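/- **Conventions.** Permutations are finitely supported permutations of $\{1,2,3,\dots\}$; $s_c$ is the transposition of $c$ and $c+1$, and $\ell(\pi)$ is the number of inversions. A (reduced) *bumpless pipe dream* (BPD) is a tiling of the quadrant (rows numbered downwards, columns to the right, both from $1$) by the six tiles blank, elbow joining south and east ("r-elbow"), elbow joining west and north ("j-elbow"), horizontal, vertical, cross, such that strands match along edges, no strand meets the top or left border, two pipes cross at most once, and outside a finite square the tiling is that of the identity (pipe $i$ runs up column $i$, turns at $(i,i)$, and runs east along row $i$). Pipe $p$ is the one that comes up in column $p$; $D\in\operatorname{BPD}(\pi)$ if pipe $\pi(r)$ exits east along row $r$ for every $r$. *Right insertion* $D\leftarrow\binom bk$. Let $(i,j)$ be the rightmost r-elbow of row $b$. (1) Perform the min-droop at $(i,j)$: droop the pipe turning from south to east at $(i,j)$ into $(x,y)$, where $x>i$ and $y>j$ are minimal such that $(x,j)$ and $(i,y)$ are not crosses. (2) If $(x,y)$ becomes a j-elbow, replace $(i,j)$ by the nearest r-elbow to its left in row $x$ and go to (1). (3) Otherwise $(x,y)$ becomes a bump (both elbows). If its two pipes cross somewhere, exchange this cross with the bump, replace $(i,j)$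 by the new position of the bump and go to (1). If they do not cross, let $p$ be the pipe turning from south to east at $(x,y)$: if $p$ exits from a row $\le k$, replace $(i,j)$ by $(x,y)$ and go to (1); otherwise replace the bump by a cross and stop. For a biword $Q=\binom{b_1\cdots b_\ell}{k_1\cdots k_\ell}$, $\varphi(Q)$ is the BPD obtained from the identity BPD by successive right insertion of $\binom{b_1}{k_1},\dots,\binom{b_\ell}{k_\ell}$. *Gao–Huang bijection.* For a BPD $D$ of a non-identity permutation, $\nabla D$ and $\operatorname{pop}(D)=(a,r)$ are given by jeu de taquin: let $r$ be the first row with a blank tile, and mark the rightmost blank tile of row $r$. Move the mark to the right end of its block of contiguous blank tiles, say to $(x,y)$, and let $p$ be the pipe through $(x,y+1)$. If $p\neq y+1$, let $(x',y+1)$ be the j-elbow of $p$ in column $y+1$; undroop $p$ at $(x',y+1)$ into $(x,y)$, drooping each pipe that has an r-elbow at $(z,y)$ and a j-elbow at $(z',y)$ with $x<z<z'<x'$ so that these elbows move to $(z,y+1)$ and $(z',y+1)$; move the mark to $(x',y+1)$ and repeat. If $p=y+1$, the pipes $y$ and $y+1$ cross at some $(x',y+1)$ with $x'>x$; replace this cross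 by a bump, undroop its j-elbow into $(x,y)$ in the same fashion, and stop with $a=y$. The bijection sends $D$ to the sequence $\operatorname{pop}(D),\operatorname{pop}(\nabla D),\operatorname{pop}(\nabla^2D),\dots$, ending when the identity BPD is reached. A *bounded reduced compatible sequence* of $\pi$ is a pair of integer sequences $(a_1,\dots,a_m)$, $(r_1,\dots,r_m)$ such that $s_{a_1}\cdots s_{a_m}=\pi$ with $m=\ell(\pi)$, $r_1\le\cdots\le r_m$, $1\le r_j\le a_j$ for all $j$, and $r_j<r_{j+1}$ whenever $a_j<a_{j+1}$. **Theorem.** Let $Q=\binom{b_1\cdots b_\ell}{k_1\cdots k_\ell}$ be a plactic biword, that is, $1\le b_i\le k_i$ for all $i$ and $k_1\ge\cdots\ge k_\ell$. Let $a=\max_i b_i$ ($a=0$ if $\ell=0$). Then $\varphi(Q)$ is well defined, and $Q$ has a growth diagram $(\pi_{i,j})_{0\le i\le a,\,0\le j\le\ell}$: for all $i,j$, $\pi_{i,j}$ is the permutation of the BPD $\varphi(w(i,j))$, where $w(i,j)$ is the biword of the biletters $\binom{b_s}{k_s}$ with $s\le j$ and $b_s>i$. Moreover, $\varphi(Q)\in\operatorname{BPD}(\pi_{0,\ell})$,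 $\pi_{a,\ell}=\mathrm{id}$, and for each $1\le i\le a$ there is exactly one sequence $c_{i,1}>\cdots>c_{i,m_i}\geq 1$ (with $m_i\ge 0$) such that $$\pi_{i-1,\ell}=s_{c_{i,1}}s_{c_{i,2}}\cdots s_{c_{i,m_i}}\,\pi_{i,\ell}.$$ The sequence $$\binom{\mathbf a}{\mathbf r}=\begin{pmatrix} c_{1,1}&\cdots&c_{1,m_1}&c_{2,1}&\cdots&c_{2,m_2}&\cdots&c_{a,1}&\cdots&c_{a,m_a}\\ 1&\cdots&1&2&\cdots&2&\cdots&a&\cdots&a\end{pmatrix},$$ which is thus uniquely determined by the chain $\mathrm{id}=\pi_{a,\ell},\dots,\pi_{1,\ell},\pi_{0,\ell}$, is a bounded reduced compatible sequence of $\pi_{0,\ell}$, and it is the image of $\varphi(Q)$ under the Gao–Huang bijection. -/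

import Mathlib

namespace BPD

/-- The six tiles of a bumpless pipe dream, and the bump tile that occurs during insertion.
`rElbow` joins the south and east edges, `jElbow` joins the west and north edges,
and `bump` contains both of these turns. -/
inductive Tile where
  | blank | rElbow | jElbow | horiz | vert | cross | bump
  deriving DecidableEq

namespace Tile

/-- A pipe crosses the north edge of the tile. -/
def hasN : Tile → Bool
  | jElbow | vert | cross | bump => true
  | _ => false

/-- A pipe crosses the south edge of the tile. -/
def hasS : Tile → Bool
  | rElbow | vert | cross | bump => true
  | _ => false

/-- A pipe crosses the west edge of the tile. -/
def hasW : Tile → Bool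
  | jElbow | horiz | cross | bump => true
  | _ => false

/-- A pipe crosses the east edge of the tile. -/
def hasE : Tile → Bool
  | rElbow | horiz | cross | bump => true
  | _ => false

/-- Add a vertical strand. -/
def addVert : Tile → Tile
  | blank => vert
  | horiz => cross
  | t => t

/-- Add a horizontal strand. -/
def addHoriz : Tile → Tile
  | blank => horiz
  | vert => cross
  | t => t

/-- Remove the vertical strand. -/
def removeVert : Tile → Tile
  | vert => blank
  | cross => horiz
  | t => t

/-- Remove the horizontal strand. -/
def removeHoriz : Tile → Tile
  | horiz => blank
  | cross => vert
  | t => t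

end Tile

open Tile

/-- Tilings of the quadrant. Rows are numbered `1, 2, 3, …` from top to bottom and columns
`1, 2, 3, …` from left to right: `T i j` is the tile in row `i` and column `j`. Row `0` and
column `0` are a margin that is kept blank. -/
abbrev Tiling := ℕ → ℕ → Tile

/-- The bumpless pipe dream of the identity: pipe `i` turns once, at `(i, i)`. -/
def idTiling : Tiling := fun i j =>
  if i = 0 ∨ j = 0 then blank
  else if i = j then rElbow
  else if i < j then horiz
  else vert

/-- Replace the tile at `(x, y)` by `t`. -/
def setTile (T : Tiling) (x y : ℕ) (t : Tile) : Tiling := fun i j =>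
  if i = x ∧ j = y then t else T i j

/-- The edge through which a pipe enters a tile; pipes run from south to east. -/
inductive Side where
  | south | west

/-- `Enters T p i j e`: the pipe `p` of `T` enters the tile `(i, j)` through its edge `e`.
The pipe `p` is the one that comes up from infinity in column `p`. -/
inductive Enters (T : Tiling) (p : ℕ) : ℕ → ℕ → Side → Prop
  | start {i : ℕ} (h : ∀ i', i < i' → T i' p = vert) : Enters T p i p .south
  | south_north {i j : ℕ} (h : Enters T p (i + 1) j .south)
      (ht : T (i + 1) j = vert ∨ T (i + 1) j = cross) : Enters T p i j .south
  | west_north {i j : ℕ} (h : Enters T p (i + 1) j .west)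
      (ht : T (i + 1) j = jElbow ∨ T (i + 1) j = bump) : Enters T p i j .south
  | south_east {i j : ℕ} (h : Enters T p i j .south)
      (ht : T i j = rElbow ∨ T i j = bump) : Enters T p i (j + 1) .west
  | west_east {i j : ℕ} (h : Enters T p i j .west)
      (ht : T i j = horiz ∨ T i j = cross) : Enters T p i (j + 1) .west

/-- The pipe `p` finally runs east along row `r`. -/
def ExitsRow (T : Tiling) (p r : ℕ) : Prop :=
  ∃ m, ∀ j, m ≤ j → Enters T p r j .west

/-- The pipes `p` and `q` cross at `(i, j)`. -/
def CrossAt (T : Tiling) (p q i j : ℕ) : Prop :=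
  T i j = cross ∧
    ((Enters T p i j .west ∧ Enters T q i j .south) ∨
      (Enters T p i j .south ∧ Enters T q i j .west))

/-- `T` is a (reduced) bumpless pipe dream of the permutation `π` of the positive integers.
A permutation of the positive integers is a permutation of `ℕ` that fixes `0`; `π r` is the
pipe that exits from row `r`. -/
structure IsBPD (T : Tiling) (π : Equiv.Perm ℕ) : Prop where
  margin_row : ∀ j, T 0 j = blank
  margin_col : ∀ i, T i 0 = blank
  match_vert : ∀ i j, (T i j).hasS = (T (i + 1) j).hasN
  match_horiz : ∀ i j, (T i j).hasE = (T i (j + 1)).hasW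
  no_bump : ∀ i j, T i j ≠ bump
  finitary : ∃ n, ∀ i j, n < i ∨ n < j → T i j = idTiling i j
  reduced : ∀ p q i j i' j', p ≠ q → CrossAt T p q i j → CrossAt T p q i' j' →
    i = i' ∧ j = j'
  map_zero : π 0 = 0
  exits : ∀ r, 1 ≤ r → ExitsRow T (π r) r

/-! ### Right insertion -/

/-- The smallest rectangle in which the pipe that turns from south to east at `(i, j)` can
droop: its south-east corner is `(x, y)`. -/
structure IsMinDroop (T : Tiling) (i j x y : ℕ) : Prop where
  row_lt : i < x
  col_lt : j < y
  row_stop : T x j ≠ cross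
  col_stop : T i y ≠ cross
  row_cross : ∀ z, i < z → z < x → T z j = cross
  col_cross : ∀ z, j < z → z < y → T i z = cross

/-- Droop the pipe that turns from south to east at `(i, j)` into `(x, y)`. -/
def droop (T : Tiling) (i j x y : ℕ) : Tiling := fun a b =>
  if a = i ∧ b = j then
    match T a b with
    | rElbow => blank
    | bump => jElbow
    | t => t
  else if a = x ∧ b = j then
    match T a b with
    | vert => rElbow
    | jElbow => horiz
    | t => t
  else if a = i ∧ b = y then
    match T a b with
    | horiz => rElbow
    | jElbow => vert
    | t => t
  else if a = x ∧ b = y then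
    match T a b with
    | blank => jElbow
    | rElbow => bump
    | t => t
  else if a = i ∧ j < b ∧ b < y then (T a b).removeHoriz
  else if b = j ∧ i < a ∧ a < x then (T a b).removeVert
  else if a = x ∧ j < b ∧ b < y then (T a b).addHoriz
  else if b = y ∧ i < a ∧ a < x then (T a b).addVert
  else T a b

/-- `InsertRun k T i j T'`: the right insertion procedure with bound `k`, when it is about to
droop the pipe turning at `(i, j)` in `T`, terminates with result `T'`.  In each constructor `U`
is the tiling after the min-droop, which ends at `(x, y)`. -/
inductive InsertRun (k : ℕ) : Tiling → ℕ → ℕ → Tiling → Prop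
  /-- `(x, y)` becomes a `jElbow`: continue at the nearest `rElbow` to the left. -/
  | left {T U T' : Tiling} {i j x y y' : ℕ} (hd : IsMinDroop T i j x y)
      (hU : U = droop T i j x y) (ht : U x y = jElbow)
      (hlt : y' < y) (hr : U x y' = rElbow) (hmax : ∀ z, y' < z → z < y → U x z ≠ rElbow)
      (next : InsertRun k U x y' T') : InsertRun k T i j T'
  /-- `(x, y)` becomes a bump of two pipes which cross at `(x', y')`: exchange the crossing
  with the bump (cross-bump-swap) and continue at `(x', y')`. -/
  | swap {T U T' : Tiling} {i j x y x' y' p q : ℕ} (hd : IsMinDroop T i j x y)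
      (hU : U = droop T i j x y) (ht : U x y = bump)
      (hq : Enters U q x y .west) (hp : Enters U p x y .south) (hc : CrossAt U p q x' y')
      (next : InsertRun k (setTile (setTile U x y cross) x' y' bump) x' y' T') :
      InsertRun k T i j T'
  /-- `(x, y)` becomes a bump of two pipes which do not cross, and the pipe `p` that turns
  from south to east exits from a row `r ≤ k`: continue at `(x, y)`. -/
  | pass {T U T' : Tiling} {i j x y p q r : ℕ} (hd : IsMinDroop T i j x y)
      (hU : U = droop T i j x y) (ht : U x y = bump)
      (hq : Enters U q x y .west) (hp : Enters U p x y .south)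
      (hc : ∀ x' y', ¬ CrossAt U p q x' y')
      (he : ExitsRow U p r) (hr : r ≤ k)
      (next : InsertRun k U x y T') : InsertRun k T i j T'
  /-- As before, but `p` exits from a row `r > k`: replace the bump by a crossing and stop. -/
  | halt {T U : Tiling} {i j x y p q r : ℕ} (hd : IsMinDroop T i j x y)
      (hU : U = droop T i j x y) (ht : U x y = bump)
      (hq : Enters U q x y .west) (hp : Enters U p x y .south)
      (hc : ∀ x' y', ¬ CrossAt U p q x' y')
      (he : ExitsRow U p r) (hr : k < r) : InsertRun k T i j (setTile U x y cross)

/-- `T'` is the result `T ← (b, k)` of the right insertion of the biletter `(b, k)` into `T`;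
the procedure starts at the rightmost `rElbow` of row `b`. -/
def RightInsert (T : Tiling) (b k : ℕ) (T' : Tiling) : Prop :=
  ∃ j, T b j = rElbow ∧ (∀ j', j < j' → T b j' ≠ rElbow) ∧ InsertRun k T b j T'

/-- A biword is a list of biletters `(b, k)`.  `InsertWord T Q T'`: the successive right
insertion of the biletters of `Q`, from left to right, turns `T` into `T'`. -/
def InsertWord : Tiling → List (ℕ × ℕ) → Tiling → Prop
  | T, [], T' => T' = T
  | T, x :: Q, T' => ∃ U, RightInsert T x.1 x.2 U ∧ InsertWord U Q T'

/-- `D` is the insertion bumpless pipe dream `φ(Q)`. -/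
def IsInsertionBPD (Q : List (ℕ × ℕ)) (D : Tiling) : Prop :=
  InsertWord idTiling Q D

/-! ### Jeu de taquin and the bijection of Gao and Huang -/

/-- The modification of columns `y`, `y + 1` between rows `x` and `x'` in a step of jeu de taquin:
the turn from west to north at `(x', y + 1)` is undrooped into the blank tile `(x, y)`, and each
pipe that makes the turns `rElbow` at `(z, y)` and `jElbow` at `(z', y)`, `x < z < z' < x'`, is
drooped so that these turns move to `(z, y + 1)` and `(z', y + 1)`.  If `(x', y + 1)` is a
crossing, it is first replaced by a bump, so that after the step it is an `rElbow`. -/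
def undroop (T : Tiling) (x y x' : ℕ) : Tiling := fun i j =>
  if j = y then
    if i = x then rElbow
    else if i = x' then
      match T i y with
      | horiz => jElbow
      | rElbow => vert
      | t => t
    else if x < i ∧ i < x' then
      match T i y with
      | rElbow => vert
      | jElbow => cross
      | t => t.addVert
    else T i j
  else if j = y + 1 then
    if i = x then
      match T i (y + 1) with
      | rElbow => horiz
      | vert => jElbow
      | t => t
    else if i = x' then
      match T i (y + 1) with
      | jElbow => blank
      | cross => rElbow
      | t => t
    else if x < i ∧ i < x' then
      match T i y with
      | rElbow => rElbow
      | jElbow => jElbow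
      | blank => (T i (y + 1)).removeVert
      | horiz => (T i (y + 1)).removeVert
      | _ => T i (y + 1)
    else T i j
  else T i j

/-- `(x, y')` is the last tile of the contiguous block of blank tiles of row `x` that
contains `(x, y)`. -/
def IsBlockEnd (T : Tiling) (x y y' : ℕ) : Prop :=
  y ≤ y' ∧ (∀ z, y ≤ z → z ≤ y' → T x z = blank) ∧ T x (y' + 1) ≠ blank

/-- `JdtRun T x y a T'`: jeu de taquin with mark at the blank tile `(x, y)` of `T` terminates
with result `T'`, its last step uncrossing the pipes `a` and `a + 1`. -/
inductive JdtRun : Tiling → ℕ → ℕ → ℕ → Tiling → Prop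
  /-- The pipe `p` of `(x, y' + 1)` is not `y' + 1`: undroop it at its `jElbow` in column
  `y' + 1`, and move the mark there. -/
  | step {T T' : Tiling} {x y y' x' p a : ℕ} (hb : IsBlockEnd T x y y')
      (hp : Enters T p x (y' + 1) .south) (hne : p ≠ y' + 1)
      (hlt : x < x') (ht : T x' (y' + 1) = jElbow) (hp' : Enters T p x' (y' + 1) .west)
      (next : JdtRun (undroop T x y' x') x' (y' + 1) a T') : JdtRun T x y a T'
  /-- The pipe of `(x, y' + 1)` is `y' + 1`: uncross the pipes `y'` and `y' + 1`. -/
  | uncross {T : Tiling} {x y y' x' : ℕ} (hb : IsBlockEnd T x y y')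
      (hp : Enters T (y' + 1) x (y' + 1) .south)
      (hlt : x < x') (hc : CrossAt T y' (y' + 1) x' (y' + 1)) :
      JdtRun T x y y' (undroop T x y' x')

/-- `Nabla D a r D'`: `∇ D = D'` and `pop D = (a, r)`.  Jeu de taquin starts at the rightmost
blank tile of the first row `r` that has blank tiles. -/
def Nabla (D : Tiling) (a r : ℕ) (D' : Tiling) : Prop :=
  1 ≤ r ∧ (∀ i j, 1 ≤ i → i < r → 1 ≤ j → D i j ≠ blank) ∧
    ∃ y, 1 ≤ y ∧ D r y = blank ∧ (∀ y', y < y' → D r y' ≠ blank) ∧ JdtRun D r y a D'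

/-- `GaoHuang D L`: the list `L` of pairs `(a_j, r_j)` is `pop D, pop (∇ D), pop (∇² D), …`,
up to the step where the identity is reached.  This is the image of `D` under the bijection
of Gao and Huang. -/
def GaoHuang : Tiling → List (ℕ × ℕ) → Prop
  | D, [] => D = idTiling
  | D, x :: L => ∃ D', Nabla D x.1 x.2 D' ∧ GaoHuang D' L

/-! ### Compatible sequences -/

/-- The product `s_{c_1} s_{c_2} ⋯` of simple reflections, where `s_c` exchanges `c` and
`c + 1`. -/
def wordProd (c : List ℕ) : Equiv.Perm ℕ :=
  (c.map fun i => Equiv.swap i (i + 1)).prod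

/-- The length of a permutation: its number of inversions. -/
noncomputable def permLength (π : Equiv.Perm ℕ) : ℕ :=
  {x : ℕ × ℕ | x.1 < x.2 ∧ π x.2 < π x.1}.ncard

/-- The list `L` of pairs `(a_j, r_j)` is a bounded reduced compatible sequence of `π`. -/
structure IsCompatibleSeq (π : Equiv.Perm ℕ) (L : List (ℕ × ℕ)) : Prop where
  prod_eq : wordProd (L.map Prod.fst) = π
  reduced : L.length = permLength π
  bounded : ∀ x ∈ L, 1 ≤ x.2 ∧ x.2 ≤ x.1
  compatible : L.IsChain fun x y => x.2 ≤ y.2 ∧ (x.1 < y.1 → x.2 < y.2)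

/-! ### Growth diagrams -/

/-- A plactic biword: `1 ≤ b ≤ k` for each biletter `(b, k)`, and the `k`'s weakly decrease. -/
def IsPlactic (Q : List (ℕ × ℕ)) : Prop :=
  (∀ x ∈ Q, 1 ≤ x.1 ∧ x.1 ≤ x.2) ∧ Q.Pairwise fun x y => y.2 ≤ x.2

/-- The largest letter `b` of a biword (`0` for the empty biword). -/
def maxLetter (Q : List (ℕ × ℕ)) : ℕ :=
  (Q.map Prod.fst).foldr max 0

/-- The biword `w(i, j)`: the biletters `(b, k)` with `b > i` among the first `j` ones. -/
def subword (Q : List (ℕ × ℕ)) (i j : ℕ) : List (ℕ × ℕ) :=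
  (Q.take j).filter fun x => i < x.1

/-- `π i j` (`0 ≤ i ≤ a`, `0 ≤ j ≤ ℓ`) is the growth diagram of `Q`: `π i j` is the permutation
of the insertion bumpless pipe dream of `w(i, j)`. -/
def IsGrowthDiagram (Q : List (ℕ × ℕ)) (π : ℕ → ℕ → Equiv.Perm ℕ) : Prop :=
  ∀ i ≤ maxLetter Q, ∀ j ≤ Q.length,
    ∃ D, IsInsertionBPD (subword Q i j) D ∧ IsBPD D (π i j)

/-- `s` expresses the steps of a chain `ρ 0, ρ 1, …, ρ a` of permutations:
`ρ i = s_{c_1} ⋯ s_{c_m} ρ (i + 1)` with `c_1 > ⋯ > c_m ≥ 1`, where `s i = [c_1, …, c_m]`. -/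
def IsChainLetters {a : ℕ} (ρ : ℕ → Equiv.Perm ℕ) (s : Fin a → List ℕ) : Prop :=
  ∀ i : Fin a, (s i).Pairwise (fun c d => d < c) ∧ (∀ c ∈ s i, 1 ≤ c) ∧
    ρ i = wordProd (s i) * ρ (i + 1)

/-- The letters of `s 0, s 1, …, s (a - 1)` in this order, those of `s i` paired with the
row `i + 1`. -/
def labeledWord {a : ℕ} (s : Fin a → List ℕ) : List (ℕ × ℕ) :=
  (List.finRange a).flatMap fun i => (s i).map fun c => (c, (i : ℕ) + 1)

end BPD

/-! Label every edge of a bumpless pipe dream by the row from which its pipe exits. The horizontal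
labels of a row are forced by the two lines of vertical labels bounding it (`Row.w_eq`), so a pipe
dream amounts to its sequence of lines `v i`. Labels make reducedness local: it is enough that at
each crossing the horizontal pipe has the larger label (`Lab.cross_unique`). `Lab k` requires in
addition that this larger label exceeds `k`. Insertion with bound `k` preserves `Lab k`
(`Lab.exists_ins`), and since the bounds of a plactic biword weakly decrease, `Lab` is available
with the right bound at each insertion.

In this language both algorithms act on each line by one transposition. Below row `b`, the insertion
of `(b, k)` is either active (a pipe with label at most `k` is pushed into the empty column on its
right) or dormant (two pipes exchange labels, from a newly made crossing down to the old crossing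
that it replaces, or for ever). Droops, bumps and cross-bump swaps are the transitions of this
automaton (`Ins.rightInsert_iff`). Jeu de taquin from row `r` exchanges two adjacent columns of
every line below row `r` (`JCert.nabla_iff`).

The heart is that jeu de taquin from row `r` commutes with insertion into a row `b ≥ r`
(`JCert.commute`). The insertions before and after jeu de taquin are run side by side, one row at a
time: `Sync` lists their possible relative positions, `Sync.next` passes from one line to the next,
and `Sync.perm` closes the square of transpositions. The second ingredient is `JCert.of_ins`: when
rows `1, …, r` have no blank tile, an insertion into row `r` is undone by a single jeu de taquin
from row `r`.

Let `V r` be the labels for the subword of letters greater than `r`, and append a letter `b` to the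
biword. The chain of jeux de taquin from `V r` to `V (r + 1)`, all starting in row `r + 1`, is
transported by commutation if `r + 1 < b`, is transported and gains one step at its end if `r + 1 =
b`, and is untouched otherwise. Hence such chains always exist (`exists_growth`), and their
concatenation is the run of the Gao–Huang bijection.

Successive jeux de taquin from one row end in strictly decreasing columns (`JCert.col_lt`), and one
that ends in column `A` removes a left factor `s_A` and one inversion (`JCert.perm`,
`permLength_swap_mul`). So the end columns are letters as required, and they are the only ones
because a strictly decreasing word is determined by its product (`wordProd_injective_of_pairwise`).
-/

namespace BPD

/-! ### Edge labels and the tracing of pipes through a row -/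

/-- The rule for the labels `n`, `s`, `w`, `x` of the north, south, west and east edges of a tile.
The label of an edge is the row from which its pipe exits, and `0` if there is no pipe. In a
crossing the horizontal pipe exits below the vertical one, and below row `k`. -/
def Vx (k n s w x : ℕ) : Prop :=
  (n = 0 ∧ s = 0 ∧ w = x) ∨ (n = s ∧ w = 0 ∧ x = 0) ∨ (n = 0 ∧ w = 0 ∧ s = x) ∨
  (s = 0 ∧ x = 0 ∧ n = w) ∨ (n = s ∧ w = x ∧ 0 < s ∧ s < w ∧ k < w)

/-- The labels of the north, south and west edges of the tiles of a row. -/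
structure Row (k : ℕ) (n s w : ℕ → ℕ) : Prop where
  w_zero : w 0 = 0
  n_zero : n 0 = 0
  s_zero : s 0 = 0
  vx : ∀ c, Vx k (n c) (s c) (w c) (w (c + 1))

/-- `v i j` and `h i j` are the labels of the north and west edges of the tile `(i, j)` of a
bumpless pipe dream in which no pipe that exits from one of the rows `1, …, k` crosses another
pipe horizontally. -/
structure Lab (k : ℕ) (v h : ℕ → ℕ → ℕ) : Prop where
  row : ∀ i, Row k (v i) (v (i + 1)) (h i)
  v_zero : ∀ j, v 0 j = 0
  v_one : ∀ j, v 1 j = 0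
  h_zero : ∀ j, h 0 j = 0
  far : ∃ N, (∀ i j, N ≤ i ∨ N ≤ j → (v i j ≠ 0 ↔ 1 ≤ j ∧ j < i)) ∧
    ∀ i j, 1 ≤ i → i < j → N ≤ j → h i j = i

theorem Vx.mono {k k' n s w x : ℕ} (hk : k' ≤ k) (h : Vx k n s w x) : Vx k' n s w x := by
  unfold Vx at *; omega

theorem Row.mono {k k' : ℕ} {n s w : ℕ → ℕ} (hk : k' ≤ k) (h : Row k n s w) : Row k' n s w :=
  ⟨h.w_zero, h.n_zero, h.s_zero, fun c => (h.vx c).mono hk⟩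

theorem Lab.mono {k k' : ℕ} {v h : ℕ → ℕ → ℕ} (hk : k' ≤ k) (H : Lab k v h) : Lab k' v h :=
  ⟨fun i => (H.row i).mono hk, H.v_zero, H.v_one, H.h_zero, H.far⟩

section Row

variable {k : ℕ} {n s w : ℕ → ℕ}

theorem Row.straight (R : Row k n s w) {c : ℕ} (hn : n c ≠ 0) (hs : s c ≠ 0) : s c = n c := by
  have := R.vx c
  unfold Vx at this; omega

/-- The tiles strictly between the ends of a horizontal segment with label `a`. -/
def Between (k a : ℕ) (n s : ℕ → ℕ) (c d : ℕ) : Prop :=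
  ∀ z, c < z → z < d → n z = s z ∧ (n z ≠ 0 → n z < a ∧ k < a)

/-- A horizontal edge is traced back to the `rElbow` at the left end of its segment. -/
theorem Row.back (R : Row k n s w) {c : ℕ} (hw : w c ≠ 0) :
    ∃ d, d < c ∧ s d = w c ∧ n d = 0 ∧ w d = 0 ∧ (∀ z, d < z → z ≤ c → w z = w c) ∧
      Between k (w c) n s d c := by
  induction c with
  | zero => exact absurd R.w_zero hw
  | succ c ih =>
    have hv := R.vx c
    by_cases hc : w c = w (c + 1)
    · obtain ⟨d, h1, h2, h3, h4, h5, h6⟩ := ih (hc ▸ hw)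
      clear ih
      refine ⟨d, by omega, by omega, h3, h4, fun z hz hz' => ?_, fun z hz hz' => ?_⟩
      · rcases Nat.lt_or_ge z (c + 1) with h | h
        · rw [h5 z hz (by omega), hc]
        · rw [show z = c + 1 by omega]
      · rw [← hc]
        rcases Nat.lt_or_ge z c with h | h
        · exact h6 z hz h
        · rw [show z = c by omega]
          unfold Vx at hv; omega
    · refine ⟨c, by omega, ?_, ?_, ?_, fun z hz hz' => ?_, fun z hz hz' => by omega⟩
      · unfold Vx at hv; omega
      · unfold Vx at hv; omega
      · unfold Vx at hv; omega
      · rw [show z = c + 1 by omega]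

/-- A pipe at a north edge is traced back to the south edge through which it enters the row. -/
theorem Row.down (R : Row k n s w) {c : ℕ} (hn : n c ≠ 0) :
    (s c = n c ∧ w c = w (c + 1)) ∨ ∃ d, d < c ∧ s d = n c ∧ n d = 0 ∧ w d = 0 ∧ s c = 0 ∧ w (c + 1) = 0 ∧
      (∀ z, d < z → z ≤ c → w z = n c) ∧ Between k (n c) n s d c := by
  have hv := R.vx c
  by_cases hs : s c = 0
  · have hw : w c = n c := by unfold Vx at hv; omega
    obtain ⟨d, h1, h2, h3, h4, h5, h6⟩ := R.back (c := c) (by omega)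
    rw [hw] at h2 h5 h6
    exact Or.inr ⟨d, h1, h2, h3, h4, hs, by unfold Vx at hv; omega, h5, h6⟩
  · exact Or.inl ⟨R.straight hn hs, by unfold Vx at hv; omega⟩

/-- A horizontal edge is traced forward. -/
theorem Row.fwd (R : Row k n s w) {c d : ℕ} (hw : w c ≠ 0) (hcd : c ≤ d) :
    (w d = w c ∧ ∀ z, c ≤ z → z < d → n z = s z ∧ (n z ≠ 0 → n z < w c ∧ k < w c)) ∨
      ∃ z, c ≤ z ∧ z < d ∧ n z = w c ∧ s z = 0 := by
  induction d with
  | zero =>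
    obtain rfl : c = 0 := by omega
    exact absurd R.w_zero hw
  | succ d ih =>
    rcases Nat.lt_or_ge d c with h | h
    · obtain rfl : c = d + 1 := by omega
      exact Or.inl ⟨rfl, fun z h1 h2 => by omega⟩
    · rcases ih h with ⟨h1, h2⟩ | ⟨z, h1, h2, h3, h4⟩
      · have hv := R.vx d
        by_cases hE : w (d + 1) = w c
        · clear ih
          refine Or.inl ⟨hE, fun z hz hz' => ?_⟩
          rcases Nat.lt_or_ge z d with h' | h'
          · exact h2 z hz h'
          · rw [show z = d by omega]
            unfold Vx at hv; omega
        · exact Or.inr ⟨d, h, by omega, by unfold Vx at hv; omega, by unfold Vx at hv; omega⟩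
      · exact Or.inr ⟨z, h1, by omega, h3, h4⟩


end Row

/-! ### Right insertion through one row -/

/-- The state of the right insertion at a horizontal line. `act j`: the pipe at column `j` moves
to column `j + 1`. `dor u v`: the pipes at the columns `u` and `v` exchange their labels. -/
inductive St where
  | act (j : ℕ)
  | dor (u v : ℕ)

/-- The modification of a line in a given state of the insertion. -/
def St.perm : St → Equiv.Perm ℕ
  | act j => Equiv.swap j (j + 1)
  | dor u v => Equiv.swap u v

/-- The states of the insertion that can occur at a line with labels `n`. -/
def Good (k : ℕ) (n : ℕ → ℕ) : St → Prop
  | .act j => n j ≠ 0 ∧ n j ≤ k ∧ n (j + 1) = 0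
  | .dor u v => n u ≠ 0 ∧ n u ≤ k ∧ k < n v ∧ u < v ∧ ∀ z, u < z → z < v → n z = 0 ∨ n v < n z

/-- A step of the insertion, from the top line of a row, with labels `n`, to the bottom line,
with labels `s`. -/
inductive IRow (k : ℕ) (n s : ℕ → ℕ) : St → St → Prop
  | act_left {j j' : ℕ} (hj : s j' = n j) (h : s (j + 1) = 0) : IRow k n s (.act j) (.act j')
  | act_pass {j j' : ℕ} (hj : s j' = n j) (h0 : s (j + 1) ≠ 0) (h : s (j + 1) ≤ k) :
      IRow k n s (.act j) (.act (j + 1))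
  | act_rest {j j' : ℕ} (hj : s j' = n j) (h : k < s (j + 1)) :
      IRow k n s (.act j) (.dor j' (j + 1))
  | dor_act {u v u' v' : ℕ} (hu : s u' = n u) (hv : s v' = n v) (h : v' < u') :
      IRow k n s (.dor u v) (.act u')
  | dor_dor {u v u' v' : ℕ} (hu : s u' = n u) (hv : s v' = n v) (h : u' < v') :
      IRow k n s (.dor u v) (.dor u' v')

section
variable {k : ℕ} {n s w : ℕ → ℕ}

/-- A pipe that exits from one of the rows `1, …, k` is traced back. -/
theorem Row.down_small (R : Row k n s w) {c : ℕ} (hn : n c ≠ 0) (hk : n c ≤ k) :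
    (s c = n c ∧ w c = w (c + 1)) ∨ ∃ d, d < c ∧ s d = n c ∧ n d = 0 ∧ w d = 0 ∧ s c = 0 ∧
      w (c + 1) = 0 ∧ (∀ z, d < z → z ≤ c → w z = n c) ∧
      (∀ z, d < z → z < c → n z = 0 ∧ s z = 0) := by
  rcases R.down hn with h | ⟨d, h1, h2, h3, h4, h5, h6, h7, h8⟩
  · exact Or.inl h
  · refine Or.inr ⟨d, h1, h2, h3, h4, h5, h6, h7, fun z hz hz' => ?_⟩
    have := h8 z hz hz'
    omega

/-- A pipe with label at most `k` crosses nothing horizontally, so the moving pipe comes from its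
bottom column `j'` along tiles that are empty above and below. As column `j + 1` is empty at the
top, the tile there is an `rElbow` or has no vertical strand. -/
theorem Row.act_next (R : Row k n s w) {j : ℕ} (G : Good k n (.act j)) :
    ∃ j' ≤ j, s j' = n j ∧ (j' < j → n j' = 0) ∧
      (∀ z, j' < z → z ≤ j → w z = n j ∧ s z = 0) ∧ (∀ z, j' < z → z < j → n z = 0) ∧
      (j' < j → w j' = 0 ∧ w (j + 1) = 0) ∧ (j' = j → w j = w (j + 1)) ∧
      (s (j + 1) ≠ 0 → w (j + 1) = 0 ∧ w (j + 2) = s (j + 1)) ∧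
      (s (j + 1) = 0 → w (j + 2) = w (j + 1)) := by
  obtain ⟨g1, g2, g3⟩ := G
  have hv := R.vx (j + 1)
  rw [show j + 1 + 1 = j + 2 from rfl] at hv
  rcases R.down_small g1 g2 with ⟨h1, h2⟩ | ⟨d, h1, h2, h3, h4, h5, h6, h7, h8⟩
  · exact ⟨j, le_rfl, h1, fun h => by omega, fun z hz hz' => by omega, fun z hz hz' => by omega,
      fun h => by omega, fun _ => h2, fun h => by unfold Vx at hv; omega,
      fun h => by unfold Vx at hv; omega⟩
  · refine ⟨d, by omega, h2, fun _ => h3, fun z hz hz' => ⟨h7 z hz hz', ?_⟩,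
      fun z hz hz' => (h8 z hz hz').1, fun h => ⟨h4, h6⟩, fun h => by omega,
      fun h => by unfold Vx at hv; omega, fun h => by unfold Vx at hv; omega⟩
    rcases Nat.lt_or_ge z j with h | h
    · exact (h8 z hz h).2
    · rw [show z = j by omega, h5]

/-- Modified rows are checked tile by tile: name the kind of tile with one of the lemmas below, then
identify its four labels. -/
theorem Vx.congr {n s w x n' s' w' x' : ℕ} (h : Vx k n' s' w' x') (hn : n = n') (hs : s = s')
    (hw : w = w') (hx : x = x') : Vx k n s w x := by subst hn hs hw hx; exact h

theorem vx_horiz (k a : ℕ) : Vx k 0 0 a a := Or.inl ⟨rfl, rfl, rfl⟩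

theorem vx_vert (k a : ℕ) : Vx k a a 0 0 := Or.inr (Or.inl ⟨rfl, rfl, rfl⟩)

theorem vx_rElbow (k a : ℕ) : Vx k 0 a 0 a := Or.inr (Or.inr (Or.inl ⟨rfl, rfl, rfl⟩))

theorem vx_jElbow (k a : ℕ) : Vx k a 0 a 0 :=
  Or.inr (Or.inr (Or.inr (Or.inl ⟨rfl, rfl, rfl⟩)))

theorem vx_cross {k a b : ℕ} (ha : 0 < a) (hab : a < b) (hb : k < b) : Vx k a a b b :=
  Or.inr (Or.inr (Or.inr (Or.inr ⟨rfl, rfl, ha, hab, hb⟩)))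

theorem swap_ne (f : ℕ → ℕ) {a b c : ℕ} (ha : c ≠ a) (hb : c ≠ b) :
    (f ∘ Equiv.swap a b) c = f c := by
  simp [Equiv.swap_apply_of_ne_of_ne ha hb]

theorem swap_left (f : ℕ → ℕ) (a b : ℕ) : (f ∘ Equiv.swap a b) a = f b := by simp

theorem swap_right (f : ℕ → ℕ) (a b : ℕ) : (f ∘ Equiv.swap a b) b = f a := by simp

/-- The south edge in column `j + 1` decides: if it is free the same pipe goes on moving, if its
label is at most `k` that pipe takes over, and otherwise a crossing is made and the insertion
becomes dormant. In each case `w'` gives the new horizontal labels explicitly. -/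
theorem Row.act_step (R : Row k n s w) {j : ℕ} (G : Good k n (.act j)) :
    ∃ σ w', IRow k n s (.act j) σ ∧ Good k s σ ∧ Row k (n ∘ Equiv.swap j (j + 1)) (s ∘ σ.perm) w' ∧
      ∀ c, j + 2 < c → w' c = w c := by
  obtain ⟨j', hj, h1, h2, h3, h4, h5, h6, h7, h8⟩ := R.act_next G
  obtain ⟨g1, g2, g3⟩ := G
  have hj0 : 0 ≠ j' := by rintro rfl; rw [R.s_zero] at h1; omega
  have hj1 : 0 ≠ j := by rintro rfl; exact g1 R.n_zero
  have hn0 : (n ∘ Equiv.swap j (j + 1)) 0 = 0 := by rw [swap_ne n hj1 (by omega), R.n_zero]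
  have hnz : ∀ c, j' ≤ c → c ≤ j → (n ∘ Equiv.swap j (j + 1)) c = 0 := by
    intro c hc hc'
    rcases Nat.lt_or_ge c j with h | h
    · rw [swap_ne n (by omega) (by omega)]
      rcases Nat.lt_or_ge j' c with h' | h'
      · exact h4 c h' h
      · rw [show c = j' by omega]; exact h2 (by omega)
    · rw [show c = j by omega, swap_left, g3]
  have hwj : s (j + 1) ≠ 0 → w j' = 0 := by
    intro h
    rcases Nat.lt_or_ge j' j with h' | h'
    · exact (h5 h').1
    · have e : j' = j := by omega
      rw [e, h6 e, (h7 h).1]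
  by_cases hs : s (j + 1) = 0
  · rcases Nat.lt_or_ge j' j with hlt | hge
    · obtain ⟨e1, e2⟩ := h5 hlt
      -- The `rElbow` of the moving pipe goes from `j'` to `j' + 1`, its `jElbow` from `j` to `j +
      -- 1`.
      refine ⟨.act j', fun c => if c = j' + 1 then 0 else if j' + 1 < c ∧ c ≤ j + 1 then n j else w c,
        .act_left h1 hs, ⟨by omega, by omega, (h3 _ (by omega) (by omega)).2⟩,
        ⟨?_, hn0, ?_, fun c => ?_⟩, fun c hc => ?_⟩
      · simp [R.w_zero]
      · rw [St.perm, swap_ne s hj0 (by omega), R.s_zero]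
      · dsimp only [St.perm]
        rcases lt_trichotomy c j' with h | rfl | h
        · exact (R.vx c).congr (swap_ne n (by omega) (by omega)) (swap_ne s (by omega) (by omega))
            (by rw [if_neg (by omega), if_neg (by omega)])
            (by rw [if_neg (by omega), if_neg (by omega)])
        · exact (vx_horiz k 0).congr (hnz c le_rfl hj)
            (by rw [swap_left, (h3 (c + 1) (by omega) (by omega)).2])
            (by rw [if_neg (by omega), if_neg (by omega), e1]) (by rw [if_pos rfl])
        · rcases Nat.lt_or_ge j c with h' | h'
          · rcases Nat.lt_or_ge (j + 1) c with h'' | h''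
            · exact (R.vx c).congr (swap_ne n (by omega) (by omega)) (swap_ne s (by omega) (by omega))
                (by rw [if_neg (by omega), if_neg (by omega)])
                (by rw [if_neg (by omega), if_neg (by omega)])
            · obtain rfl : c = j + 1 := by omega
              exact (vx_jElbow k (n j)).congr (swap_right n _ _)
                (by rw [swap_ne s (by omega) (by omega), hs])
                (by rw [if_neg (by omega), if_pos (by omega)])
                (by rw [if_neg (by omega), if_neg (by omega), h8 hs, e2])
          · by_cases hc : c = j' + 1
            · subst hc
              exact (vx_rElbow k (n j)).congr (hnz _ (by omega) h') (by rw [swap_right, h1])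
                (by rw [if_pos rfl]) (by rw [if_neg (by omega), if_pos (by omega)])
            · exact (vx_horiz k (n j)).congr (hnz _ (by omega) h')
                (by rw [swap_ne s (by omega) (by omega), (h3 c h h').2])
                (by rw [if_neg (by omega), if_pos (by omega)])
                (by rw [if_neg (by omega), if_pos (by omega)])
      · dsimp only; rw [if_neg (by omega), if_neg (by omega)]
    · obtain rfl : j' = j := by omega
      -- The pipe runs straight, possibly through a crossing: columns `j` and `j + 1` trade tiles
      -- and no horizontal label changes.
      refine ⟨.act j', w, .act_left h1 hs, ⟨by omega, by omega, hs⟩,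
        ⟨R.w_zero, hn0, ?_, fun c => ?_⟩, fun c hc => rfl⟩
      · rw [St.perm, swap_ne s hj0 (by omega), R.s_zero]
      · dsimp only [St.perm]
        by_cases hc : c = j'
        · subst hc
          exact (vx_horiz k (w c)).congr (by rw [swap_left, g3]) (by rw [swap_left, hs]) rfl
            (h6 rfl).symm
        · by_cases hc' : c = j' + 1
          · subst hc'
            exact (R.vx j').congr (swap_right n _ _) (swap_right s _ _) (h6 rfl).symm (h8 hs)
          · exact (R.vx c).congr (swap_ne n hc hc') (swap_ne s hc hc') rfl rfl
  · obtain ⟨e1, e2⟩ := h7 hs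
    by_cases hk : s (j + 1) ≤ k
    · have hv := R.vx (j + 2)
      -- The west edge of this tile has label `s (j + 1) ≤ k`, and such a pipe crosses nothing
      -- horizontally.
      have hs2 : s (j + 2) = 0 := by
        unfold Vx at hv; omega
      -- The moving pipe now turns north in column `j + 1`; the pipe that had its `rElbow` there is
      -- shifted to column `j + 2` and becomes the moving one.
      refine ⟨.act (j + 1), fun c => if j' < c ∧ c ≤ j + 1 then n j else if c = j + 2 then 0 else w c,
        .act_pass h1 hs hk, ⟨by omega, by omega, hs2⟩, ⟨?_, hn0, ?_, fun c => ?_⟩, fun c hc => ?_⟩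
      · simp [R.w_zero]
      · rw [St.perm, swap_ne s (by omega) (by omega), R.s_zero]
      · dsimp only [St.perm]
        rcases lt_trichotomy c j' with h | rfl | h
        · exact (R.vx c).congr (swap_ne n (by omega) (by omega)) (swap_ne s (by omega) (by omega))
            (by rw [if_neg (by omega), if_neg (by omega)])
            (by rw [if_neg (by omega), if_neg (by omega)])
        · exact (vx_rElbow k (n j)).congr (hnz c le_rfl hj)
            (by rw [swap_ne s (by omega) (by omega), h1])
            (by rw [if_neg (by omega), if_neg (by omega), hwj hs]) (by rw [if_pos (by omega)])
        · rcases Nat.lt_or_ge j c with h' | h'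
          · rcases Nat.lt_or_ge (j + 1) c with h'' | h''
            · by_cases hc : c = j + 2
              · subst hc
                have : Vx k (n (j + 2)) (s (j + 1)) 0 (w (j + 2 + 1)) := by
                  clear h7 h8 h6 h5 h2 hwj
                  unfold Vx at *; omega
                exact this.congr (swap_ne n (by omega) (by omega)) (swap_right s _ _)
                  (by rw [if_neg (by omega), if_pos rfl]) (by rw [if_neg (by omega), if_neg (by omega)])
              · exact (R.vx c).congr (swap_ne n (by omega) (by omega))
                  (swap_ne s (by omega) (by omega))
                  (by rw [if_neg (by omega), if_neg (by omega)])
                  (by rw [if_neg (by omega), if_neg (by omega)])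
            · obtain rfl : c = j + 1 := by omega
              exact (vx_jElbow k (n j)).congr (swap_right n _ _)
                (by rw [swap_left, hs2]) (by rw [if_pos (by omega)])
                (by rw [if_neg (by omega), if_pos rfl])
          · exact (vx_horiz k (n j)).congr (hnz _ (by omega) h')
              (by rw [swap_ne s (by omega) (by omega), (h3 c h h').2])
              (by rw [if_pos (by omega)]) (by rw [if_pos (by omega)])
      · dsimp only; rw [if_neg (by omega), if_neg (by omega)]
    -- A crossing appears in column `j + 1`: the pipe with label `s (j + 1) > k` now starts in
    -- column `j'` and runs through it, so below this row the two pipes have traded places.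
    · refine ⟨.dor j' (j + 1), fun c => if j' < c ∧ c ≤ j + 1 then s (j + 1) else w c,
        .act_rest h1 (by omega), ⟨by omega, by omega, by omega, by omega, ?_⟩,
        ⟨?_, hn0, ?_, fun c => ?_⟩, fun c hc => ?_⟩
      · exact fun z hz hz' => Or.inl (h3 z hz (by omega)).2
      · simp [R.w_zero]
      · rw [St.perm, swap_ne s (by omega) (by omega), R.s_zero]
      · dsimp only [St.perm]
        rcases lt_trichotomy c j' with h | rfl | h
        · exact (R.vx c).congr (swap_ne n (by omega) (by omega)) (swap_ne s (by omega) (by omega))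
            (by rw [if_neg (by omega)]) (by rw [if_neg (by omega)])
        · exact (vx_rElbow k (s (j + 1))).congr (hnz c le_rfl hj) (swap_left s _ _)
            (by rw [if_neg (by omega), hwj hs]) (by rw [if_pos (by omega)])
        · rcases Nat.lt_or_ge j c with h' | h'
          · rcases Nat.lt_or_ge (j + 1) c with h'' | h''
            · exact (R.vx c).congr (swap_ne n (by omega) (by omega))
                (swap_ne s (by omega) (by omega)) (by rw [if_neg (by omega)])
                (by rw [if_neg (by omega)])
            · obtain rfl : c = j + 1 := by omega
              exact (vx_cross (k := k) (a := n j) (b := s (j + 1)) (by omega) (by omega)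
                (by omega)).congr (swap_right n _ _) (by rw [swap_right, h1])
                (by rw [if_pos (by omega)]) (by rw [if_neg (by omega), e2])
          · exact (vx_horiz k (s (j + 1))).congr (hnz _ (by omega) h')
              (by rw [swap_ne s (by omega) (by omega), (h3 c h h').2])
              (by rw [if_pos (by omega)]) (by rw [if_pos (by omega)])
      · dsimp only; rw [if_neg (by omega)]

/-- The dormant state at the next line, when the two pipes do not cross in the row. -/
theorem Row.dor_next (R : Row k n s w) {u v : ℕ} (G : Good k n (.dor u v)) :
    ∃ u' v', u' ≤ u ∧ v' ≤ v ∧ s u' = n u ∧ s v' = n v ∧ u' ≠ v' ∧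
      ((u' = u ∧ w u = w (u + 1)) ∨ (u' < u ∧ n u' = 0 ∧ w u' = 0 ∧ s u = 0 ∧ w (u + 1) = 0)) ∧
      (∀ z, u' < z → z ≤ u → w z = n u) ∧ (∀ z, u' < z → z < u → n z = 0 ∧ s z = 0) ∧
      ((v' = v ∧ w v = w (v + 1)) ∨ (v' < v ∧ n v' = 0 ∧ w v' = 0 ∧ s v = 0 ∧ w (v + 1) = 0)) ∧
      (∀ z, v' < z → z ≤ v → w z = n v) ∧ Between k (n v) n s v' v ∧ (v' < u' → u' = u) ∧
      (u' < v' → u < v') := by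
  obtain ⟨g1, g2, g3, g4, g5⟩ := G
  have hnv : n v ≠ 0 := by omega
  obtain ⟨v', hv1, hv2, hv3, hv4, hv5⟩ : ∃ v', v' ≤ v ∧ s v' = n v ∧
      ((v' = v ∧ w v = w (v + 1)) ∨ (v' < v ∧ n v' = 0 ∧ w v' = 0 ∧ s v = 0 ∧ w (v + 1) = 0)) ∧
        (∀ z, v' < z → z ≤ v → w z = n v) ∧ Between k (n v) n s v' v := by
    rcases R.down hnv with h | ⟨d, h1, h2, h3, h4, h5, h6, h7, h8⟩
    · exact ⟨v, le_rfl, h.1, Or.inl ⟨rfl, h.2⟩, fun z _ _ => by omega, fun z _ _ => by omega⟩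
    · exact ⟨d, by omega, h2, Or.inr ⟨h1, h3, h4, h5, h6⟩, h7, h8⟩
  obtain ⟨u', hu1, hu2, hu3, hu4, hu5⟩ : ∃ u', u' ≤ u ∧ s u' = n u ∧
      ((u' = u ∧ w u = w (u + 1)) ∨ (u' < u ∧ n u' = 0 ∧ w u' = 0 ∧ s u = 0 ∧ w (u + 1) = 0)) ∧
        (∀ z, u' < z → z ≤ u → w z = n u) ∧ (∀ z, u' < z → z < u → n z = 0 ∧ s z = 0) := by
    rcases R.down_small g1 g2 with h | ⟨d, h1, h2, h3, h4, h5, h6, h7, h8⟩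
    · exact ⟨u, le_rfl, h.1, Or.inl ⟨rfl, h.2⟩, fun z _ _ => by omega, fun z _ _ => by omega⟩
    · exact ⟨d, by omega, h2, Or.inr ⟨h1, h3, h4, h5, h6⟩, h7, h8⟩
  have hne : u' ≠ v' := by rintro rfl; omega
  refine ⟨u', v', hu1, hv1, hu2, hv2, hne, hu3, hu4, hu5, hv3, hv4, hv5, fun h => ?_, fun h => ?_⟩
  · rcases hu3 with h3 | h3
    · exact h3.1
    · have := hu4 u h3.1 le_rfl
      have := hv4 u (by omega) (by omega)
      omega
  · by_contra hcon
    rcases Nat.lt_or_ge v' u with h4 | h4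
    · have := hu5 v' h h4
      omega
    · have : v' = u := by omega
      rw [this] at hv2
      omega

/-- While the two pipes keep their order, exchanging their labels leaves every tile shape as it was.
When pipe `v` crosses pipe `u` horizontally, this old crossing is turned into a bump which droops at
once, and the insertion is active again. -/
theorem Row.dor_step (R : Row k n s w) {u v : ℕ} (G : Good k n (.dor u v)) :
    ∃ σ w', IRow k n s (.dor u v) σ ∧ Good k s σ ∧ Row k (n ∘ Equiv.swap u v) (s ∘ σ.perm) w' ∧
      ∀ c, v < c → w' c = w c := by
  obtain ⟨u', v', hu1, hv1, hu2, hv2, hne, hu3, hu4, hu5, hv3, hv4, hv5, hc1, hc2⟩ := R.dor_next G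
  obtain ⟨g1, g2, g3, g4, g5⟩ := G
  have hu0 : 0 ≠ u := by rintro rfl; exact g1 R.n_zero
  have hv0 : 0 ≠ v := by omega
  have hu'0 : 0 ≠ u' := by rintro rfl; rw [R.s_zero] at hu2; omega
  have hv'0 : 0 ≠ v' := by rintro rfl; rw [R.s_zero] at hv2; omega
  have hn0 : (n ∘ Equiv.swap u v) 0 = 0 := by rw [swap_ne n hu0 hv0, R.n_zero]
  rcases Nat.lt_or_ge v' u' with hlt | hge
  · obtain ⟨hv3, hv6, hv7, hv8, hv9⟩ := hv3.resolve_left (by omega)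
    obtain rfl := hc1 hlt
    -- Pipe `v` crosses only smaller labels here, whereas `Good` admits only larger ones between `u`
    -- and `v`; so there is nothing to cross.
    have hz : ∀ z, u' < z → z < v → n z = 0 ∧ s z = 0 := by
      intro z h1 h2
      have := hv5 z (by omega) h2
      have := g5 z h1 h2
      omega
    have hsu : s (u' + 1) = 0 := by
      rcases Nat.lt_or_ge (u' + 1) v with h | h
      · exact (hz _ (by omega) h).2
      · rw [show u' + 1 = v by omega, hv8]
    refine ⟨.act u', fun c => if c = u' + 1 then 0 else if u' + 1 < c ∧ c ≤ v then n u' else w c,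
      .dor_act hu2 hv2 hlt, ⟨by omega, by omega, hsu⟩, ⟨?_, hn0, ?_, fun c => ?_⟩, fun c hc => ?_⟩
    · simp [R.w_zero]
    · rw [St.perm, swap_ne s hu0 (by omega), R.s_zero]
    · dsimp only [St.perm]
      rcases lt_trichotomy c u' with h | rfl | h
      · exact (R.vx c).congr (swap_ne n (by omega) (by omega)) (swap_ne s (by omega) (by omega))
            (by rw [if_neg (by omega), if_neg (by omega)])
            (by rw [if_neg (by omega), if_neg (by omega)])
      · exact (vx_jElbow k (n v)).congr (swap_left n _ _) (by rw [swap_left, hsu])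
          (by rw [if_neg (by omega), if_neg (by omega), hv4 c hlt (by omega)]) (by rw [if_pos rfl])
      · rcases lt_trichotomy c v with h' | rfl | h'
        · by_cases hc : c = u' + 1
          · subst hc
            exact (vx_rElbow k (n u')).congr (by rw [swap_ne n (by omega) (by omega), (hz _ h h').1])
              (by rw [swap_right, hu2]) (by rw [if_pos rfl])
              (by rw [if_neg (by omega), if_pos (by omega)])
          · exact (vx_horiz k (n u')).congr (by rw [swap_ne n (by omega) (by omega), (hz _ h h').1])
              (by rw [swap_ne s (by omega) (by omega), (hz _ h h').2])
              (by rw [if_neg (by omega), if_pos (by omega)])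
              (by rw [if_neg (by omega), if_pos (by omega)])
        · by_cases hc : c = u' + 1
          · subst hc
            exact (vx_vert k (n u')).congr (swap_right n _ _)
              (by rw [swap_right, hu2]) (by rw [if_pos rfl])
              (by rw [if_neg (by omega), if_neg (by omega), hv9])
          · exact (vx_jElbow k (n u')).congr (swap_right n _ _)
              (by rw [swap_ne s (by omega) (by omega), hv8])
              (by rw [if_neg (by omega), if_pos (by omega)])
              (by rw [if_neg (by omega), if_neg (by omega), hv9])
        · exact (R.vx c).congr (swap_ne n (by omega) (by omega)) (swap_ne s (by omega) (by omega))
            (by rw [if_neg (by omega), if_neg (by omega)])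
            (by rw [if_neg (by omega), if_neg (by omega)])
    · dsimp only; rw [if_neg (by omega), if_neg (by omega)]
  · have hlt : u' < v' := by omega
    have huv := hc2 hlt
    have hsv : s v' ≠ 0 := by omega
    -- A horizontal pipe at this place turns north between `u` and `v` or crosses pipe `v`; both
    -- make its label larger than `n v`. This keeps a crossing in column `u` legal after its
    -- vertical label becomes `n v`, and gives `Good` on the next line.
    have key : ∀ c, u < c → c ≤ v' → w c ≠ 0 → n v < w c := by
      intro c h1 h2 h3
      rcases R.fwd h3 h2 with ⟨h4, h5⟩ | ⟨z, h4, h5, h6, h7⟩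
      · rcases hv3 with ⟨h6, h7⟩ | ⟨h6, h7, h8, h9⟩
        · have := R.vx v
          rw [h6] at h4 hv2
          unfold Vx at this; omega
        · omega
      · have := g5 z (by omega) (by omega)
        omega
    have hz : ∀ z, v' < z → z < v → n z = 0 ∧ s z = 0 := by
      intro z h1 h2
      have := hv5 z (by omega) h2
      have := g5 z (by omega) h2
      omega
    refine ⟨.dor u' v', fun c => if u' < c ∧ c ≤ u then n v else if v' < c ∧ c ≤ v then n u else w c,
      .dor_dor hu2 hv2 hlt, ⟨by omega, by omega, by omega, hlt, fun z h1 h2 => ?_⟩,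
      ⟨?_, hn0, ?_, fun c => ?_⟩, fun c hc => ?_⟩
    · by_contra hcon
      have hzu : u < z := by
        rcases lt_trichotomy z u with h | rfl | h
        · have := hu5 z h1 h; omega
        · omega
        · exact h
      have hv := R.vx z
      have g := g5 z hzu (by omega)
      have := key (z + 1) (by omega) (by omega)
      unfold Vx at hv; omega
    · simp [R.w_zero]
    · rw [St.perm, swap_ne s hu'0 hv'0, R.s_zero]
    · dsimp only [St.perm]
      rcases lt_trichotomy c u' with h | rfl | h
      · exact (R.vx c).congr (swap_ne n (by omega) (by omega)) (swap_ne s (by omega) (by omega))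
            (by rw [if_neg (by omega), if_neg (by omega)])
            (by rw [if_neg (by omega), if_neg (by omega)])
      · rcases hu3 with ⟨rfl, h4⟩ | ⟨h3, h4, h5, h6, h7⟩
        · have : Vx k (n v) (s v') (w c) (w (c + 1)) := by
            have := key (c + 1) (by omega) (by omega)
            by_cases h0 : w (c + 1) = 0
            · rw [h4, h0, hv2]; exact vx_vert k _
            · rw [h4, hv2]; exact vx_cross (by omega) (this h0) (by omega)
          exact this.congr (swap_left n _ _) (swap_left s _ _)
            (by rw [if_neg (by omega), if_neg (by omega)])
            (by rw [if_neg (by omega), if_neg (by omega)])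
        · exact (vx_rElbow k (n v)).congr (by rw [swap_ne n (by omega) (by omega), h4])
            (by rw [swap_left, hv2]) (by rw [if_neg (by omega), if_neg (by omega), h5])
            (by rw [if_pos (by omega)])
      · rcases lt_trichotomy c u with h' | rfl | h'
        · obtain ⟨e1, e2⟩ := hu5 c h h'
          exact (vx_horiz k (n v)).congr (by rw [swap_ne n (by omega) (by omega), e1])
            (by rw [swap_ne s (by omega) (by omega), e2]) (by rw [if_pos (by omega)])
            (by rw [if_pos (by omega)])
        · obtain ⟨h3, h4, h5, h6, h7⟩ := hu3.resolve_left (by omega)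
          exact (vx_jElbow k (n v)).congr (swap_left n _ _)
            (by rw [swap_ne s (by omega) (by omega), h6]) (by rw [if_pos (by omega)])
            (by rw [if_neg (by omega), if_neg (by omega), h7])
        · rcases lt_trichotomy c v' with h'' | rfl | h''
          · exact (R.vx c).congr (swap_ne n (by omega) (by omega)) (swap_ne s (by omega) (by omega))
              (by rw [if_neg (by omega), if_neg (by omega)])
              (by rw [if_neg (by omega), if_neg (by omega)])
          · rcases hv3 with ⟨rfl, h4⟩ | ⟨h3, h4, h5, h6, h7⟩
            · have : Vx k (n u) (s u') (w c) (w (c + 1)) := by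
                have hv := R.vx c
                by_cases h0 : w c = 0
                · rw [← h4, h0, hu2]; exact vx_vert k _
                · rw [← h4, hu2]
                  exact vx_cross (by omega) (by unfold Vx at hv; omega) (by unfold Vx at hv; omega)
              exact this.congr (swap_right n _ _) (swap_right s _ _)
                (by rw [if_neg (by omega), if_neg (by omega)])
                (by rw [if_neg (by omega), if_neg (by omega)])
            · exact (vx_rElbow k (n u)).congr (by rw [swap_ne n (by omega) (by omega), h4])
                (by rw [swap_right, hu2]) (by rw [if_neg (by omega), if_neg (by omega), h5])
                (by rw [if_neg (by omega), if_pos (by omega)])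
          · rcases lt_trichotomy c v with h3 | rfl | h3
            · obtain ⟨e1, e2⟩ := hz c h'' h3
              exact (vx_horiz k (n u)).congr (by rw [swap_ne n (by omega) (by omega), e1])
                (by rw [swap_ne s (by omega) (by omega), e2])
                (by rw [if_neg (by omega), if_pos (by omega)])
                (by rw [if_neg (by omega), if_pos (by omega)])
            · obtain ⟨h3, h4, h5, h6, h7⟩ := hv3.resolve_left (by omega)
              exact (vx_jElbow k (n u)).congr (swap_right n _ _)
                (by rw [swap_ne s (by omega) (by omega), h6])
                (by rw [if_neg (by omega), if_pos (by omega)])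
                (by rw [if_neg (by omega), if_neg (by omega), h7])
            · exact (R.vx c).congr (swap_ne n (by omega) (by omega))
                (swap_ne s (by omega) (by omega)) (by rw [if_neg (by omega), if_neg (by omega)])
                (by rw [if_neg (by omega), if_neg (by omega)])
    · dsimp only; rw [if_neg (by omega), if_neg (by omega)]

/-- The final clause bounds the modification on the right; it is what transfers the condition
`Lab.far` to the new labels. -/
theorem Row.step (R : Row k n s w) {σ : St} (G : Good k n σ) :
    ∃ σ' w', IRow k n s σ σ' ∧ Good k s σ' ∧ Row k (n ∘ σ.perm) (s ∘ σ'.perm) w' ∧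
      ∀ m, (∀ c, m ≤ c → n c = 0) →
        ∀ c, m ≤ c → m + 2 ≤ c ∨ (∃ u v, σ = .dor u v) → w' c = w c := by
  cases σ with
  | act j =>
    obtain ⟨σ', w', h1, h2, h3, h4⟩ := R.act_step G
    refine ⟨σ', w', h1, h2, h3, fun m hm c hc hc' => h4 c ?_⟩
    rcases hc' with hc' | ⟨u, v, hc'⟩
    · by_contra hcon
      exact G.1 (hm j (by omega))
    · cases hc'
  | dor u v =>
    obtain ⟨σ', w', h1, h2, h3, h4⟩ := R.dor_step G
    refine ⟨σ', w', h1, h2, h3, fun m hm c hc _ => h4 c ?_⟩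
    by_contra hcon
    have := G.2.2.1
    have := hm v (by omega)
    omega

end

/-! ### Order of the pipes on successive lines -/

section Row
variable {k : ℕ} {n s w : ℕ → ℕ}

/-- A pipe at a south edge is traced forward through the row. -/
theorem Row.up (R : Row k n s w) {c : ℕ} (hs : s c ≠ 0) :
    n c = s c ∨ (n c = 0 ∧ ∃ z, c < z ∧ n z = s c ∧ s z = 0 ∧ ∀ y, c < y → y ≤ z → w y = s c) ∨
      (n c = 0 ∧ ∀ y, c < y → w y = s c) := by
  by_cases hn : n c = s c
  · exact Or.inl hn
  have hv := R.vx c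
  have h1 : w (c + 1) = s c ∧ n c = 0 := by unfold Vx at hv; omega
  refine Or.inr ?_
  by_cases hall : ∀ y, c < y → w y = s c
  · exact Or.inr ⟨h1.2, hall⟩
  · left
    refine ⟨h1.2, ?_⟩
    push Not at hall
    classical
    let y := Nat.find hall
    have hy : c < y ∧ w y ≠ s c := Nat.find_spec hall
    have hmin : ∀ z, z < y → c < z → w z = s c := by
      intro z hz hc
      by_contra hcon
      exact Nat.find_min hall hz ⟨hc, hcon⟩
    clear_value y
    obtain ⟨z, rfl⟩ : ∃ z, y = z + 1 := ⟨y - 1, by omega⟩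
    have hz : c < z := by
      rcases Nat.lt_or_ge c z with h | h
      · exact h
      · exfalso
        obtain rfl : c = z := by omega
        exact hy.2 h1.1
    have hw := hmin z (by omega) hz
    have hv := R.vx z
    refine ⟨z, hz, ?_, ?_, fun y h1 h2 => hmin y (by omega) h1⟩
    · unfold Vx at hv; omega
    · unfold Vx at hv; omega

/-- Each label occurs at most once in the line. -/
def LineInj (n : ℕ → ℕ) : Prop := ∀ c d, n c = n d → n c ≠ 0 → c = d

/-- If the pipe labelled `a` is to the left of the pipe labelled `b` at the bottom of a row,
and `a < b`, then this is also true at its top. -/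
theorem Row.ord (R : Row k n s w) (hI : LineInj s) {a b ca cb na nb : ℕ} (ha : a ≠ 0) (hab : a < b)
    (h1 : s ca = a) (h2 : s cb = b) (h : ca < cb) (h3 : n na = a) (h4 : n nb = b) : na < nb := by
  have hnb : cb ≤ nb := by
    rcases R.down (c := nb) (by omega) with h5 | ⟨d, h5, h6, -⟩
    · rw [hI cb nb (by omega) (by omega)]
    · rw [hI cb d (by omega) (by omega)]; omega
  rcases R.down (c := na) (by omega) with h5 | ⟨d, h5, h6, h7, h8, h9, h10, h11, -⟩
  · have := hI ca na (by omega) (by omega)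
    omega
  · have := hI ca d (by omega) (by omega)
    subst this
    rcases Nat.lt_or_ge na cb with h12 | h12
    · omega
    · have := h11 cb h h12
      have hv := R.vx cb
      unfold Vx at hv; omega

/-- Above a crossing the horizontal pipe is to the right of the vertical one. -/
theorem Row.ord_cross (R : Row k n s w) (hI : LineInj s) {c nb : ℕ} (hn : n c ≠ 0) (hs : s c ≠ 0)
    (hw : w c ≠ 0) (h4 : n nb = w c) : c < nb := by
  obtain ⟨d, h1, h2, h3, h4', h5, h6⟩ := R.back hw
  rcases R.down (c := nb) (by omega) with h7 | ⟨e, h7, h8, h9, h10, h11, h12, h13, -⟩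
  · have := hI d nb (by omega) (by omega)
    subst this; omega
  · have := hI d e (by omega) (by omega)
    subst this
    by_contra hcon
    rcases Nat.lt_or_ge nb c with h | h
    · have := h5 (nb + 1) (by omega) (by omega)
      omega
    · have : nb = c := by omega
      subst this
      exact hs h11

end Row

section Lab
variable {k : ℕ} {v h : ℕ → ℕ → ℕ}

/-- Induction downwards: a label on line `i + 1` is already on line `i`, or its pipe runs east for
ever along row `i`. By `far` it is then equal to `i`, larger than all labels of line `i`. -/
theorem Lab.line (H : Lab k v h) (i : ℕ) :
    (∀ c, v i c = 0 ∨ v i c < i) ∧ LineInj (v i) := by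
  induction i with
  | zero =>
    exact ⟨fun c => Or.inl (H.v_zero c), fun c d _ h => absurd (H.v_zero c) h⟩
  | succ i ih =>
    obtain ⟨ih1, ih2⟩ := ih
    have R := H.row i
    obtain ⟨N, hN1, hN2⟩ := H.far
    rcases Nat.eq_zero_or_pos i with rfl | hi
    · exact ⟨fun c => Or.inl (H.v_one c), fun c d _ h => absurd (H.v_one c) h⟩
    have hfar : ∀ a c, (∀ y, c < y → h i y = a) → a = i := by
      intro a c hy
      rw [← hy (N + c + i + 1) (by omega), hN2 i _ hi (by omega) (by omega)]
    refine ⟨fun c => ?_, ?_⟩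
    · by_contra hcon
      push Not at hcon
      rcases R.up hcon.1 with h1 | ⟨-, z, h1, h2, -⟩ | ⟨-, h1⟩
      · have := ih1 c; omega
      · have := ih1 z; omega
      · have := hfar _ _ h1; omega
    · have key : ∀ c d, c < d → v (i + 1) c = v (i + 1) d → v (i + 1) c ≠ 0 → False := by
        intro c d hcd he h0
        have hd := R.vx d
        have up2 := R.up (c := d) (by omega)
        rcases R.up h0 with h1 | ⟨-, z, h1, h2, h3, h4⟩ | ⟨-, h1⟩
        · rcases up2 with h5 | ⟨-, z, h5, h6, -⟩ | ⟨-, h5⟩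
          · have := ih2 c d (by omega) (by omega); omega
          · have := ih2 c z (by omega) (by omega); omega
          · have := hfar _ _ h5
            have := ih1 c; omega
        · rcases Nat.lt_or_ge z d with h5 | h5
          · rcases up2 with h5 | ⟨-, z', h5, h6, -⟩ | ⟨-, h5⟩
            · have := ih2 z d (by omega) (by omega); omega
            · have := ih2 z z' (by omega) (by omega); omega
            · have := hfar _ _ h5
              have := ih1 z; omega
          · have := h4 d hcd h5
            unfold Vx at hd; omega
        · have := h1 d hcd
          unfold Vx at hd; omega
      intro c d he h0
      rcases lt_trichotomy c d with h1 | h1 | h1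
      · exact (key c d h1 he h0).elim
      · exact h1
      · exact (key d c h1 he.symm (by omega)).elim

theorem Lab.inj (H : Lab k v h) (i : ℕ) : LineInj (v i) := (H.line i).2

theorem Lab.lt (H : Lab k v h) {i c : ℕ} (h0 : v i c ≠ 0) : v i c < i :=
  ((H.line i).1 c).resolve_left h0

/-- A label that is present in a line is present in all lines below. -/
theorem Lab.present (H : Lab k v h) {i i' c : ℕ} (hi : i ≤ i') (h0 : v i c ≠ 0) :
    ∃ d, v i' d = v i c := by
  induction i', hi using Nat.le_induction with
  | base => exact ⟨c, rfl⟩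
  | succ m hm ih =>
    obtain ⟨d, hd⟩ := ih
    rcases (H.row m).down (c := d) (by omega) with h1 | ⟨e, -, h1, -⟩
    · exact ⟨d, by omega⟩
    · exact ⟨e, by omega⟩

/-- Two pipes that have not crossed below some line in the order of their exit rows do not
change their order above it. -/
theorem Lab.ord (H : Lab k v h) {i i' a b ca cb na nb : ℕ} (hi : i' ≤ i) (ha : a ≠ 0) (hab : a < b)
    (h1 : v i ca = a) (h2 : v i cb = b) (hlt : ca < cb) (h3 : v i' na = a) (h4 : v i' nb = b) :
    na < nb := by
  induction i, hi using Nat.le_induction generalizing ca cb with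
  | base =>
    rw [H.inj i' na ca (by omega) (by omega), H.inj i' nb cb (by omega) (by omega)]
    exact hlt
  | succ m hm ih =>
    obtain ⟨da, hda⟩ := H.present hm (c := na) (by omega)
    obtain ⟨db, hdb⟩ := H.present hm (c := nb) (by omega)
    exact ih (ca := da) (cb := db) (by omega) (by omega)
      ((H.row m).ord (H.inj (m + 1)) ha hab h1 h2 hlt (by omega) (by omega))

/-- The start of an insertion into row `b`. -/
theorem Lab.start (H : Lab k v h) {b : ℕ} (hb : 1 ≤ b) (hk : b ≤ k) :
    ∃ j, v (b + 1) j = b ∧ v b j = 0 ∧ h b j = 0 ∧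
      ∀ z, j < z → h b z = b ∧ v b z = 0 ∧ v (b + 1) z = 0 := by
  obtain ⟨N, hN1, hN2⟩ := H.far
  have R := H.row b
  have hw : ∀ z, N ≤ z → b < z → h b z = b := fun z h1 h2 => hN2 b z hb h2 h1
  -- An edge far to the east has label `b`; tracing it back leads to the rightmost `rElbow` of the
  -- row.
  have h0 := hw (N + b + 1) (by omega) (by omega)
  obtain ⟨j, h1, h2, h3, h4, h5, -⟩ := R.back (c := N + b + 1) (by omega)
  rw [h0] at h2 h5
  have hall : ∀ z, j < z → h b z = b := by
    intro z hz
    rcases Nat.lt_or_ge (N + b + 1) z with h | h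
    · exact hw z (by omega) (by omega)
    · exact h5 z hz h
  refine ⟨j, h2, h3, h4, fun z hz => ?_⟩
  have hv := R.vx z
  have e1 := hall z hz
  have e2 := hall (z + 1) (by omega)
  unfold Vx at hv; omega

end Lab

/-! ### Right insertion as a sequence of states -/

/-- `σ` is the sequence of the states of the insertion of a biletter `(b, k)` at the lines below
row `b`, and `v'` is the result. -/
structure Ins (k b : ℕ) (v : ℕ → ℕ → ℕ) (σ : ℕ → St) (v' : ℕ → ℕ → ℕ) : Prop where
  start : ∃ j, σ (b + 1) = .act j ∧ v (b + 1) j = b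
  step : ∀ i, b < i → IRow k (v i) (v (i + 1)) (σ i) (σ (i + 1))
  good : ∀ i, b < i → Good k (v i) (σ i)
  above : ∀ i, i ≤ b → v' i = v i
  below : ∀ i, b < i → v' i = v i ∘ (σ i).perm

section Lab
variable {k : ℕ} {v h : ℕ → ℕ → ℕ}

/-- Labels are distinct on the bottom line, so the columns `j'`, `u'`, `v'` are determined, and the
side conditions of the constructors exclude each other. -/
theorem IRow.unique {n s : ℕ → ℕ} (hs : LineInj s) {σ σ₁ σ₂ : St} (hσ : Good k n σ)
    (h1 : IRow k n s σ σ₁) (h2 : IRow k n s σ σ₂) : σ₁ = σ₂ := by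
  cases h1 <;> cases h2 <;> try omega
  all_goals obtain ⟨g1, g2, g3⟩ := hσ
  case act_left.act_left j a1 a2 a3 b1 b2 b3 => rw [hs a1 b1 (by omega) (by omega)]
  case act_pass.act_pass => rfl
  case act_rest.act_rest j a1 a2 a3 b1 b2 b3 => rw [hs a1 b1 (by omega) (by omega)]
  case dor_act.dor_act u v u' v' a1 a2 a3 u2 v2 b1 b2 b3 =>
    rw [hs u' u2 (by omega) (by omega)]
  case dor_act.dor_dor u v u' v' a1 a2 a3 u2 v2 b1 b2 b3 =>
    have := hs u' u2 (by omega) (by omega)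
    have := hs v' v2 (by omega) (by omega)
    omega
  case dor_dor.dor_act u v u' v' a1 a2 a3 u2 v2 b1 b2 b3 =>
    have := hs u' u2 (by omega) (by omega)
    have := hs v' v2 (by omega) (by omega)
    omega
  case dor_dor.dor_dor u v u' v' a1 a2 a3 u2 v2 b1 b2 b3 =>
    rw [hs u' u2 (by omega) (by omega), hs v' v2 (by omega) (by omega)]

theorem Ins.unique (H : Lab k v h) {b : ℕ} {σ τ : ℕ → St} {v' v'' : ℕ → ℕ → ℕ} (hb : b ≠ 0)
    (I : Ins k b v σ v') (J : Ins k b v τ v'') : (∀ i, b < i → σ i = τ i) ∧ v' = v'' := by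
  have key : ∀ i, b < i → σ i = τ i := by
    intro i hi
    induction i, hi using Nat.le_induction with
    | base =>
      obtain ⟨j, h1, h2⟩ := I.start
      obtain ⟨j', h1', h2'⟩ := J.start
      rw [h1, h1', H.inj (b + 1) j j' (by omega) (by omega)]
    | succ m hm ih =>
      have := J.step m hm
      rw [← ih] at this
      exact (I.step m hm).unique (H.inj (m + 1)) (I.good m hm) this
  refine ⟨key, funext fun i => ?_⟩
  rcases Nat.lt_or_ge b i with hi | hi
  · rw [I.below i hi, J.below i hi, key i hi]
  · rw [I.above i hi, J.above i hi]

end Lab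

section Lab
variable {k : ℕ} {v h : ℕ → ℕ → ℕ}

theorem Lab.exists_states (H : Lab k v h) {b : ℕ} {σ₀ : St} (h0 : Good k (v (b + 1)) σ₀) :
    ∃ σ : ℕ → St, σ (b + 1) = σ₀ ∧ ∀ i, b < i → Good k (v i) (σ i) ∧
      IRow k (v i) (v (i + 1)) (σ i) (σ (i + 1)) := by
  classical
  have hex : ∀ i σ, ∃ τ, Good k (v i) σ → IRow k (v i) (v (i + 1)) σ τ ∧ Good k (v (i + 1)) τ := by
    intro i σ
    by_cases hg : Good k (v i) σ
    · obtain ⟨τ, w', h1, h2, -⟩ := (H.row i).step hg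
      exact ⟨τ, fun _ => ⟨h1, h2⟩⟩
    -- A default value: the recursion starts in a good state and stays in good states.
    · exact ⟨σ, fun h => absurd h hg⟩
  choose f hf using hex
  let g : ℕ → St := fun m => Nat.rec σ₀ (fun m σ => f (b + 1 + m) σ) m
  have hg : ∀ m, Good k (v (b + 1 + m)) (g m) := by
    intro m
    induction m with
    | zero => exact h0
    | succ m ih => exact (hf _ _ ih).2
  refine ⟨fun i => g (i - (b + 1)), by simp [g], fun i hi => ?_⟩
  obtain ⟨m, rfl⟩ := Nat.exists_eq_add_of_le hi
  have e1 : b.succ + m - (b + 1) = m := by omega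
  have e2 : b.succ + m + 1 - (b + 1) = m + 1 := by omega
  simp only [e1, e2]
  exact ⟨hg m, (hf _ _ (hg m)).1⟩

/-- Far below, an insertion is in a dormant state. -/
theorem Lab.eventually_dor (H : Lab k v h) {b N : ℕ} {σ : ℕ → St}
    (hN : ∀ i j, N ≤ i ∨ N ≤ j → (v i j ≠ 0 ↔ 1 ≤ j ∧ j < i))
    (hN2 : ∀ i j, 1 ≤ i → i < j → N ≤ j → h i j = i)
    (hσ : ∀ i, b < i → Good k (v i) (σ i) ∧ IRow k (v i) (v (i + 1)) (σ i) (σ (i + 1)))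
    {i : ℕ} (hi : N ≤ i) (hb : b < i) (hk : k < i) :
    ∀ i', i < i' → ∃ u w, σ i' = .dor u w := by
  -- From line `N` on, all columns left of the diagonal are occupied, so both dormant pipes run
  -- straight and never cross again.
  have hst : ∀ m, N ≤ m → b < m → ∀ u w, σ m = .dor u w → σ (m + 1) = .dor u w := by
    intro m h1 h2 u w he
    obtain ⟨g, s⟩ := hσ m h2
    rw [he] at g s
    obtain ⟨g1, g2, g3, g4, g5⟩ := g
    have e1 := (H.row m).straight g1 ((hN (m + 1) u (by omega)).2
      (by have := (hN m u (by omega)).1 g1; omega))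
    have e2 := (H.row m).straight (c := w) (by omega) ((hN (m + 1) w (by omega)).2
      (by have := (hN m w (by omega)).1 (by omega); omega))
    have I := H.inj (m + 1)
    generalize σ (m + 1) = τ at s ⊢
    cases s with
    | dor_act hu hv hlt =>
      have := I _ _ (hu.trans e1.symm) (by omega)
      have := I _ _ (hv.trans e2.symm) (by omega)
      omega
    | dor_dor hu hv hlt =>
      rw [I _ _ (hu.trans e1.symm) (by omega), I _ _ (hv.trans e2.symm) (by omega)]
  intro i' hi'
  induction i', hi' using Nat.le_induction with
  | base =>
    obtain ⟨g, s⟩ := hσ i hb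
    cases hs : σ i with
    | dor u w => exact ⟨u, w, hst i hi hb u w hs⟩
    | act j =>
      rw [hs] at g s
      obtain ⟨g1, g2, g3⟩ := g
      have hj := (hN i j (by omega)).1 g1
      -- The column to the right of the moving pipe is empty, so the pipe is in the last occupied
      -- column `i - 1`. The pipe that starts beside it in row `i` has label `i > k`, and this puts
      -- the insertion to rest.
      have hj' : i ≤ j + 1 := by
        by_contra hcon
        exact (hN i (j + 1) (by omega)).2 (by omega) g3
      have hji : j + 1 = i := by omega
      have hs1 : v (i + 1) (j + 1) = i := by
        have h1 := (hN (i + 1) (j + 1) (by omega)).2 (by omega)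
        have h2 := hN2 i (i + 1) (by omega) (by omega) (by omega)
        have hv := (H.row i).vx (j + 1)
        rw [hji] at h1 g3 hv ⊢
        unfold Vx at hv; omega
      generalize σ (i + 1) = τ at s ⊢
      cases s with
      | act_left _ h => omega
      | act_pass _ _ h => omega
      | act_rest hj h => exact ⟨_, _, rfl⟩
  | succ m hm ih =>
    obtain ⟨u, w, he⟩ := ih
    exact ⟨u, w, hst m (by omega) (by omega) u w he⟩

/-- `Lab k` survives an insertion with bound `k`: the rows above `b` are kept, the last `rElbow` of
row `b` moves one column to the right, and `Row.step` supplies the rows below. Far away only labels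
change and not the set of occupied edges, because the insertion is dormant from some line on. -/
theorem Lab.exists_ins (H : Lab k v h) {b : ℕ} (hb : 1 ≤ b) (hbk : b ≤ k) :
    ∃ σ v' h', Ins k b v σ v' ∧ Lab k v' h' := by
  classical
  obtain ⟨N, hN, hN2⟩ := H.far
  obtain ⟨j, h1, h2, h3, h4⟩ := H.start hb hbk
  obtain ⟨σ, hσ0, hσ⟩ := H.exists_states (b := b) (σ₀ := .act j)
    ⟨by omega, by omega, (h4 (j + 1) (by omega)).2.2⟩
  have hw : ∀ i, ∃ w', b < i → Row k (v i ∘ (σ i).perm) (v (i + 1) ∘ (σ (i + 1)).perm) w' ∧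
      ∀ m, (∀ c, m ≤ c → v i c = 0) →
        ∀ c, m ≤ c → m + 2 ≤ c ∨ (∃ u v, σ i = .dor u v) → w' c = h i c := by
    intro i
    by_cases hi : b < i
    · obtain ⟨τ, w', s1, s2, s3, s4⟩ := (H.row i).step (hσ i hi).1
      rw [← (hσ i hi).2.unique (H.inj (i + 1)) (hσ i hi).1 s1] at s3
      exact ⟨w', fun _ => ⟨s3, s4⟩⟩
    · exact ⟨fun _ => 0, fun h => absurd h hi⟩
  choose w' hw' using hw
  have hd := H.eventually_dor hN hN2 hσ (i := N + b + k + 1) (by omega) (by omega) (by omega)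
  have hzero : ∀ i c, N ≤ c → i ≤ c → v i c = 0 := by
    intro i c hc hi
    by_contra hcon
    have := (hN i c (Or.inr hc)).1 hcon
    omega
  -- the modification of a line does not change the occupied columns far to the right
  have hperm : ∀ i c, b < i → (N + b + k + 1 < i ∨ N + b + k + 3 ≤ c) →
      ((v i ∘ (σ i).perm) c ≠ 0 ↔ v i c ≠ 0) := by
    intro i c hi hc
    have g := (hσ i hi).1
    have hdor : ∀ u w, σ i = .dor u w → ((v i ∘ (σ i).perm) c ≠ 0 ↔ v i c ≠ 0) := by
      intro u w he
      rw [he] at g ⊢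
      obtain ⟨g1, g2, g3, g4, g5⟩ := g
      simp only [St.perm]
      by_cases hu : c = u
      · subst hu; rw [swap_left]; omega
      · by_cases hw : c = w
        · subst hw; rw [swap_right]; omega
        · rw [swap_ne _ hu hw]
    by_cases hi2 : N + b + k + 1 < i
    · obtain ⟨u, w, he⟩ := hd i hi2
      exact hdor u w he
    · cases he : σ i with
      | dor u w => rw [← he]; exact hdor u w he
      | act j =>
        rw [he] at g
        obtain ⟨g1, g2, g3⟩ := g
        have : j < N + b + k + 2 := by
          by_contra hcon
          exact g1 (hzero i j (by omega) (by omega))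
        simp only [St.perm]
        rw [swap_ne _ (by omega) (by omega)]
  refine ⟨σ, fun i => if i ≤ b then v i else v i ∘ (σ i).perm,
    fun i => if i < b then h i else if i = b then fun c => if c = j + 1 then 0 else h b c else w' i,
    ⟨⟨j, hσ0, h1⟩, fun i hi => (hσ i hi).2, fun i hi => (hσ i hi).1, fun i hi => if_pos hi,
      fun i hi => if_neg (by omega)⟩, ?_, ?_, ?_, ?_, ?_⟩
  · intro i
    rcases lt_trichotomy i b with hi | rfl | hi
    · rw [if_pos (by omega), if_pos (by omega), if_pos hi]
      exact H.row i
    · rw [if_pos le_rfl, if_neg (by omega), if_neg (by omega), if_pos rfl, hσ0]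
      have R := H.row i
      have hj0 : 0 ≠ j := by rintro rfl; rw [R.s_zero] at h1; omega
      refine ⟨by simp [R.w_zero], R.n_zero, by rw [St.perm, swap_ne _ hj0 (by omega), R.s_zero],
        fun c => ?_⟩
      dsimp only [St.perm]
      rcases lt_trichotomy c j with hc | rfl | hc
      · exact (R.vx c).congr rfl (swap_ne _ (by omega) (by omega)) (if_neg (by omega))
          (if_neg (by omega))
      · exact (vx_horiz k 0).congr h2 (by rw [swap_left, (h4 _ (by omega)).2.2])
          (by rw [if_neg (by omega), h3]) (if_pos rfl)
      · obtain ⟨e1, e2, e3⟩ := h4 c hc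
        by_cases hc' : c = j + 1
        · subst hc'
          exact (vx_rElbow k i).congr e2 (by rw [swap_right, h1]) (if_pos rfl)
            (by rw [if_neg (by omega), (h4 _ (by omega)).1])
        · exact (R.vx c).congr rfl (swap_ne _ (by omega) (by omega)) (if_neg (by omega))
            (if_neg (by omega))
    · rw [if_neg (by omega), if_neg (by omega), if_neg (by omega), if_neg (by omega)]
      exact (hw' i hi).1
  · intro c; rw [if_pos (by omega), H.v_zero]
  · intro c; rw [if_pos (by omega), H.v_one]
  · intro c; rw [if_pos (by omega), H.h_zero]
  -- Any bound beyond the region in which the insertion can be active would do.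
  · refine ⟨N + b + k + j + 5, fun i c hc => ?_, fun i c hi hic hc => ?_⟩
    · by_cases hi : i ≤ b
      · rw [if_pos hi]; exact hN i c (by omega)
      · rw [if_neg hi, hperm i c (by omega) (by omega)]; exact hN i c (by omega)
    · rcases lt_trichotomy i b with hb' | hb' | hb'
      · rw [if_pos hb']; exact hN2 i c hi hic (by omega)
      · rw [if_neg (by omega), if_pos hb', if_neg (by omega), ← hb']
        exact hN2 i c hi hic (by omega)
      · rw [if_neg (by omega), if_neg (by omega)]
        rw [(hw' i hb').2 (max N i) (fun y hy => hzero i y (by omega) (by omega)) c (by omega)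
          ((Nat.lt_or_ge (N + b + k + 1) i).symm.imp (fun _ => by omega) (hd i))]
        exact hN2 i c hi hic (by omega)

end Lab

/-! ### From labels to tilings, pipes and permutations -/

/-- The tile with the given labels of its north, south and west edges. -/
def mkTile (n s w : ℕ) : Tile :=
  if n = 0 then
    if s = 0 then if w = 0 then .blank else .horiz else .rElbow
  else if s = 0 then .jElbow else if w = 0 then .vert else if n = s then .cross else .bump

/-- The tiling with the given labels of the north and west edges. -/
def tiling (v h : ℕ → ℕ → ℕ) : Tiling := fun i j => mkTile (v i j) (v (i + 1) j) (h i j)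

/-- The rule for the labels of the north, south, west and east edges of a tile that may also be a
bump. -/
def VxB (n s w x : ℕ) : Prop :=
  (n = 0 ∧ s = 0 ∧ w = x) ∨ (n = s ∧ w = 0 ∧ x = 0) ∨ (n = 0 ∧ w = 0 ∧ s = x) ∨
  (s = 0 ∧ x = 0 ∧ n = w) ∨ (n = s ∧ w = x ∧ n ≠ 0 ∧ w ≠ 0 ∧ n ≠ w) ∨
  (n = w ∧ s = x ∧ n ≠ 0 ∧ s ≠ 0 ∧ n ≠ s)

theorem Vx.toB {k n s w x : ℕ} (h : Vx k n s w x) : VxB n s w x := by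
  unfold Vx at h; unfold VxB; omega

/-- Labels of a tiling, which may contain bumps; `lam p` is the label of the pipe `p`. -/
structure Lbl (v h : ℕ → ℕ → ℕ) (lam : ℕ → ℕ) : Prop where
  vx : ∀ i j, VxB (v i j) (v (i + 1) j) (h i j) (h i (j + 1))
  h_col : ∀ i, h i 0 = 0
  h_zero : ∀ j, h 0 j = 0
  lam_zero : lam 0 = 0
  lam_inj : Function.Injective lam
  far : ∃ N, (∀ i j, N ≤ i → v i j = if j < i then lam j else 0) ∧
    ∀ i j, 1 ≤ i → i < j → N ≤ j → h i j = i

section mkTile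

theorem mk_cases (n s w : ℕ) :
    (mkTile n s w = .blank ∧ n = 0 ∧ s = 0 ∧ w = 0) ∨ (mkTile n s w = .horiz ∧ n = 0 ∧ s = 0 ∧ w ≠ 0) ∨
    (mkTile n s w = .rElbow ∧ n = 0 ∧ s ≠ 0) ∨ (mkTile n s w = .jElbow ∧ n ≠ 0 ∧ s = 0) ∨
    (mkTile n s w = .vert ∧ n ≠ 0 ∧ s ≠ 0 ∧ w = 0) ∨
    (mkTile n s w = .cross ∧ n ≠ 0 ∧ s ≠ 0 ∧ w ≠ 0 ∧ n = s) ∨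
    (mkTile n s w = .bump ∧ n ≠ 0 ∧ s ≠ 0 ∧ w ≠ 0 ∧ n ≠ s) := by
  unfold mkTile; split_ifs <;> simp_all

theorem mk_blank {n s w : ℕ} : mkTile n s w = .blank ↔ n = 0 ∧ s = 0 ∧ w = 0 := by
  unfold mkTile; split_ifs <;> simp_all

theorem mk_horiz {n s w : ℕ} : mkTile n s w = .horiz ↔ n = 0 ∧ s = 0 ∧ w ≠ 0 := by
  unfold mkTile; split_ifs <;> simp_all

theorem mk_rElbow {n s w : ℕ} : mkTile n s w = .rElbow ↔ n = 0 ∧ s ≠ 0 := by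
  unfold mkTile; split_ifs <;> simp_all

theorem mk_jElbow {n s w : ℕ} : mkTile n s w = .jElbow ↔ n ≠ 0 ∧ s = 0 := by
  unfold mkTile; split_ifs <;> simp_all

theorem mk_vert {n s w : ℕ} : mkTile n s w = .vert ↔ n ≠ 0 ∧ s ≠ 0 ∧ w = 0 := by
  unfold mkTile; split_ifs <;> simp_all

theorem mk_cross {n s w : ℕ} : mkTile n s w = .cross ↔ n ≠ 0 ∧ s ≠ 0 ∧ w ≠ 0 ∧ n = s := by
  unfold mkTile; split_ifs <;> simp_all

theorem mk_bump {n s w : ℕ} : mkTile n s w = .bump ↔ n ≠ 0 ∧ s ≠ 0 ∧ w ≠ 0 ∧ n ≠ s := by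
  unfold mkTile; split_ifs <;> simp_all

theorem mk_congr {n s w n' s' w' : ℕ} (hn : n = 0 ↔ n' = 0) (hs : s = 0 ↔ s' = 0)
    (hw : w = 0 ↔ w' = 0) (hb : n = s ↔ n' = s') : mkTile n s w = mkTile n' s' w' := by
  unfold mkTile; simp only [hn, hs, hw, hb]

end mkTile

section Lbl
variable {v h : ℕ → ℕ → ℕ} {lam : ℕ → ℕ}

theorem Lbl.lam_ne (H : Lbl v h lam) {p : ℕ} (hp : p ≠ 0) : lam p ≠ 0 := fun h0 =>
  hp (H.lam_inj (h0.trans H.lam_zero.symm))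

/-- The label is constant along a pipe: far down in column `p` it is `lam p`, and each tile on the
way hands it on. -/
theorem Lbl.label (H : Lbl v h lam) {p i j : ℕ} {e : Side} (he : Enters (tiling v h) p i j e) :
    lam p ≠ 0 ∧ (match e with | .south => v (i + 1) j | .west => h i j) = lam p := by
  induction he with
  | @start i h' =>
    obtain ⟨N, hN, -⟩ := H.far
    have h1 : ∀ m, v (i + 1 + m) p = v (i + 1) p := by
      intro m
      induction m with
      | zero => rfl
      | succ m ih =>
        have h2 := h' (i + 1 + m) (by omega)
        rw [tiling, mk_vert] at h2
        have h3 := H.vx (i + 1 + m) p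
        rw [← ih]
        unfold VxB at h3
        rw [show i + 1 + (m + 1) = i + 1 + m + 1 by omega]; omega
    have h2 := h1 (N + p)
    rw [hN _ _ (by omega), if_pos (by omega)] at h2
    have h3 := h' (i + 1) (by omega)
    rw [tiling, mk_vert] at h3
    simp only
    omega
  | @south_north i j _ ht ih =>
    have h3 := H.vx (i + 1) j
    simp only [tiling, mk_vert, mk_cross] at ht ih ⊢
    unfold VxB at h3; omega
  | @west_north i j _ ht ih =>
    have h3 := H.vx (i + 1) j
    simp only [tiling, mk_jElbow, mk_bump] at ht ih ⊢
    unfold VxB at h3; omega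
  | @south_east i j _ ht ih =>
    have h3 := H.vx i j
    simp only [tiling, mk_rElbow, mk_bump] at ht ih ⊢
    unfold VxB at h3; omega
  | @west_east i j _ ht ih =>
    have h3 := H.vx i j
    simp only [tiling, mk_horiz, mk_cross] at ht ih ⊢
    unfold VxB at h3; omega

theorem Lbl.vert_far (H : Lbl v h lam) {N : ℕ}
    (hN : ∀ i j, N ≤ i → v i j = if j < i then lam j else 0) {i j : ℕ} (hi : N ≤ i) (hj : j ≤ i) :
    h i j = 0 := by
  induction j with
  | zero => exact H.h_col i
  | succ j ih =>
    have ih := ih (by omega)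
    have h1 := H.vx i j
    rw [hN i j hi, hN (i + 1) j (by omega), if_pos (by omega), if_pos (by omega)] at h1
    have := H.lam_zero
    unfold VxB at h1; omega

/-- Every labelled edge is traced back, westwards inside a row and then to the line below, until it
reaches the region of vertical pipes where `Enters` can start. With injectivity of `lam`, statements
about pipes become equations between labels. -/
theorem Lbl.exists_enters (H : Lbl v h lam) (i : ℕ) :
    (∀ j, v (i + 1) j ≠ 0 → ∃ p, Enters (tiling v h) p i j .south) ∧
      ∀ j, h i j ≠ 0 → ∃ p, Enters (tiling v h) p i j .west := by
  obtain ⟨N, hN, -⟩ := H.far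
  have west : ∀ i, (∀ j, v (i + 1) j ≠ 0 → ∃ p, Enters (tiling v h) p i j .south) →
      ∀ j, h i j ≠ 0 → ∃ p, Enters (tiling v h) p i j .west := by
    intro i hs j
    induction j with
    | zero => intro h0; exact absurd (H.h_col i) h0
    | succ j ih =>
      intro h0
      have h1 := H.vx i j
      by_cases hw : h i j = 0 ∨ (v i j ≠ 0 ∧ v (i + 1) j ≠ 0 ∧ v i j ≠ v (i + 1) j)
      · clear ih
        obtain ⟨p, hp⟩ := hs j (by unfold VxB at h1; omega)
        refine ⟨p, .south_east hp ?_⟩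
        simp only [tiling, mk_rElbow, mk_bump]
        unfold VxB at h1; omega
      · obtain ⟨p, hp⟩ := ih (by omega)
        clear ih
        refine ⟨p, .west_east hp ?_⟩
        simp only [tiling, mk_horiz, mk_cross]
        unfold VxB at h1; omega
  have south : ∀ d i, N ≤ i + d → ∀ j, v (i + 1) j ≠ 0 →
      ∃ p, Enters (tiling v h) p i j .south := by
    intro d
    induction d with
    | zero =>
      intro i hi j h0
      have hj : j < i + 1 ∧ lam j ≠ 0 := by
        rw [hN _ _ (by omega)] at h0
        split_ifs at h0 with h1
        · exact ⟨h1, h0⟩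
        · exact absurd rfl h0
      refine ⟨j, .start fun i' hi' => ?_⟩
      rw [tiling, mk_vert, hN _ _ (by omega), hN _ _ (by omega), if_pos (by omega),
        if_pos (by omega)]
      exact ⟨hj.2, hj.2, H.vert_far hN (by omega) (by omega)⟩
    | succ d ih =>
      intro i hi j h0
      have h1 := H.vx (i + 1) j
      have hs := ih (i + 1) (by omega)
      clear ih
      by_cases hw : v (i + 1) j = v (i + 1 + 1) j
      · obtain ⟨p, hp⟩ := hs j (by omega)
        refine ⟨p, .south_north hp ?_⟩
        simp only [tiling, mk_vert, mk_cross]; omega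
      · obtain ⟨p, hp⟩ := west _ hs j (by unfold VxB at h1; omega)
        refine ⟨p, .west_north hp ?_⟩
        simp only [tiling, mk_jElbow, mk_bump]
        unfold VxB at h1; omega
  have hs := south N i (by omega)
  exact ⟨hs, west i hs⟩

theorem Lbl.enters_south (H : Lbl v h lam) {p i j : ℕ} :
    Enters (tiling v h) p i j .south ↔ lam p ≠ 0 ∧ v (i + 1) j = lam p := by
  refine ⟨fun h => H.label h, fun ⟨h1, h2⟩ => ?_⟩
  obtain ⟨q, hq⟩ := (H.exists_enters i).1 j (by omega)
  obtain ⟨h3, h4⟩ := H.label hq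
  simp only at h4
  rwa [H.lam_inj (a₁ := p) (a₂ := q) (by omega)]

theorem Lbl.enters_west (H : Lbl v h lam) {p i j : ℕ} :
    Enters (tiling v h) p i j .west ↔ lam p ≠ 0 ∧ h i j = lam p := by
  refine ⟨fun h => H.label h, fun ⟨h1, h2⟩ => ?_⟩
  obtain ⟨q, hq⟩ := (H.exists_enters i).2 j (by omega)
  obtain ⟨h3, h4⟩ := H.label hq
  simp only at h4
  rwa [H.lam_inj (a₁ := p) (a₂ := q) (by omega)]

theorem Lbl.exitsRow (H : Lbl v h lam) {p r : ℕ} :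
    ExitsRow (tiling v h) p r ↔ lam p ≠ 0 ∧ lam p = r := by
  obtain ⟨N, -, hN⟩ := H.far
  constructor
  · rintro ⟨m, hm⟩
    obtain ⟨h1, h2⟩ := H.enters_west.1 (hm (m + N + r + 1) (by omega))
    refine ⟨h1, ?_⟩
    rcases Nat.eq_zero_or_pos r with rfl | hr
    · rw [H.h_zero] at h2; omega
    · rw [hN _ _ hr (by omega) (by omega)] at h2; omega
  · rintro ⟨h1, h2⟩
    refine ⟨N + r + 1, fun j hj => H.enters_west.2 ⟨h1, ?_⟩⟩
    rw [hN _ _ (by omega) (by omega) (by omega), h2]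

theorem Lbl.crossAt (H : Lbl v h lam) {p q i j : ℕ} : CrossAt (tiling v h) p q i j ↔
    lam p ≠ 0 ∧ lam q ≠ 0 ∧ v i j = v (i + 1) j ∧
      ((h i j = lam p ∧ v (i + 1) j = lam q) ∨ (h i j = lam q ∧ v (i + 1) j = lam p)) := by
  rw [CrossAt, H.enters_south, H.enters_west, H.enters_south, H.enters_west, tiling, mk_cross]
  omega

theorem Lbl.exists_lam (H : Lbl v h lam) (r : ℕ) : ∃ p, lam p = r := by
  rcases Nat.eq_zero_or_pos r with rfl | hr
  · exact ⟨0, H.lam_zero⟩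
  obtain ⟨N, -, hN⟩ := H.far
  have h1 := hN r (N + r + 1) hr (by omega) (by omega)
  obtain ⟨p, hp⟩ := (H.exists_enters r).2 (N + r + 1) (by omega)
  exact ⟨p, by have := (H.enters_west.1 hp).2; omega⟩

end Lbl

section Lab
variable {k : ℕ} {v h : ℕ → ℕ → ℕ}

/-- Beyond the far bound an occupied column stays straight for ever, so the exit row of pipe `p` can
be read in column `p` on line `N + p + 1`. -/
theorem Lab.exists_lbl (H : Lab k v h) : ∃ lam, Lbl v h lam := by
  obtain ⟨N, hN, hN2⟩ := H.far
  have hst : ∀ i j, N ≤ i → j < i → ∀ m, v (i + m) j = v i j := by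
    intro i j hi hj m
    induction m with
    | zero => rfl
    | succ m ih =>
      have h1 := hN (i + m) j (by omega)
      have h2 := hN (i + m + 1) j (by omega)
      rcases Nat.eq_zero_or_pos j with rfl | h0
      · rw [(H.row i).n_zero, (H.row _).n_zero]
      · rw [← ih]
        exact (H.row (i + m)).straight (h1.2 (by omega)) (h2.2 (by omega))
  have hlam : ∀ i j, N ≤ i → j < i → v i j = v (N + j + 1) j := by
    intro i j hi hj
    have h1 := hst i j hi hj (N + j + 1)
    have h2 := hst (N + j + 1) j (by omega) (by omega) i
    rw [show i + (N + j + 1) = N + j + 1 + i by omega] at h1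
    omega
  refine ⟨fun j => v (N + j + 1) j, fun i j => ((H.row i).vx j).toB, fun i => (H.row i).w_zero,
    H.h_zero, (H.row _).n_zero, fun p q hpq => ?_, N, fun i j hi => ?_, hN2⟩
  · rw [← hlam (N + p + q + 1) p (by omega) (by omega),
      ← hlam (N + p + q + 1) q (by omega) (by omega)] at hpq
    have h1 := hN (N + p + q + 1) p (by omega)
    have h2 := hN (N + p + q + 1) q (by omega)
    by_cases h0 : p = 0
    · have := (H.row (N + p + q + 1)).n_zero
      subst h0; omega
    · exact H.inj _ p q hpq (h1.2 (by omega))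
  · split_ifs with hj
    · exact hlam i j hi hj
    · by_contra hcon
      have := (hN i j (by omega)).1 hcon
      omega

/-- If the pipe labelled `b` crosses the pipe labelled `a` horizontally, it is to the right of it
above the crossing. -/
theorem Lab.cross_order (H : Lab k v h) {i j : ℕ} (hn : v i j ≠ 0) (hs : v (i + 1) j ≠ 0)
    (hw : h i j ≠ 0) : v i j = v (i + 1) j ∧ v i j < h i j ∧ k < h i j ∧
      (∀ c, v i c = h i j → j < c) ∧ ∃ d < j, v (i + 1) d = h i j := by
  have hv := (H.row i).vx j
  obtain ⟨d, h1, h2, -⟩ := (H.row i).back hw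
  exact ⟨by unfold Vx at hv; omega, by unfold Vx at hv; omega, by unfold Vx at hv; omega,
    fun c hc => (H.row i).ord_cross (H.inj (i + 1)) hn hs hw hc, d, h1, h2⟩

/-- Two pipes cross at most once. -/
theorem Lab.cross_unique (H : Lab k v h) {i j i' j' : ℕ} (hn : v i j ≠ 0) (hs : v (i + 1) j ≠ 0)
    (hw : h i j ≠ 0) (hs' : v (i' + 1) j' ≠ 0) (ha : v i j = v i' j') (hb : h i j = h i' j') :
    i = i' ∧ j = j' := by
  have key : ∀ i j i' j', v i j ≠ 0 → v (i + 1) j ≠ 0 → h i j ≠ 0 → v (i' + 1) j' ≠ 0 →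
      v i j = v i' j' → h i j = h i' j' → i < i' → False := by
    intro i j i' j' hn hs hw hs' ha hb hlt
    obtain ⟨e1, e2, -, e3, d, e4, e5⟩ := H.cross_order hn hs hw
    obtain ⟨f1, f2, -, f3, -⟩ := H.cross_order (i := i') (j := j') (by omega) hs' (by omega)
    obtain ⟨c, hc⟩ := H.present (i := i + 1) (i' := i') hlt (c := d) (by omega)
    have := H.ord (i := i') (i' := i + 1) hlt (by omega) f2 rfl (show v i' c = h i' j' by omega) (f3 c (by omega))
      (na := j) (nb := d) (by omega) (by omega)
    omega
  rcases lt_trichotomy i i' with h1 | rfl | h1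
  · exact (key i j i' j' hn hs hw hs' ha hb h1).elim
  · exact ⟨rfl, H.inj i _ _ ha hn⟩
  · have e1 := H.cross_order hn hs hw
    exact (key i' j' i j (by omega) hs' (by omega) hs ha.symm hb.symm h1).elim

theorem hasN_mk {n s w : ℕ} : (mkTile n s w).hasN = decide (n ≠ 0) := by
  unfold mkTile; split_ifs <;> simp_all [Tile.hasN]

theorem hasS_mk {n s w : ℕ} : (mkTile n s w).hasS = decide (s ≠ 0) := by
  unfold mkTile; split_ifs <;> simp_all [Tile.hasS]

theorem hasW_mk {n s w x : ℕ} (h : VxB n s w x) : (mkTile n s w).hasW = decide (w ≠ 0) := by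
  unfold VxB at h
  rcases mk_cases n s w with h1 | h1 | h1 | h1 | h1 | h1 | h1 <;> rw [h1.1] <;>
    simp [Tile.hasW] <;> omega

theorem hasE_mk {n s w x : ℕ} (h : VxB n s w x) : (mkTile n s w).hasE = decide (x ≠ 0) := by
  unfold VxB at h
  rcases mk_cases n s w with h1 | h1 | h1 | h1 | h1 | h1 | h1 <;> rw [h1.1] <;>
    simp [Tile.hasE] <;> omega

/-- `lam` takes a pipe to its exit row, so the permutation is the inverse of `lam`. In a crossing of
two given pipes the smaller label is vertical, hence `Lab.cross_unique` gives reducedness. -/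
theorem Lab.isBPD (H : Lab k v h) : ∃ π : Equiv.Perm ℕ, IsBPD (tiling v h) π ∧
    Lbl v h π.symm := by
  obtain ⟨lam, L⟩ := H.exists_lbl
  obtain ⟨N, hN, hN2⟩ := H.far
  let e := Equiv.ofBijective lam ⟨L.lam_inj, L.exists_lam⟩
  have he : ∀ p, e p = lam p := fun p => rfl
  refine ⟨e.symm, ⟨fun j => ?_, fun i => ?_, fun i j => ?_, fun i j => ?_, fun i j => ?_,
    ⟨N + 1, fun i j hij => ?_⟩, fun p q i j i' j' hpq h1 h2 => ?_, ?_, fun r hr => ?_⟩, L⟩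
  · rw [tiling, mk_blank]
    exact ⟨H.v_zero j, H.v_one j, H.h_zero j⟩
  · rw [tiling, mk_blank]
    exact ⟨(H.row i).n_zero, (H.row i).s_zero, (H.row i).w_zero⟩
  · rw [tiling, tiling, hasS_mk, hasN_mk]
  · rw [tiling, tiling, hasE_mk (L.vx i j), hasW_mk (L.vx i (j + 1))]
  · rw [tiling, Ne, mk_bump]
    have := (H.row i).vx j
    unfold Vx at this; omega
  · have h1 := hN i j (by omega)
    have h2 := hN (i + 1) j (by omega)
    have h4 := (H.row i).vx j
    unfold idTiling tiling
    split_ifs with c1 c2 c3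
    · rw [mk_blank]
      rcases c1 with rfl | rfl
      · exact ⟨H.v_zero j, H.v_one j, H.h_zero j⟩
      · exact ⟨(H.row i).n_zero, (H.row i).s_zero, (H.row i).w_zero⟩
    · rw [mk_rElbow]; omega
    · rw [mk_horiz]
      have := hN2 i j (by omega) c3 (by omega)
      omega
    · rw [mk_vert]
      refine ⟨by omega, by omega, ?_⟩
      -- A horizontal pipe here would be right of column `j` above the crossing, while it comes from
      -- a column `d < j` in which, this far down, it runs straight.
      by_contra h0
      have h5 := H.cross_order (i := i) (j := j) (by omega) (by omega) h0
      obtain ⟨d, h6, h7⟩ := h5.2.2.2.2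
      have h8 := hN i d
      have h9 := hN (i + 1) d
      rcases Nat.lt_or_ge i N with h10 | h10
      · omega
      · have h11 := (H.row i).straight (c := d) (by omega) (by omega)
        have := h5.2.2.2.1 d (by omega)
        omega
  · rw [L.crossAt] at h1 h2
    obtain ⟨a1, a2, a3, a4⟩ := h1
    obtain ⟨b1, b2, b3, b4⟩ := h2
    have e1 := H.cross_order (i := i) (j := j) (by omega) (by omega) (by omega)
    have e2 := H.cross_order (i := i') (j := j') (by omega) (by omega) (by omega)
    exact H.cross_unique (by omega) (by omega) (by omega) (by omega) (by omega) (by omega)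
  · rw [Equiv.symm_apply_eq, he, L.lam_zero]
  · have e1 : lam (e.symm r) = r := by rw [← he]; exact e.apply_symm_apply r
    exact L.exitsRow.2 ⟨by omega, e1⟩

end Lab

theorem Lbl.perm_unique {v h : ℕ → ℕ → ℕ} {π ρ : Equiv.Perm ℕ} (H : Lbl v h π.symm)
    (hρ : IsBPD (tiling v h) ρ) : ρ = π := by
  ext r
  rcases Nat.eq_zero_or_pos r with rfl | hr
  · have h1 : π.symm 0 = 0 := H.lam_zero
    rw [hρ.map_zero, eq_comm, ← Equiv.eq_symm_apply, h1]
  · exact (Equiv.symm_apply_eq _).1 (H.exitsRow.1 (hρ.exits r hr)).2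

/-! ### The insertion procedure realises the sequence of states -/

section InsertRun

variable {T T' : Tiling} {k i j x y : ℕ}

theorem IsMinDroop.unique {x' y' : ℕ} (h : IsMinDroop T i j x y) (h' : IsMinDroop T i j x' y') :
    x' = x ∧ y' = y := by
  constructor
  · rcases lt_trichotomy x x' with h1 | h1 | h1
    · exact absurd (h'.row_cross x h.row_lt h1) (IsMinDroop.row_stop h)
    · exact h1.symm
    · exact absurd (h.row_cross x' h'.row_lt h1) (IsMinDroop.row_stop h')
  · rcases lt_trichotomy y y' with h1 | h1 | h1
    · exact absurd (h'.col_cross y h.col_lt h1) (IsMinDroop.col_stop h)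
    · exact h1.symm
    · exact absurd (h.col_cross y' h'.col_lt h1) (IsMinDroop.col_stop h')

theorem InsertRun.left_iff {U : Tiling} {y' : ℕ} (hd : IsMinDroop T i j x y)
    (hU : droop T i j x y = U) (ht : U x y = .jElbow)
    (hlt : y' < y) (hr : U x y' = .rElbow)
    (hmax : ∀ z, y' < z → z < y → U x z ≠ .rElbow) :
    InsertRun k T i j T' ↔ InsertRun k U x y' T' := by
  constructor
  · intro h
    cases h with
    | left hd' hU' ht' hlt' hr' hmax' next =>
      obtain ⟨rfl, rfl⟩ := hd.unique hd'
      rw [hU] at hU'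
      subst hU'
      rename_i z
      rcases lt_trichotomy y' z with h1 | rfl | h1
      · exact absurd hr' (hmax z h1 hlt')
      · exact next
      · exact absurd hr (hmax' _ h1 hlt)
    | swap hd' hU' ht' =>
      obtain ⟨rfl, rfl⟩ := hd.unique hd'
      rw [hU', hU, ht] at ht'; cases ht'
    | pass hd' hU' ht' =>
      obtain ⟨rfl, rfl⟩ := hd.unique hd'
      rw [hU', hU, ht] at ht'; cases ht'
    | halt hd' hU' ht' =>
      obtain ⟨rfl, rfl⟩ := hd.unique hd'
      rw [hU', hU, ht] at ht'; cases ht'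
  · exact fun h => .left hd hU.symm ht hlt hr hmax h

variable {v h : ℕ → ℕ → ℕ} {lam : ℕ → ℕ}

/-- The pipes labelled `a` and `b` cross at `(i, j)`. -/
def LCross (v h : ℕ → ℕ → ℕ) (a b i j : ℕ) : Prop :=
  v i j = v (i + 1) j ∧
    ((h i j = a ∧ v (i + 1) j = b) ∨ (h i j = b ∧ v (i + 1) j = a))

/-- Translates what the constructors of `InsertRun` ask about the two pipes of a bump into
conditions on labels. -/
theorem Lbl.bump_data (L : Lbl v h lam) (ht : tiling v h x y = .bump) :
    ∃ p q, lam p = v (x + 1) y ∧ lam q = v x y ∧ Enters (tiling v h) q x y .west ∧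
      Enters (tiling v h) p x y .south ∧
      (∀ p', Enters (tiling v h) p' x y .south → p' = p) ∧
      (∀ q', Enters (tiling v h) q' x y .west → q' = q) ∧
      (∀ x' y', CrossAt (tiling v h) p q x' y' ↔ LCross v h (v (x + 1) y) (v x y) x' y') := by
  rw [tiling, mk_bump] at ht
  have hv := L.vx x y
  have hw : h x y = v x y := by unfold VxB at hv; omega
  obtain ⟨p, hp⟩ := L.exists_lam (v (x + 1) y)
  obtain ⟨q, hq⟩ := L.exists_lam (v x y)
  refine ⟨p, q, hp, hq, L.enters_west.2 (by omega), L.enters_south.2 (by omega),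
    fun p' h' => L.lam_inj ?_, fun q' h' => L.lam_inj ?_, fun x' y' => ?_⟩
  · rw [L.enters_south] at h'; omega
  · rw [L.enters_west] at h'; omega
  · rw [L.crossAt, LCross, hp, hq]; tauto

theorem InsertRun.swap_iff (L : Lbl v h lam) {x' y' : ℕ} (hd : IsMinDroop T i j x y)
    (hU : droop T i j x y = tiling v h) (ht : tiling v h x y = .bump)
    (hc : ∀ i j, LCross v h (v (x + 1) y) (v x y) i j ↔ i = x' ∧ j = y') :
    InsertRun k T i j T' ↔
      InsertRun k (setTile (setTile (tiling v h) x y .cross) x' y' .bump) x' y' T' := by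
  obtain ⟨p, q, hp, hq, eq, ep, up, uq, hpq⟩ := L.bump_data ht
  constructor
  · intro h
    cases h with
    | left hd' hU' ht' =>
      obtain ⟨rfl, rfl⟩ := hd.unique hd'
      rw [hU', hU, ht] at ht'; cases ht'
    | swap hd' hU' ht' hq' hp' hc' next =>
      obtain ⟨rfl, rfl⟩ := hd.unique hd'
      rw [hU] at hU'
      subst hU'
      obtain rfl := up _ hp'
      obtain rfl := uq _ hq'
      obtain ⟨rfl, rfl⟩ := (hc _ _).1 ((hpq _ _).1 hc')
      exact next
    | pass hd' hU' ht' hq' hp' hc' =>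
      obtain ⟨rfl, rfl⟩ := hd.unique hd'
      rw [hU] at hU'
      subst hU'
      obtain rfl := up _ hp'
      obtain rfl := uq _ hq'
      exact absurd ((hpq _ _).2 ((hc _ _).2 ⟨rfl, rfl⟩)) (hc' x' y')
    | halt hd' hU' ht' hq' hp' hc' =>
      obtain ⟨rfl, rfl⟩ := hd.unique hd'
      rw [hU] at hU'
      subst hU'
      obtain rfl := up _ hp'
      obtain rfl := uq _ hq'
      exact absurd ((hpq _ _).2 ((hc _ _).2 ⟨rfl, rfl⟩)) (hc' x' y')
  · exact fun h => .swap hd hU.symm ht eq ep ((hpq _ _).2 ((hc _ _).2 ⟨rfl, rfl⟩)) h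

theorem InsertRun.pass_iff (L : Lbl v h lam) (hd : IsMinDroop T i j x y)
    (hU : droop T i j x y = tiling v h) (ht : tiling v h x y = .bump)
    (hc : ∀ i j, ¬ LCross v h (v (x + 1) y) (v x y) i j) (hk : v (x + 1) y ≤ k) :
    InsertRun k T i j T' ↔ InsertRun k (tiling v h) x y T' := by
  obtain ⟨p, q, hp, hq, eq, ep, up, uq, hpq⟩ := L.bump_data ht
  constructor
  · intro h
    cases h with
    | left hd' hU' ht' =>
      obtain ⟨rfl, rfl⟩ := hd.unique hd'
      rw [hU', hU, ht] at ht'; cases ht'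
    | swap hd' hU' ht' hq' hp' hc' next =>
      obtain ⟨rfl, rfl⟩ := hd.unique hd'
      rw [hU] at hU'
      subst hU'
      obtain rfl := up _ hp'
      obtain rfl := uq _ hq'
      exact absurd ((hpq _ _).1 hc') (hc _ _)
    | pass hd' hU' ht' hq' hp' hc' he hr next =>
      obtain ⟨rfl, rfl⟩ := hd.unique hd'
      rw [hU] at hU'
      subst hU'
      exact next
    | halt hd' hU' ht' hq' hp' hc' he hr =>
      obtain ⟨rfl, rfl⟩ := hd.unique hd'
      rw [hU] at hU'
      subst hU'
      obtain rfl := up _ hp'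
      rw [L.exitsRow] at he
      omega
  · refine fun h => .pass hd hU.symm ht eq ep (fun x' y' => ?_) (L.exitsRow.2 ⟨?_, rfl⟩) (by omega) h
    · rw [hpq]; exact hc x' y'
    · rw [tiling, mk_bump] at ht; omega

theorem InsertRun.halt_iff (L : Lbl v h lam) (hd : IsMinDroop T i j x y)
    (hU : droop T i j x y = tiling v h) (ht : tiling v h x y = .bump)
    (hc : ∀ i j, ¬ LCross v h (v (x + 1) y) (v x y) i j) (hk : k < v (x + 1) y) :
    InsertRun k T i j T' ↔ T' = setTile (tiling v h) x y .cross := by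
  obtain ⟨p, q, hp, hq, eq, ep, up, uq, hpq⟩ := L.bump_data ht
  constructor
  · intro h
    cases h with
    | left hd' hU' ht' =>
      obtain ⟨rfl, rfl⟩ := hd.unique hd'
      rw [hU', hU, ht] at ht'; cases ht'
    | swap hd' hU' ht' hq' hp' hc' next =>
      obtain ⟨rfl, rfl⟩ := hd.unique hd'
      rw [hU] at hU'
      subst hU'
      obtain rfl := up _ hp'
      obtain rfl := uq _ hq'
      exact absurd ((hpq _ _).1 hc') (hc _ _)
    | pass hd' hU' ht' hq' hp' hc' he hr next =>
      obtain ⟨rfl, rfl⟩ := hd.unique hd'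
      rw [hU] at hU'
      subst hU'
      obtain rfl := up _ hp'
      rw [L.exitsRow] at he
      omega
    | halt hd' hU' ht' hq' hp' hc' he hr =>
      obtain ⟨rfl, rfl⟩ := hd.unique hd'
      rw [hU', hU]
  · rintro rfl
    rw [← hU]
    refine .halt hd rfl (hU ▸ ht) (hU ▸ eq) (hU ▸ ep) (fun x' y' => ?_)
      (hU ▸ L.exitsRow.2 ⟨?_, rfl⟩) (by omega)
    · rw [hU, hpq]; exact hc x' y'
    · rw [tiling, mk_bump] at ht; omega

end InsertRun

section droop
variable {T : Tiling} {i j x a c : ℕ}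

theorem droop_row (ha : a < i ∨ x < a) (hx : i < x) : droop T i j x (j + 1) a c = T a c := by
  unfold droop
  iterate 8 rw [if_neg (by omega)]

theorem droop_col (h1 : c ≠ j) (h2 : c ≠ j + 1) : droop T i j x (j + 1) a c = T a c := by
  unfold droop
  iterate 8 rw [if_neg (by omega)]

theorem droop_nw : droop T i j x (j + 1) i j =
    match T i j with
    | .rElbow => .blank
    | .bump => .jElbow
    | t => t := by
  unfold droop; rw [if_pos ⟨rfl, rfl⟩]

theorem droop_sw (hx : i < x) : droop T i j x (j + 1) x j =
    match T x j with
    | .vert => .rElbow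
    | .jElbow => .horiz
    | t => t := by
  unfold droop; rw [if_neg (by omega), if_pos ⟨rfl, rfl⟩]

theorem droop_ne (hx : i < x) : droop T i j x (j + 1) i (j + 1) =
    match T i (j + 1) with
    | .horiz => .rElbow
    | .jElbow => .vert
    | t => t := by
  unfold droop; rw [if_neg (by omega), if_neg (by omega), if_pos ⟨rfl, rfl⟩]

theorem droop_se (hx : i < x) : droop T i j x (j + 1) x (j + 1) =
    match T x (j + 1) with
    | .blank => .jElbow
    | .rElbow => .bump
    | t => t := by
  unfold droop; rw [if_neg (by omega), if_neg (by omega), if_neg (by omega), if_pos ⟨rfl, rfl⟩]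

theorem droop_w (h1 : i < a) (h2 : a < x) : droop T i j x (j + 1) a j = (T a j).removeVert := by
  unfold droop
  iterate 5 rw [if_neg (by omega)]
  rw [if_pos (by omega)]

theorem droop_e (h1 : i < a) (h2 : a < x) :
    droop T i j x (j + 1) a (j + 1) = (T a (j + 1)).addVert := by
  unfold droop
  iterate 7 rw [if_neg (by omega)]
  rw [if_pos (by omega)]

end droop

section mix

/-- The labels `v'` in the lines `0, …, x`, and `v` below. -/
def mixV (x : ℕ) (v' v : ℕ → ℕ → ℕ) : ℕ → ℕ → ℕ := fun i => if i ≤ x then v' i else v i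

/-- The labels `h'` above row `x`, the labels `w` in row `x`, and `h` below row `x`. -/
def mixH (x : ℕ) (h' : ℕ → ℕ → ℕ) (w : ℕ → ℕ) (h : ℕ → ℕ → ℕ) : ℕ → ℕ → ℕ :=
  fun i => if i < x then h' i else if i = x then w else h i

variable {v' v h' h : ℕ → ℕ → ℕ} {w : ℕ → ℕ} {x i c : ℕ}

theorem mixV_le (hi : i ≤ x) : mixV x v' v i = v' i := if_pos hi

theorem mixV_gt (hi : x < i) : mixV x v' v i = v i := if_neg (by omega)

theorem mixH_lt (hi : i < x) : mixH x h' w h i = h' i := if_pos hi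

theorem mixH_eq : mixH x h' w h x = w := by simp [mixH]

theorem mixH_gt (hi : x < i) : mixH x h' w h i = h i := by
  unfold mixH; rw [if_neg (by omega), if_neg (by omega)]

theorem mix_lt (hi : i < x) : tiling (mixV x v' v) (mixH x h' w h) i c = tiling v' h' i c := by
  simp only [tiling]; rw [mixV_le (by omega), mixV_le (by omega), mixH_lt hi]

theorem mix_gt (hi : x < i) : tiling (mixV x v' v) (mixH x h' w h) i c = tiling v h i c := by
  simp only [tiling]; rw [mixV_gt (by omega), mixV_gt (by omega), mixH_gt hi]

theorem mix_eq : tiling (mixV x v' v) (mixH x h' w h) x c = mkTile (v' x c) (v (x + 1) c) (w c) := by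
  simp only [tiling]; rw [mixV_le le_rfl, mixV_gt (by omega), mixH_eq]

/-- Horizontal labels of a row with lines `n` and `s`, which may contain bumps. -/
structure RowB (x : ℕ) (n s w : ℕ → ℕ) : Prop where
  zero : w 0 = 0
  vx : ∀ c, VxB (n c) (s c) (w c) (w (c + 1))
  far : ∃ N, ∀ c, N ≤ c → w c = x

/-- From the left border on, each horizontal label is forced by the vertical ones. Hence horizontal
labels are identified by merely exhibiting candidates that satisfy the tile rule. -/
theorem Row.w_eq {k : ℕ} {n s w w' : ℕ → ℕ} (R : Row k n s w) (h0 : w' 0 = 0)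
    (h : ∀ c, VxB (n c) (s c) (w' c) (w' (c + 1))) : w = w' := by
  funext c
  induction c with
  | zero => rw [R.w_zero, h0]
  | succ c ih =>
    have h1 := R.vx c
    have h2 := h c
    unfold Vx at h1; unfold VxB at h2; omega

/-- Which horizontal edges are occupied depends only on which vertical ones are; an exchange of
labels between two pipes does not affect it. -/
theorem vxB_zero_iff {n s w n' s' w' : ℕ → ℕ} (h0 : w 0 = 0) (h0' : w' 0 = 0)
    (h : ∀ c, VxB (n c) (s c) (w c) (w (c + 1))) (h' : ∀ c, VxB (n' c) (s' c) (w' c) (w' (c + 1)))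
    (hn : ∀ c, n c = 0 ↔ n' c = 0) (hs : ∀ c, s c = 0 ↔ s' c = 0) (c : ℕ) :
    w c = 0 ↔ w' c = 0 := by
  induction c with
  | zero => rw [h0, h0']
  | succ c ih =>
    have h1 := h c
    have h2 := h' c
    have h3 := hn c
    have h4 := hs c
    unfold VxB at h1 h2; omega

/-- Far down, an intermediate tiling has the original labels, so its pipes have the original exit
rows: the same `lam` serves. -/
theorem Lbl.exists_lbl_mix {k : ℕ} {lam : ℕ → ℕ} (L : Lbl v h lam) (H' : Lab k v' h')
    (hx : 1 ≤ x) (hw : RowB x (v' x) (v (x + 1)) w) :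
    Lbl (mixV x v' v) (mixH x h' w h) lam := by
  obtain ⟨N, hN, hN2⟩ := L.far
  obtain ⟨N', -, hN2'⟩ := H'.far
  obtain ⟨K, hK⟩ := hw.far
  refine ⟨fun i j => ?_, fun i => ?_, fun j => ?_, L.lam_zero, L.lam_inj, N + N' + K + x + 1,
    fun i j hi => ?_, fun i j hi hij hj => ?_⟩
  · rcases lt_trichotomy i x with hi | rfl | hi
    · rw [mixV_le (by omega), mixV_le (by omega), mixH_lt hi]
      exact ((H'.row i).vx j).toB
    · rw [mixV_le le_rfl, mixV_gt (by omega), mixH_eq]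
      exact hw.vx j
    · rw [mixV_gt (by omega), mixV_gt (by omega), mixH_gt hi]
      exact L.vx i j
  · rcases lt_trichotomy i x with hi | rfl | hi
    · rw [mixH_lt hi]; exact (H'.row i).w_zero
    · rw [mixH_eq]; exact hw.zero
    · rw [mixH_gt hi]; exact L.h_col i
  · rw [mixH_lt (by omega)]; exact H'.h_zero j
  · rw [mixV_gt (by omega)]; exact hN i j (by omega)
  · rcases lt_trichotomy i x with hx | rfl | hx
    · rw [mixH_lt hx]; exact hN2' i j hi hij (by omega)
    · rw [mixH_eq]; exact hK j (by omega)
    · rw [mixH_gt hx]; exact hN2 i j hi hij (by omega)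

end mix

section Row
variable {k : ℕ} {n s w : ℕ → ℕ}

/-- A min-droop passes over crossings in column `j`; at each of them the state stays `act j`. -/
theorem Row.act_cross (R : Row k n s w) {j : ℕ} {σ' : St} (G : Good k n (.act j)) (hI : LineInj s)
    (hS : IRow k n s (.act j) σ') (hs : s j ≠ 0) (hw : w j ≠ 0) :
    σ' = .act j ∧ s j = n j ∧ s (j + 1) = 0 ∧ w (j + 1) = w j ∧ w (j + 2) = w j ∧ n j < w j := by
  obtain ⟨g1, g2, g3⟩ := G
  have h1 := R.vx j
  have h2 := R.vx (j + 1)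
  rw [show j + 1 + 1 = j + 2 from rfl] at h2
  have h3 : s j = n j ∧ s (j + 1) = 0 ∧ w (j + 1) = w j ∧ w (j + 2) = w j ∧ n j < w j := by
    unfold Vx at h1 h2; omega
  refine ⟨?_, h3⟩
  cases hS with
  | @act_left _ j' hj h => rw [hI j' j (by omega) (by omega)]
  | act_pass hj h0 h => omega
  | act_rest hj h => omega

/-- The first row whose tile in column `j` is not a crossing ends the min-droop: that tile is
vertical or a `jElbow`, and the one on its right is blank or an `rElbow`. -/
theorem Row.act_droop (R : Row k n s w) {j : ℕ} (G : Good k n (.act j)) (hI : LineInj s)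
    (h : ¬ (s j ≠ 0 ∧ w j ≠ 0)) :
    w (j + 1) = 0 ∧ w (j + 2) = s (j + 1) ∧ s (j + 1) ≠ n j ∧
      ((s j = n j ∧ w j = 0) ∨ (s j = 0 ∧ w j = n j)) := by
  have h3 : s (j + 1) ≠ n j := by
    intro he
    obtain ⟨j', h4, h5, -⟩ := R.act_next G
    have := G.1
    have := hI j' (j + 1) (by omega) (by omega)
    omega
  obtain ⟨g1, g2, g3⟩ := G
  have h1 := R.vx j
  have h2 := R.vx (j + 1)
  rw [show j + 1 + 1 = j + 2 from rfl] at h2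
  unfold Vx at h1 h2; omega

end Row

section Ins
variable {k b : ℕ} {v h v' h' : ℕ → ℕ → ℕ} {σ : ℕ → St} {i j x : ℕ} {w : ℕ → ℕ}

theorem Ins.at_act (I : Ins k b v σ v') {z : ℕ} (hz : b < z) (hσ : σ z = .act j) :
    v z j ≠ 0 ∧ v z j ≤ k ∧ v z (j + 1) = 0 ∧ v' z j = 0 ∧ v' z (j + 1) = v z j ∧
      ∀ c, c ≠ j → c ≠ j + 1 → v' z c = v z c := by
  have hg := I.good z hz
  rw [hσ] at hg
  rw [I.below z hz, hσ]
  refine ⟨hg.1, hg.2.1, hg.2.2, ?_, ?_, fun c h1 h2 => ?_⟩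
  · rw [St.perm, swap_left, hg.2.2]
  · rw [St.perm, swap_right]
  · rw [St.perm, swap_ne _ h1 h2]

/-- The row in which a min-droop ends. -/
theorem Ins.exists_droop (H : Lab k v h) (I : Ins k b v σ v') {M : ℕ}
    (hM : ∀ z, M < z → ∃ c d, σ z = .dor c d) (hb : b ≤ i) (hσ : σ (i + 1) = .act j) :
    ∃ x, i < x ∧ (∀ z, i < z → z ≤ x → σ z = .act j ∧ v z j = v (i + 1) j) ∧
      (∀ z, i < z → z < x → v (z + 1) j ≠ 0 ∧ h z j ≠ 0) ∧ ¬ (v (x + 1) j ≠ 0 ∧ h x j ≠ 0) := by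
  classical
  have step : ∀ z, i < z → σ z = .act j → v (z + 1) j ≠ 0 ∧ h z j ≠ 0 →
      σ (z + 1) = .act j ∧ v (z + 1) j = v z j := by
    intro z hz hs hc
    have hg := I.good z (by omega)
    have hi := I.step z (by omega)
    rw [hs] at hg hi
    have := (H.row z).act_cross hg (H.inj _) hi hc.1 hc.2
    exact ⟨this.1, this.2.1⟩
  have hex : ∃ x, i < x ∧ ¬ (v (x + 1) j ≠ 0 ∧ h x j ≠ 0) := by
    by_contra hcon
    push Not at hcon
    have hall : ∀ z, i + 1 ≤ z → σ z = .act j := by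
      intro z hz
      induction z, hz using Nat.le_induction with
      | base => exact hσ
      | succ m hm ih => exact (step m hm ih ⟨fun h0 => by have := hcon m hm; simp_all,
          fun h0 => by have := hcon m hm; simp_all⟩).1
    obtain ⟨c, d, he⟩ := hM (M + i + 1) (by omega)
    rw [hall _ (by omega)] at he
    cases he
  have hs := Nat.find_spec hex
  have hmin : ∀ z, i < z → z < Nat.find hex → v (z + 1) j ≠ 0 ∧ h z j ≠ 0 := by
    intro z h1 h2
    by_contra hcon
    exact Nat.find_min hex h2 ⟨h1, hcon⟩
  refine ⟨Nat.find hex, hs.1, fun z h1 h2 => ?_, hmin, hs.2⟩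
  induction z, h1 using Nat.le_induction with
  | base => exact ⟨hσ, rfl⟩
  | succ m hm ih =>
    obtain ⟨h3, h4⟩ := ih (by omega)
    have h5 := step m hm h3 (hmin m hm (by omega))
    exact ⟨h5.1, h5.2.trans h4⟩

/-- Drooping out of `(i, j)` frees the edge between columns `j` and `j + 1`, and row `i` is then
final. -/
theorem Ins.above_row (H : Lab k v h) (H' : Lab k v' h') (I : Ins k b v σ v') (hb : b ≤ i)
    (hσ : σ (i + 1) = .act j) (hw : RowB i (v' i) (v (i + 1)) w) (hne : v' i j ≠ v (i + 1) j) :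
    h' i = Function.update w (j + 1) 0 ∧ w (j + 1) = v (i + 1) j := by
  obtain ⟨a1, a2, a3, a4, a5, a6⟩ := I.at_act (z := i + 1) (by omega) hσ
  have h1 := hw.vx j
  have h2 := hw.vx (j + 1)
  have hj : j ≠ 0 := by
    rintro rfl
    exact a1 (H.row _).n_zero
  refine ⟨(H'.row i).w_eq ?_ fun c => ?_, by unfold VxB at h1; omega⟩
  · rw [Function.update_of_ne (by omega), hw.zero]
  · rcases Nat.lt_trichotomy c j with hc | rfl | hc
    · rw [a6 c (by omega) (by omega), Function.update_of_ne (by omega),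
        Function.update_of_ne (by omega)]
      exact hw.vx c
    · rw [a4, Function.update_of_ne (by omega), Function.update_self]
      unfold VxB at h1 ⊢; omega
    · by_cases hc' : c = j + 1
      · subst hc'
        rw [a5, Function.update_self, Function.update_of_ne (by omega)]
        unfold VxB at h1 h2 ⊢; omega
      · rw [a6 c (by omega) (by omega), Function.update_of_ne (by omega),
          Function.update_of_ne (by omega)]
        exact hw.vx c

/-- The bottom side of the droop puts the label of the moving pipe on the edge between columns `j`
and `j + 1`. -/
theorem Ins.droop_rowB (H : Lab k v h) (I : Ins k b v σ v') (hb : b < x) (hσ : σ x = .act j)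
    (hncross : ¬ (v (x + 1) j ≠ 0 ∧ h x j ≠ 0)) :
    RowB x (v' x) (v (x + 1)) (Function.update (h x) (j + 1) (v x j)) := by
  obtain ⟨a1, a2, a3, a4, a5, a6⟩ := I.at_act hb hσ
  have hg := I.good x hb
  rw [hσ] at hg
  obtain ⟨e1, e2, e3, e4⟩ := (H.row x).act_droop hg (H.inj _) hncross
  obtain ⟨N, -, hN⟩ := H.far
  refine ⟨?_, fun c => ?_, N + j + x + 2, fun c hc => ?_⟩
  · rw [Function.update_of_ne (by omega), (H.row x).w_zero]
  · rcases Nat.lt_trichotomy c j with hc | rfl | hc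
    · rw [a6 c (by omega) (by omega), Function.update_of_ne (by omega),
        Function.update_of_ne (by omega)]
      exact ((H.row x).vx c).toB
    · rw [a4, Function.update_of_ne (by omega), Function.update_self]
      unfold VxB; omega
    · by_cases hc' : c = j + 1
      · subst hc'
        rw [a5, Function.update_self, Function.update_of_ne (by omega)]
        rw [show j + 1 + 1 = j + 2 from rfl]
        unfold VxB; omega
      · rw [a6 c (by omega) (by omega), Function.update_of_ne (by omega),
          Function.update_of_ne (by omega)]
        exact ((H.row x).vx c).toB
  · rw [Function.update_of_ne (by omega), hN x c (by omega) (by omega) (by omega)]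

/-- Every droop spans just two columns, since `(i, j + 1)` is no crossing: its south edge is empty.
-/
theorem Ins.isMinDroop (H : Lab k v h) (I : Ins k b v σ v') (hb : b ≤ i) (hx : i < x)
    (hact : ∀ z, i < z → z ≤ x → σ z = .act j ∧ v z j = v (i + 1) j)
    (hcross : ∀ z, i < z → z < x → v (z + 1) j ≠ 0 ∧ h z j ≠ 0)
    (hncross : ¬ (v (x + 1) j ≠ 0 ∧ h x j ≠ 0)) :
    IsMinDroop (tiling (mixV i v' v) (mixH i h' w h)) i j x (j + 1) := by
  refine ⟨hx, by omega, ?_, ?_, fun z h1 h2 => ?_, fun z h1 h2 => by omega⟩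
  · rw [mix_gt hx, tiling, Ne, mk_cross]; tauto
  · obtain ⟨a1, a2, a3, -⟩ := I.at_act (z := i + 1) (by omega) (hact _ (by omega) (by omega)).1
    rw [mix_eq, Ne, mk_cross]; omega
  · have hg := I.good z (by omega)
    have hs := I.step z (by omega)
    rw [(hact z h1 (by omega)).1] at hg hs
    obtain ⟨c1, c2⟩ := hcross z h1 h2
    have := (H.row z).act_cross hg (H.inj _) hs c1 c2
    rw [mix_gt h1, tiling, mk_cross]; omega

/-- Strictly between rows `i` and `x`, the crossings in column `j` slide to column `j + 1`, and the
horizontal labels stay as they were. Only the rows `i` and `x` need the two preceding descriptions.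
-/
theorem Ins.droop_eq (H : Lab k v h) (H' : Lab k v' h') (I : Ins k b v σ v') (hb : b ≤ i)
    (hw : RowB i (v' i) (v (i + 1)) w) (hne : v' i j ≠ v (i + 1) j) (hx : i < x)
    (hact : ∀ z, i < z → z ≤ x → σ z = .act j ∧ v z j = v (i + 1) j)
    (hcross : ∀ z, i < z → z < x → v (z + 1) j ≠ 0 ∧ h z j ≠ 0)
    (hncross : ¬ (v (x + 1) j ≠ 0 ∧ h x j ≠ 0)) :
    droop (tiling (mixV i v' v) (mixH i h' w h)) i j x (j + 1) =
      tiling (mixV x v' v) (mixH x h' (Function.update (h x) (j + 1) (v x j)) h) := by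
  have hσ := (hact (i + 1) (by omega) (by omega)).1
  funext a c
  rcases Nat.lt_or_ge a i with ha | ha
  · rw [droop_row (Or.inl ha) hx, mix_lt ha, mix_lt (by omega)]
  rcases Nat.lt_or_ge x a with ha' | ha'
  · rw [droop_row (Or.inr ha') hx, mix_gt (by omega), mix_gt ha']
  by_cases hai : a = i
  · subst hai
    obtain ⟨e1, e2⟩ := Ins.above_row H H' I hb hσ hw hne
    obtain ⟨a1, a2, a3, a4, a5, a6⟩ := I.at_act (z := a + 1) (by omega) hσ
    have v1 := hw.vx j
    have v2 := hw.vx (j + 1)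
    rw [mix_lt hx, tiling, e1]
    by_cases hc : c = j
    · subst hc
      rw [droop_nw, mix_eq, a4, Function.update_of_ne (by omega)]
      by_cases h0 : v' a c = 0
      · rw [mk_rElbow.2 ⟨h0, a1⟩, mk_blank.2 ⟨h0, rfl, by unfold VxB at v1; omega⟩]
      · rw [mk_bump.2 ⟨h0, a1, by unfold VxB at v1; omega, hne⟩, mk_jElbow.2 ⟨h0, rfl⟩]
    by_cases hc' : c = j + 1
    · subst hc'
      rw [droop_ne hx, mix_eq, a5, Function.update_self]
      by_cases h0 : v' a (j + 1) = 0
      · rw [mk_horiz.2 ⟨h0, a3, by omega⟩, mk_rElbow.2 ⟨h0, a1⟩]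
      · rw [mk_jElbow.2 ⟨h0, a3⟩, mk_vert.2 ⟨h0, a1, rfl⟩]
    rw [droop_col hc hc', mix_eq, a6 c hc hc', Function.update_of_ne hc']
  by_cases hax : a = x
  · subst hax
    obtain ⟨hσ', -⟩ := hact a (by omega) le_rfl
    obtain ⟨a1, a2, a3, a4, a5, a6⟩ := I.at_act (z := a) (by omega) hσ'
    have hg := I.good a (by omega)
    rw [hσ'] at hg
    obtain ⟨e1, e2, e3, e4⟩ := (H.row a).act_droop hg (H.inj _) hncross
    rw [mix_eq]
    by_cases hc : c = j
    · subst hc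
      rw [droop_sw hx, mix_gt hx, a4, Function.update_of_ne (by omega), tiling]
      rcases e4 with e4 | e4
      · rw [mk_vert.2 ⟨a1, by omega, e4.2⟩, mk_rElbow.2 ⟨rfl, by omega⟩]
      · rw [mk_jElbow.2 ⟨a1, e4.1⟩, mk_horiz.2 ⟨rfl, e4.1, by omega⟩]
    by_cases hc' : c = j + 1
    · subst hc'
      rw [droop_se hx, mix_gt hx, a5, Function.update_self, tiling]
      by_cases h0 : v (a + 1) (j + 1) = 0
      · rw [mk_blank.2 ⟨a3, h0, e1⟩, mk_jElbow.2 ⟨a1, h0⟩]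
      · rw [mk_rElbow.2 ⟨a3, h0⟩, mk_bump.2 ⟨a1, h0, a1, by omega⟩]
    rw [droop_col hc hc', mix_gt hx, a6 c hc hc', Function.update_of_ne hc', tiling]
  · have hσa := (hact a (by omega) (by omega)).1
    obtain ⟨a1, a2, a3, a4, a5, a6⟩ := I.at_act (z := a) (by omega) hσa
    obtain ⟨b1, b2, b3, b4, b5, b6⟩ := I.at_act (z := a + 1) (by omega)
      (hact (a + 1) (by omega) (by omega)).1
    have hg := I.good a (by omega)
    have hs := I.step a (by omega)
    rw [hσa] at hg hs
    obtain ⟨c1, c2⟩ := hcross a (by omega) (by omega)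
    obtain ⟨f1, f2, f3, f4, f5, f6⟩ := (H.row a).act_cross hg (H.inj _) hs c1 c2
    have hh : h' a = h a := by
      refine (H'.row a).w_eq (H.row a).w_zero fun c => ?_
      by_cases hc : c = j
      · subst hc
        rw [a4, b4, f4]; exact Or.inl ⟨rfl, rfl, rfl⟩
      by_cases hc' : c = j + 1
      · subst hc'
        rw [a5, b5, f4, f5, f2]; unfold VxB; omega
      rw [a6 c hc hc', b6 c hc hc']
      exact ((H.row a).vx c).toB
    rw [mix_lt (by omega : a < x), tiling, hh]
    by_cases hc : c = j
    · subst hc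
      rw [droop_w (by omega) (by omega), mix_gt (by omega), a4, b4, tiling,
        mk_cross.2 ⟨a1, c1, c2, f2.symm⟩, mk_horiz.2 ⟨rfl, rfl, c2⟩]
      rfl
    by_cases hc' : c = j + 1
    · subst hc'
      rw [droop_e (by omega) (by omega), mix_gt (by omega), a5, b5, tiling,
        mk_horiz.2 ⟨a3, f3, by omega⟩, mk_cross.2 ⟨a1, c1, by omega, f2.symm⟩]
      rfl
    rw [droop_col hc hc', mix_gt (by omega), a6 c hc hc', b6 c hc hc', tiling]

end Ins

theorem mk_congr_of_straight {n s w n' s' w' : ℕ} (hn : n = 0 ↔ n' = 0) (hs : s = 0 ↔ s' = 0)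
    (hw : w = 0 ↔ w' = 0) (h : n ≠ 0 → s ≠ 0 → n = s) (h' : n' ≠ 0 → s' ≠ 0 → n' = s') :
    mkTile n s w = mkTile n' s' w' := by
  by_cases h0 : n = 0
  · have h0' := hn.1 h0
    unfold mkTile; simp only [h0, h0', if_pos, hs, hw]
  · have h0' : n' ≠ 0 := fun e => h0 (hn.2 e)
    by_cases h1 : s = 0
    · have h1' := hs.1 h1
      unfold mkTile; simp only [h0, h0', h1, h1', if_pos, if_false]
    · have h1' : s' ≠ 0 := fun e => h1 (hs.2 e)
      exact mk_congr hn hs hw ⟨fun _ => h' h0' h1', fun _ => h h0 h1⟩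

section Ins
variable {k b : ℕ} {v h v' h' : ℕ → ℕ → ℕ} {σ : ℕ → St} {i j x c d z : ℕ} {w : ℕ → ℕ}

theorem Ins.at_dor (I : Ins k b v σ v') (hz : b < z) (hσ : σ z = .dor c d) :
    v z c ≠ 0 ∧ v z c ≤ k ∧ k < v z d ∧ c < d ∧ v' z c = v z d ∧ v' z d = v z c ∧
      ∀ y, y ≠ c → y ≠ d → v' z y = v z y := by
  have hg := I.good z hz
  rw [hσ] at hg
  rw [I.below z hz, hσ]
  refine ⟨hg.1, hg.2.1, hg.2.2.1, hg.2.2.2.1, ?_, ?_, fun y h1 h2 => ?_⟩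
  · rw [St.perm, swap_left]
  · rw [St.perm, swap_right]
  · rw [St.perm, swap_ne _ h1 h2]

theorem Ins.dor_zero_iff (I : Ins k b v σ v') (hz : b < z) (hσ : σ z = .dor c d) (y : ℕ) :
    v z y = 0 ↔ v' z y = 0 := by
  obtain ⟨a1, a2, a3, a4, a5, a6, a7⟩ := I.at_dor hz hσ
  by_cases h1 : y = c
  · subst h1; omega
  by_cases h2 : y = d
  · subst h2; omega
  rw [a7 y h1 h2]

theorem Ins.dor_run (I : Ins k b v σ v') (hz : b < z) (hσ : σ z = .dor c d) {m : ℕ} (hm : z ≤ m)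
    (hall : ∀ y, z ≤ y → y ≤ m → ∃ e f, σ y = .dor e f) :
    ∃ e f, σ m = .dor e f ∧ v m e = v z c ∧ v m f = v z d := by
  induction m, hm using Nat.le_induction with
  | base => exact ⟨c, d, hσ, rfl, rfl⟩
  | succ m hm ih =>
    obtain ⟨e, f, h1, h2, h3⟩ := ih fun y h1 h2 => hall y h1 (by omega)
    obtain ⟨e', f', h4⟩ := hall (m + 1) (by omega) le_rfl
    have hs := I.step m (by omega)
    rw [h1, h4] at hs
    cases hs with
    | dor_dor hu hv hlt => exact ⟨e', f', h4, by omega, by omega⟩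

theorem Ins.dor_row (H : Lab k v h) (H' : Lab k v' h') (I : Ins k b v σ v') (hz : b < z)
    (hσ : σ z = .dor c d) {c' d' : ℕ} (hσ' : σ (z + 1) = .dor c' d') (y : ℕ) :
    tiling v h z y = tiling v' h' z y := by
  have R := H.row z
  have R' := H'.row z
  exact mk_congr_of_straight (I.dor_zero_iff hz hσ y) (I.dor_zero_iff (by omega) hσ' y)
    (vxB_zero_iff R.w_zero R'.w_zero (fun c => (R.vx c).toB) (fun c => (R'.vx c).toB)
      (I.dor_zero_iff hz hσ) (I.dor_zero_iff (by omega) hσ') y)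
    (fun h1 h2 => (R.straight h1 h2).symm) (fun h1 h2 => (R'.straight h1 h2).symm)

/-- The final row `x` has the same occupied edges as the row with the bump; the labels on the line
below are exchanged, so the bump is the only tile that changes, into a crossing. -/
theorem Ins.halt_row (H : Lab k v h) (H' : Lab k v' h') (I : Ins k b v σ v') (hx : b < x)
    (hσ : σ x = .act j) (hncross : ¬ (v (x + 1) j ≠ 0 ∧ h x j ≠ 0))
    (hσ' : σ (x + 1) = .dor c (j + 1)) (y : ℕ) :
    tiling v' h' x y = if y = j + 1 then .cross else
      mkTile (v' x y) (v (x + 1) y) (Function.update (h x) (j + 1) (v x j) y) := by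
  have R := H.row x
  have R' := H'.row x
  have B := I.droop_rowB H hx hσ hncross
  obtain ⟨a1, a2, a3, a4, a5, a6⟩ := I.at_act hx hσ
  have hw := vxB_zero_iff B.zero R'.w_zero B.vx (fun c => (R'.vx c).toB) (fun _ => Iff.rfl)
    (I.dor_zero_iff (by omega) hσ')
  have hs0 := I.dor_zero_iff (z := x + 1) (by omega) hσ'
  obtain ⟨f1, f2, f3, f4, f5, f6, f7⟩ := I.at_dor (z := x + 1) (by omega) hσ'
  split_ifs with hy
  · subst hy
    have h1 := hw (j + 1)
    rw [Function.update_self] at h1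
    rw [tiling, mk_cross]
    refine ⟨by omega, by omega, by omega, (R'.straight (by omega) (by omega)).symm⟩
  · refine (mk_congr_of_straight Iff.rfl (hs0 y) (hw y) (fun h1 h2 => ?_)
      (fun h1 h2 => (R'.straight h1 h2).symm)).symm
    by_cases hj : y = j
    · subst hj; omega
    · rw [a6 y hj hy] at h1 ⊢
      exact (R.straight h1 h2).symm

/-- The row in which a dormant insertion becomes active again. -/
theorem Ins.act_row (H : Lab k v h) (I : Ins k b v σ v') (hz : b < z)
    (hσ : σ z = .dor c d) {c' : ℕ} (hσ' : σ (z + 1) = .act c') :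
    c' = c ∧ v (z + 1) c = v z c ∧ h z c = v z d ∧
      ∃ w, RowB z (v' z) (v (z + 1)) w ∧
        ∀ y, mkTile (v' z y) (v (z + 1) y) (w y) = if y = c then .bump else tiling v h z y := by
  have R := H.row z
  have hg := I.good z hz
  have hs := I.step z hz
  rw [hσ, hσ'] at hs
  rw [hσ] at hg
  obtain ⟨a1, a2, a3, a4, a5, a6, a7⟩ := I.at_dor hz hσ
  obtain ⟨u', e, hu1, hv1, hu2, hv2, hne, hu3, hu4, hu5, hv3, hv4, hv5, hc1, hc2⟩ := R.dor_next hg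
  cases hs with
  | @dor_act _ _ _ d' hu hv hlt =>
    have I1 := H.inj (z + 1)
    obtain rfl := I1 c' u' (by omega) (by omega)
    obtain rfl := I1 d' e (by omega) (by omega)
    obtain rfl := hc1 hlt
    obtain ⟨hv3, hv6, hv7, hv8, hv9⟩ := hv3.resolve_left (by omega)
    have hzz : ∀ y, c' < y → y < d → v z y = 0 ∧ v (z + 1) y = 0 := by
      intro y h1 h2
      have := hv5 y (by omega) h2
      have := hg.2.2.2.2 y h1 h2
      omega
    obtain ⟨N, -, hN⟩ := H.far
    have hwc := hv4 c' hlt (by omega)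
    have hz0 : z ≠ 0 := by omega
    refine ⟨rfl, hu2, hwc, fun y => if c' < y ∧ y ≤ d then v z c' else h z y,
      ⟨?_, fun y => ?_, N + d + z + 1, fun y hy => ?_⟩, fun y => ?_⟩
    · rw [if_neg (by omega), R.w_zero]
    · rcases lt_trichotomy y c' with h1 | rfl | h1
      · rw [if_neg (by omega), if_neg (by omega), a7 y (by omega) (by omega)]
        exact (R.vx y).toB
      · rw [if_neg (by omega), if_pos (by omega), a5]
        unfold VxB; omega
      · rcases lt_trichotomy y d with h2 | rfl | h2
        · rw [if_pos (by omega), if_pos (by omega), a7 y (by omega) (by omega), (hzz y h1 h2).1,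
            (hzz y h1 h2).2]
          exact Or.inl ⟨rfl, rfl, rfl⟩
        · rw [if_pos (by omega), if_neg (by omega), a6, hv8, hv9]
          unfold VxB; omega
        · rw [if_neg (by omega), if_neg (by omega), a7 y (by omega) (by omega)]
          exact (R.vx y).toB
    · rw [if_neg (by omega), hN z y (by omega) (by omega) (by omega)]
    · dsimp only
      by_cases h1 : y = c'
      · subst h1
        rw [if_pos rfl, if_neg (by omega), mk_bump]; omega
      rw [if_neg h1, tiling]
      by_cases h2 : c' < y ∧ y ≤ d
      · rw [if_pos h2]
        refine mk_congr_of_straight (I.dor_zero_iff hz hσ y).symm Iff.rfl ?_ ?_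
          (fun h3 h4 => (R.straight h3 h4).symm)
        · rw [hv4 y (by omega) h2.2]; omega
        · intro h3 h4
          rcases Nat.lt_or_ge y d with h5 | h5
          · exact absurd (hzz y (by omega) h5).2 h4
          · rw [show y = d by omega] at h4
            exact absurd hv8 h4
      · rw [if_neg h2]
        refine mk_congr_of_straight (I.dor_zero_iff hz hσ y).symm Iff.rfl Iff.rfl ?_
          (fun h3 h4 => (R.straight h3 h4).symm)
        intro h3 h4
        by_cases h5 : y = d
        · subst h5; omega
        rw [a7 y h1 h5] at h3 ⊢
        exact (R.straight h3 h4).symm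

/-- The crossings of the intermediate tilings. -/
theorem Ins.mix_cross (H : Lab k v h) (H' : Lab k v' h') (I : Ins k b v σ v') (hx : b < x)
    (hσ : σ x = .act j) (hncross : ¬ (v (x + 1) j ≠ 0 ∧ h x j ≠ 0)) {p q y : ℕ} (hp : p ≠ 0)
    (hq : q ≠ 0)
    (hc : LCross (mixV x v' v) (mixH x h' (Function.update (h x) (j + 1) (v x j)) h) p q z y) :
    (k < p ∨ k < q) ∧ (q < p →
      (z < x ∧ v' z y = q ∧ v' (z + 1) y = q ∧ h' z y = p) ∨
      (z = x ∧ v' x y = q ∧ y ≠ j + 1) ∨ (x < z ∧ v z y = q ∧ v (z + 1) y = q ∧ h z y = p)) := by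
  have B := I.droop_rowB H hx hσ hncross
  obtain ⟨a1, a2, a3, a4, a5, a6⟩ := I.at_act hx hσ
  obtain ⟨h1, h2⟩ := hc
  rcases lt_trichotomy z x with hz | rfl | hz
  · rw [mixV_le (i := z) (by omega)] at h1
    rw [mixV_le (i := z + 1) (by omega)] at h1 h2
    rw [mixH_lt hz] at h2
    have h3 := H'.cross_order (i := z) (j := y) (by omega) (by omega) (by omega)
    omega
  · rw [mixV_gt (i := z + 1) (by omega)] at h1 h2
    rw [mixV_le (i := z) (by omega)] at h1
    rw [mixH_eq] at h2
    have hj : y ≠ j := by rintro rfl; omega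
    have hj' : y ≠ j + 1 := by
      rintro rfl
      have hg := I.good z hx
      rw [hσ] at hg
      have := (H.row z).act_droop hg (H.inj _) hncross
      omega
    rw [Function.update_of_ne hj'] at h2
    have e := a6 y hj hj'
    have h3 := H.cross_order (i := z) (j := y) (by omega) (by omega) (by omega)
    omega
  · rw [mixV_gt (i := z) (by omega)] at h1
    rw [mixV_gt (i := z + 1) (by omega)] at h1 h2
    rw [mixH_gt hz] at h2
    have h3 := H.cross_order (i := z) (j := y) (by omega) (by omega) (by omega)
    omega

/-- The crossings of the two pipes of a bump at which the insertion becomes dormant. -/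
theorem Ins.halt_cross (H : Lab k v h) (H' : Lab k v' h') (I : Ins k b v σ v') (hx : b < x)
    (hσ : σ x = .act j) (hncross : ¬ (v (x + 1) j ≠ 0 ∧ h x j ≠ 0))
    (hσ' : σ (x + 1) = .dor c (j + 1)) {y : ℕ}
    (hc : LCross (mixV x v' v) (mixH x h' (Function.update (h x) (j + 1) (v x j)) h)
      (v (x + 1) (j + 1)) (v x j) z y) :
    x < z ∧ v z y = v x j ∧ v (z + 1) y = v x j ∧ h z y = v (x + 1) (j + 1) := by
  obtain ⟨f1, f2, f3, f4, f5, f6, f7⟩ := I.at_dor (z := x + 1) (by omega) hσ'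
  obtain ⟨a1, a2, a3, a4, a5, a6⟩ := I.at_act hx hσ
  rcases (I.mix_cross H H' hx hσ hncross (by omega) a1 hc).2 (by omega) with
    ⟨h1, h2, h3, h4⟩ | ⟨h1, h2, h3⟩ | h1
  · exfalso
    obtain ⟨b1, b2, -, -, e, b4, b5⟩ := H'.cross_order (i := z) (j := y) (by omega) (by omega)
      (by omega)
    obtain ⟨t, ht⟩ := H'.present (i := z + 1) (i' := x) h1 (c := e) (by omega)
    have hne : t ≠ j := by rintro rfl; omega
    have hne' : t ≠ j + 1 := by rintro rfl; omega
    have ht' := a6 t hne hne'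
    -- The pipe with the larger label has its `rElbow` in column `j + 1`, so on line `x` it is
    -- further right. In that order the two pipes cannot cross above.
    have hlt : j + 1 < t := by
      rcases (H.row x).down (c := t) (by omega) with h5 | ⟨e', h5, h6, -⟩
      · have := H.inj (x + 1) t (j + 1) (by omega) (by omega)
        omega
      · have := H.inj (x + 1) e' (j + 1) (by omega) (by omega)
        omega
    have := H'.ord (i := x) (i' := z + 1) (a := v x j) (b := v (x + 1) (j + 1)) (ca := j + 1)
      (cb := t) (na := y) (nb := e) h1 a1 (by omega) a5 (by omega) hlt h3 (by omega)
    omega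
  · have := H'.inj x y (j + 1) (by omega) (by omega)
    omega
  · exact h1

theorem setTile_apply (T : Tiling) (x y : ℕ) (t : Tile) (i j : ℕ) :
    setTile T x y t i j = if i = x ∧ j = y then t else T i j := rfl

/-- The invariant: when the procedure is about to droop at `(i, j)`, the rows above `i` are final,
those below are original, and by `hne` the tile `(i, j)` is an `rElbow` or a bump. One step leads to
the row `x` where the droop ends or, after a cross-bump swap, to the row of the old crossing. The
induction is on the number of lines left before the insertion is dormant for good. -/
theorem Ins.insertRun_iff (H : Lab k v h) (H' : Lab k v' h') (I : Ins k b v σ v') {M : ℕ}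
    (hM : ∀ z, M < z → ∃ c d, σ z = .dor c d) {T' : Tiling} (n : ℕ) : ∀ {i j : ℕ} {w : ℕ → ℕ},
    M ≤ i + n → b ≤ i → 1 ≤ i → σ (i + 1) = .act j → RowB i (v' i) (v (i + 1)) w →
    v' i j ≠ v (i + 1) j →
    (InsertRun k (tiling (mixV i v' v) (mixH i h' w h)) i j T' ↔ T' = tiling v' h') := by
  classical
  induction n with
  | zero =>
    intro i j w h1 h2 h3 h4
    obtain ⟨c, d, h5⟩ := hM (i + 1) (by omega)
    rw [h4] at h5; cases h5
  | succ n ih =>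
    intro i j w h1 h2 h3 h4 hw hne
    obtain ⟨lam, L⟩ := H.exists_lbl
    obtain ⟨x, hx, hact, hcross, hncross⟩ := I.exists_droop H hM h2 h4
    have hd := I.isMinDroop (w := w) (h' := h') H h2 hx hact hcross hncross
    have hU := I.droop_eq H H' h2 hw hne hx hact hcross hncross
    have hbx : b < x := by omega
    have hσ := (hact x hx le_rfl).1
    have B := I.droop_rowB H hbx hσ hncross
    have L' := L.exists_lbl_mix H' (by omega) B
    obtain ⟨a1, a2, a3, a4, a5, a6⟩ := I.at_act hbx hσ
    have hg := I.good x hbx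
    have hs := I.step x hbx
    rw [hσ] at hg hs
    have R := H.row x
    obtain ⟨e1, e2, e3, e4⟩ := R.act_droop hg (H.inj _) hncross
    obtain ⟨j', hj, n1, n2, n3, n4, n5, n6, n7, n8⟩ := R.act_next hg
    generalize hτ : σ (x + 1) = τ at hs
    cases hs with
    | @act_left _ j₁ hj₁ h0 =>
      obtain rfl := H.inj (x + 1) j₁ j' (by omega) (by omega)
      have hz : v' x j₁ = 0 := by
        rcases Nat.lt_or_ge j₁ j with h5 | h5
        · rw [a6 _ (by omega) (by omega)]; exact n2 h5
        · rw [show j₁ = j by omega]; exact a4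
      rw [InsertRun.left_iff hd hU (y' := j₁) ?_ (by omega) ?_ ?_]
      · exact ih (by omega) (by omega) (by omega) hτ B (by omega)
      · rw [mix_eq, mk_jElbow]; omega
      · rw [mix_eq, mk_rElbow]; omega
      · intro z h5 h6
        rw [mix_eq, Ne, mk_rElbow]
        have := n3 z h5 (by omega)
        omega
    | @act_pass _ j₁ hj₁ h0 hk =>
      have ht : tiling (mixV x v' v) (mixH x h' (Function.update (h x) (j + 1) (v x j)) h) x (j + 1)
          = .bump := by
        rw [mix_eq, mk_bump, Function.update_self]; omega
      rw [InsertRun.pass_iff L' hd hU ht ?_ ?_]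
      · exact ih (by omega) (by omega) (by omega) hτ B (by omega)
      · intro z y hc
        rw [mixV_gt (by omega), mixV_le le_rfl, a5] at hc
        have := (I.mix_cross H H' hbx hσ hncross h0 a1 hc).1
        omega
      · rw [mixV_gt (by omega)]; exact hk
    | @act_rest _ c hj₁ hk =>
      have ht : tiling (mixV x v' v) (mixH x h' (Function.update (h x) (j + 1) (v x j)) h) x (j + 1)
          = .bump := by
        rw [mix_eq, mk_bump, Function.update_self]; omega
      have hcr := fun z y => I.halt_cross (z := z) (y := y) H H' hbx hσ hncross hτ
      by_cases hex : ∃ m, x < m ∧ ∃ c', σ (m + 1) = .act c'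
      · have hs := Nat.find_spec hex
        have hmin : ∀ m, m < Nat.find hex → ∀ c', x < m → σ (m + 1) ≠ .act c' :=
          fun m h5 c' h6 h7 => Nat.find_min hex h5 ⟨h6, c', h7⟩
        generalize Nat.find hex = m at hs hmin
        obtain ⟨hm, c', hc'⟩ := hs
        have hall : ∀ y, x + 1 ≤ y → y ≤ m → ∃ e f, σ y = .dor e f := by
          intro y h5 h6
          cases hy : σ y with
          | dor e f => exact ⟨e, f, rfl⟩
          | act e =>
            rcases Nat.lt_or_ge (x + 1) y with h7 | h7
            · obtain ⟨y, rfl⟩ : ∃ z, y = z + 1 := ⟨y - 1, by omega⟩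
              exact absurd hy (hmin y (by omega) e (by omega))
            · rw [show y = x + 1 by omega, hτ] at hy; cases hy
        obtain ⟨e, f, hm1, hm2, hm3⟩ := I.dor_run (z := x + 1) (by omega) hτ hm hall
        obtain ⟨rfl, r1, r2, w2, B2, hB2⟩ := I.act_row H (by omega) hm1 hc'
        obtain ⟨f1, f2, f3, f4, f5, f6, f7⟩ := I.at_dor (z := m) (by omega) hm1
        rw [InsertRun.swap_iff L' hd hU ht (x' := m) (y' := c') ?_]
        -- On the dormant rows the original and final tilings have the same tiles, so after the swap
        -- everything above row `m` is already final.
        · have hT : setTile (setTile (tiling (mixV x v' v) (mixH x h'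
              (Function.update (h x) (j + 1) (v x j)) h)) x (j + 1) .cross) m c' .bump =
              tiling (mixV m v' v) (mixH m h' w2 h) := by
            funext a y
            rw [setTile_apply, setTile_apply]
            rcases lt_trichotomy a m with h5 | rfl | h5
            · rw [if_neg (by omega), mix_lt (x := m) h5]
              rcases lt_trichotomy a x with h6 | rfl | h6
              · rw [if_neg (by omega), mix_lt h6]
              · rw [I.halt_row H H' hbx hσ hncross hτ y, mix_eq]
                simp
              · rw [if_neg (by omega), mix_gt h6]
                obtain ⟨_, _, h7⟩ := hall a (by omega) (by omega)
                obtain ⟨_, _, h8⟩ := hall (a + 1) (by omega) (by omega)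
                exact I.dor_row H H' (by omega) h7 h8 y
            · rw [mix_eq (x := a), hB2]
              by_cases h6 : y = c'
              · rw [if_pos ⟨rfl, h6⟩, if_pos h6]
              · rw [if_neg (by omega), if_neg (by omega), if_neg h6, mix_gt (by omega)]
            · rw [if_neg (by omega), if_neg (by omega), mix_gt (by omega), mix_gt h5]
          rw [hT]
          exact ih (by omega) (by omega) (by omega) hc' B2 (by omega)
        · intro z y
          rw [mixV_gt (by omega), mixV_le le_rfl, a5]
          constructor
          · intro h5
            have h6 := hcr z y h5
            exact H.cross_unique (by omega) (by omega) (by omega) (by omega) (by omega) (by omega)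
          · rintro ⟨rfl, rfl⟩
            rw [LCross, mixV_gt (by omega), mixV_gt (by omega), mixH_gt (by omega)]
            omega
      · have hall : ∀ y, x + 1 ≤ y → ∃ e f, σ y = .dor e f := by
          intro y h5
          cases hy : σ y with
          | dor e f => exact ⟨e, f, rfl⟩
          | act e =>
            rcases Nat.lt_or_ge (x + 1) y with h7 | h7
            · obtain ⟨y, rfl⟩ : ∃ z, y = z + 1 := ⟨y - 1, by omega⟩
              exact absurd ⟨y, by omega, e, hy⟩ hex
            · rw [show y = x + 1 by omega, hτ] at hy; cases hy
        rw [InsertRun.halt_iff L' hd hU ht ?_ ?_]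
        · have hT : setTile (tiling (mixV x v' v) (mixH x h'
              (Function.update (h x) (j + 1) (v x j)) h)) x (j + 1) .cross = tiling v' h' := by
            funext a y
            rw [setTile_apply]
            rcases lt_trichotomy a x with h6 | rfl | h6
            · rw [if_neg (by omega), mix_lt h6]
            · rw [I.halt_row H H' hbx hσ hncross hτ y, mix_eq]
              simp
            · rw [if_neg (by omega), mix_gt h6]
              obtain ⟨_, _, h7⟩ := hall a (by omega)
              obtain ⟨_, _, h8⟩ := hall (a + 1) (by omega)
              exact I.dor_row H H' (by omega) h7 h8 y
          rw [hT]
        -- Just below a crossing the pipe with the larger label would be on the left, against the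
        -- order of a dormant pair.
        · intro z y h5
          rw [mixV_gt (by omega), mixV_le le_rfl, a5] at h5
          obtain ⟨h6, h7, h8, h9⟩ := hcr z y h5
          obtain ⟨e, f, hm1, hm2, hm3⟩ := I.dor_run (z := x + 1) (m := z) (by omega) hτ h6
            fun y h5 _ => hall y h5
          obtain ⟨e', f', hm1', hm2', hm3'⟩ := I.dor_run (z := x + 1) (m := z + 1) (by omega) hτ
            (by omega) fun y h5 _ => hall y h5
          obtain ⟨f1, f2, f3, f4, -⟩ := I.at_dor (z := z + 1) (by omega) hm1'
          obtain ⟨-, -, -, -, t, ht1, ht2⟩ := H.cross_order (i := z) (j := y) (by omega) (by omega)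
            (by omega)
          have := H.inj (z + 1) y e' (by omega) (by omega)
          have := H.inj (z + 1) t f' (by omega) (by omega)
          omega
        · rw [mixV_gt (by omega)]; exact hk

theorem Ins.rightInsert_iff (H : Lab k v h) (H' : Lab k v' h') (I : Ins k b v σ v') (hb : 1 ≤ b)
    (hk : b ≤ k) {T' : Tiling} : RightInsert (tiling v h) b k T' ↔ T' = tiling v' h' := by
  obtain ⟨j, h1, h2, h3, h4⟩ := H.start hb hk
  obtain ⟨N, hN, hN2⟩ := H.far
  have hd := H.eventually_dor hN hN2 (fun i hi => ⟨I.good i hi, I.step i hi⟩)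
    (i := N + b + k + 1) (by omega) (by omega) (by omega)
  obtain ⟨j', s1, s2⟩ := I.start
  obtain rfl := H.inj (b + 1) j' j (by omega) (by omega)
  have hv := I.above b le_rfl
  -- Lines up to `b` are unchanged, so the initial tiling already has the mixed form required by the
  -- invariant.
  have hT : tiling v h = tiling (mixV b v' v) (mixH b h' (h b) h) := by
    funext i c
    rcases lt_trichotomy i b with hi | rfl | hi
    · have e : h' i = h i := by
        refine (H'.row i).w_eq (H.row i).w_zero fun c => ?_
        rw [I.above i (by omega), I.above (i + 1) (by omega)]
        exact ((H.row i).vx c).toB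
      rw [mix_lt hi, tiling, tiling, I.above i (by omega), I.above (i + 1) (by omega), e]
    · rw [mix_eq, tiling, hv]
    · rw [mix_gt hi]
  have key := Ins.insertRun_iff (T' := T') (w := h b) (i := b) (j := j') H H' I hd (N + b + k + 1)
    (by omega) le_rfl hb s1 ⟨(H.row b).w_zero, fun c => by rw [hv]; exact ((H.row b).vx c).toB,
      N + b + 1, fun c hc => hN2 b c hb (by omega) (by omega)⟩ (by rw [hv]; omega)
  rw [← hT] at key
  rw [← key]
  constructor
  · rintro ⟨y, y1, y2, y3⟩
    rw [tiling, mk_rElbow] at y1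
    rcases lt_trichotomy y j' with h5 | rfl | h5
    · refine absurd ?_ (y2 j' h5)
      rw [tiling, mk_rElbow]; omega
    · exact y3
    · have := (h4 y h5).2.2
      omega
  · intro h5
    refine ⟨j', ?_, fun y hy => ?_, h5⟩
    · rw [tiling, mk_rElbow]; omega
    · have := (h4 y hy).2.2
      rw [tiling, Ne, mk_rElbow]; omega

end Ins

/-! ### Jeu de taquin as an exchange of adjacent columns -/

/-- Jeu de taquin exchanges the columns `y` and `y + 1` of a line. -/
def JInv (n : ℕ → ℕ) (y : ℕ) : Prop := n (y + 1) ≠ 0 ∧ (n y = 0 ∨ n (y + 1) < n y)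

/-- A step of jeu de taquin, from the top line of a row, with labels `n`, to the bottom line, with
labels `s`. -/
def JRow (n s : ℕ → ℕ) (y y₁ : ℕ) : Prop :=
  (s (y + 1) ≠ 0 ∧ y₁ = y) ∨ (s (y + 1) = 0 ∧ y < y₁ ∧ (∀ c, y < c → c ≤ y₁ → s c = 0) ∧
    (∀ c, y + 1 < c → c ≤ y₁ → n c = 0) ∧ s (y₁ + 1) ≠ 0)

/-- Jeu de taquin from row `r` on: it exchanges the columns `y i` and `y i + 1` of each line `i`
below row `r`. -/
structure JCert (r : ℕ) (v : ℕ → ℕ → ℕ) (y : ℕ → ℕ) (v' : ℕ → ℕ → ℕ) : Prop where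
  row_pos : 1 ≤ r
  col : r ≤ y (r + 1)
  start : v (r + 1) (y (r + 1) + 1) = r
  start_zero : v (r + 1) (y (r + 1)) = 0
  step : ∀ i, r < i → JRow (v i) (v (i + 1)) (y i) (y (i + 1))
  inv : ∀ i, r < i → JInv (v i) (y i)
  above : ∀ i, i ≤ r → v' i = v i
  below : ∀ i, r < i → v' i = v i ∘ Equiv.swap (y i) (y i + 1)

section undroop
variable {T : Tiling} {x y x' i c : ℕ}

theorem undroop_row (hx : x < x') (hi : i < x ∨ x' < i) : undroop T x y x' i c = T i c := by
  unfold undroop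
  split_ifs <;> first | rfl | omega

theorem undroop_col (h1 : c ≠ y) (h2 : c ≠ y + 1) : undroop T x y x' i c = T i c := by
  unfold undroop
  rw [if_neg h1, if_neg h2]

theorem undroop_nw : undroop T x y x' x y = .rElbow := by
  unfold undroop
  rw [if_pos rfl, if_pos rfl]

theorem undroop_sw (hx : x < x') : undroop T x y x' x' y =
    match T x' y with
    | .horiz => .jElbow
    | .rElbow => .vert
    | t => t := by
  unfold undroop
  rw [if_pos rfl, if_neg (by omega), if_pos rfl]

theorem undroop_ne : undroop T x y x' x (y + 1) =
    match T x (y + 1) with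
    | .rElbow => .horiz
    | .vert => .jElbow
    | t => t := by
  unfold undroop
  rw [if_neg (by omega), if_pos rfl, if_pos rfl]

theorem undroop_se (hx : x < x') : undroop T x y x' x' (y + 1) =
    match T x' (y + 1) with
    | .jElbow => .blank
    | .cross => .rElbow
    | t => t := by
  unfold undroop
  rw [if_neg (by omega), if_pos rfl, if_neg (by omega), if_pos rfl]

theorem undroop_w (h1 : x < i) (h2 : i < x') : undroop T x y x' i y =
    match T i y with
    | .rElbow => .vert
    | .jElbow => .cross
    | t => t.addVert := by
  unfold undroop
  rw [if_pos rfl, if_neg (by omega), if_neg (by omega), if_pos ⟨h1, h2⟩]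

theorem undroop_e (h1 : x < i) (h2 : i < x') : undroop T x y x' i (y + 1) =
    match T i y with
    | .rElbow => .rElbow
    | .jElbow => .jElbow
    | .blank => (T i (y + 1)).removeVert
    | .horiz => (T i (y + 1)).removeVert
    | _ => T i (y + 1) := by
  unfold undroop
  rw [if_neg (by omega), if_pos rfl, if_neg (by omega), if_neg (by omega), if_pos ⟨h1, h2⟩]

end undroop

section JdtRun
variable {T T' : Tiling} {x y y' x' p a : ℕ}

theorem IsBlockEnd.unique {y'' : ℕ} (h : IsBlockEnd T x y y') (h' : IsBlockEnd T x y y'') :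
    y'' = y' := by
  obtain ⟨a1, a2, a3⟩ := h
  obtain ⟨b1, b2, b3⟩ := h'
  rcases lt_trichotomy y' y'' with h1 | h1 | h1
  · exact absurd (b2 (y' + 1) (by omega) h1) a3
  · exact h1.symm
  · exact absurd (a2 (y'' + 1) (by omega) h1) b3

/-- Determinism again: a run of jeu de taquin has only one possible constructor, here `step` and in
the next lemma `uncross`. -/
theorem JdtRun.step_iff (hb : IsBlockEnd T x y y') (hp : Enters T p x (y' + 1) .south)
    (hu : ∀ p', Enters T p' x (y' + 1) .south → p' = p) (hne : p ≠ y' + 1)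
    (hlt : x < x') (ht : T x' (y' + 1) = .jElbow) (hp' : Enters T p x' (y' + 1) .west)
    (hx : ∀ x'', x < x'' → T x'' (y' + 1) = .jElbow → Enters T p x'' (y' + 1) .west → x'' = x') :
    JdtRun T x y a T' ↔ JdtRun (undroop T x y' x') x' (y' + 1) a T' := by
  constructor
  · intro h
    cases h with
    | step hb' hp1 hne' hlt' ht' hp2 next =>
      obtain rfl := hb.unique hb'
      obtain rfl := hu _ hp1
      obtain rfl := hx _ hlt' ht' hp2
      exact next
    | uncross hb' hp1 hlt' hc =>
      obtain rfl := hb.unique hb'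
      exact absurd (hu _ hp1).symm hne
  · exact fun h => .step hb hp hne hlt ht hp' h

theorem JdtRun.uncross_iff (hb : IsBlockEnd T x y y') (hp : Enters T (y' + 1) x (y' + 1) .south)
    (hu : ∀ p', Enters T p' x (y' + 1) .south → p' = y' + 1)
    (hlt : x < x') (hc : CrossAt T y' (y' + 1) x' (y' + 1))
    (hx : ∀ x'', x < x'' → CrossAt T y' (y' + 1) x'' (y' + 1) → x'' = x') :
    JdtRun T x y a T' ↔ a = y' ∧ T' = undroop T x y' x' := by
  constructor
  · intro h
    cases h with
    | step hb' hp1 hne' hlt' ht' hp2 next =>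
      obtain rfl := hb.unique hb'
      exact absurd (hu _ hp1) hne'
    | uncross hb' hp1 hlt' hc' =>
      obtain rfl := hb.unique hb'
      obtain rfl := hx _ hlt' hc'
      exact ⟨rfl, rfl⟩
  · rintro ⟨rfl, rfl⟩
    exact .uncross hb hp hlt hc

end JdtRun

/-! ### The jeu de taquin procedure realises the exchange of columns -/

section JCert
variable {k k' r : ℕ} {v h v' h' : ℕ → ℕ → ℕ} {y : ℕ → ℕ} {i x x' : ℕ} {w : ℕ → ℕ}

/-- Pipes run from south to east, so followed downwards they only go to the left. -/
theorem Lab.col_mono (H : Lab k v h) {i i' c d : ℕ} (hi : i ≤ i') (h0 : v i c ≠ 0)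
    (he : v i' d = v i c) : d ≤ c := by
  induction i', hi using Nat.le_induction generalizing d with
  | base => rw [H.inj i d c he (by omega)]
  | succ m hm ih =>
    obtain ⟨e, h1⟩ := H.present hm h0
    have h2 := ih h1
    clear ih
    rcases (H.row m).down (c := e) (by omega) with h3 | ⟨f, h3, h4, -⟩
    · rw [H.inj (m + 1) d e (by omega) (by omega)]; exact h2
    · rw [H.inj (m + 1) d f (by omega) (by omega)]; omega

theorem JCert.line (J : JCert r v y v') (hi : r < i) : v' i (y i) = v i (y i + 1) ∧
    v' i (y i + 1) = v i (y i) ∧ ∀ c, c ≠ y i → c ≠ y i + 1 → v' i c = v i c := by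
  rw [J.below i hi]
  exact ⟨swap_left _ _ _, swap_right _ _ _, fun c h1 h2 => swap_ne _ h1 h2⟩

theorem JCert.mono (J : JCert r v y v') (hi : r < i) {i' : ℕ} (hi' : i ≤ i') : y i ≤ y i' := by
  induction i', hi' using Nat.le_induction with
  | base => exact le_rfl
  | succ m hm ih =>
    rcases J.step m (by omega) with ⟨-, h1⟩ | ⟨-, h1, -⟩ <;> omega

theorem JCert.pos (J : JCert r v y v') (hi : r < i) : r ≤ y i :=
  J.col.trans (J.mono (Nat.lt_succ_self r) hi)

theorem JCert.stay_label (H : Lab k v h) (J : JCert r v y v') (hi : r < i)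
    (h : y (i + 1) = y i) : v (i + 1) (y i + 1) = v i (y i + 1) := by
  refine (H.row i).straight (J.inv i hi).1 ?_
  rcases J.step i hi with ⟨h1, -⟩ | ⟨-, h1, -⟩
  · exact h1
  · omega

/-- A pipe entering from the west leaves through the north or east edge, so a small label could not
hide on the west edge alone. -/
theorem Vx.west_lt {k n s w e P : ℕ} (hv : Vx k n s w e) (hn : n = 0 ∨ P < n) (hs : s = 0 ∨ P < s)
    (he : e = 0 ∨ P < e) : w = 0 ∨ P < w := by
  unfold Vx at hv; omega

/-- While the column is kept, the pipe in column `y i + 1` runs straight, and all labels in column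
`y i` and on the horizontal edges beside the two columns exceed its own. It may therefore change
places with column `y i` and still be the vertical pipe in every crossing. -/
theorem JCert.stay_data (H : Lab k v h) (J : JCert r v y v') (hi : r < i)
    (hy : y (i + 1) = y i) : v (i + 1) (y i + 1) = v i (y i + 1) ∧ v i (y i + 1) ≠ 0 ∧
      (v i (y i) = 0 ∨ v i (y i + 1) < v i (y i)) ∧
      (v (i + 1) (y i) = 0 ∨ v i (y i + 1) < v (i + 1) (y i)) ∧
      (h i (y i) = 0 ∨ v i (y i + 1) < h i (y i)) ∧
      (h i (y i + 1) = 0 ∨ v i (y i + 1) < h i (y i + 1)) ∧ h i (y i + 1 + 1) = h i (y i + 1) := by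
  have hl := J.stay_label H hi hy
  obtain ⟨j1, j2⟩ := J.inv i hi
  obtain ⟨j3, j4⟩ := J.inv (i + 1) (by omega)
  rw [hy, hl] at j4
  have v1 := (H.row i).vx (y i)
  have v2 := (H.row i).vx (y i + 1)
  have h5 : (h i (y i + 1) = 0 ∨ v i (y i + 1) < h i (y i + 1)) ∧
      h i (y i + 1 + 1) = h i (y i + 1) := by
    clear v1
    unfold Vx at v2; omega
  exact ⟨hl, j1, j2, j4, v1.west_lt j2 j4 h5.1, h5.1, h5.2⟩

theorem JCert.stay_row (H : Lab k v h) (H' : Lab k' v' h') (J : JCert r v y v') (hi : r < i)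
    (hy : y (i + 1) = y i) : h' i = Function.update (h i) (y i + 1) (h i (y i)) := by
  obtain ⟨hl, d1, d2, d3, d4, d5, d6⟩ := J.stay_data H hi hy
  obtain ⟨a1, a2, a3⟩ := J.line hi
  obtain ⟨b1, b2, b3⟩ := J.line (i := i + 1) (by omega)
  rw [hy] at b1 b2 b3
  refine (H'.row i).w_eq ?_ fun c => ?_
  · rw [Function.update_of_ne (by omega), (H.row i).w_zero]
  · by_cases h1 : c = y i
    · subst h1
      rw [Function.update_of_ne (by omega), Function.update_self, a1, b1, hl]
      clear d2 d3 d5 d6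
      unfold VxB; omega
    by_cases h2 : c = y i + 1
    · subst h2
      rw [Function.update_self, Function.update_of_ne (by omega), a2, b2, d6]
      exact ((H.row i).vx (y i)).toB
    rw [a3 c h1 h2, b3 c h1 h2, Function.update_of_ne h2, Function.update_of_ne (by omega)]
    exact ((H.row i).vx c).toB

/-- The effect of an undroop on an intermediate row. -/
theorem JCert.stay_tiles (H : Lab k v h) (H' : Lab k' v' h') (J : JCert r v y v') (hi : r < i)
    (hy : y (i + 1) = y i) {T : Tiling} (hT : ∀ c, T i c = tiling v h i c) (h1 : x < i)
    (h2 : i < x') (c : ℕ) : undroop T x (y i) x' i c = tiling v' h' i c := by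
  obtain ⟨hl, d1, d2, d3, d4, d5, d6⟩ := J.stay_data H hi hy
  obtain ⟨a1, a2, a3⟩ := J.line hi
  obtain ⟨b1, b2, b3⟩ := J.line (i := i + 1) (by omega)
  rw [hy] at b1 b2 b3
  have v1 := (H.row i).vx (y i)
  have hh := J.stay_row H H' hi hy
  by_cases c1 : c = y i
  · subst c1
    rw [undroop_w h1 h2, hT, tiling, tiling, a1, b1, hh, Function.update_of_ne (by omega)]
    unfold Vx at v1
    rcases mk_cases (v i (y i)) (v (i + 1) (y i)) (h i (y i)) with m | m | m | m | m | m | m <;>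
      rw [m.1] <;> simp only [Tile.addVert] <;> symm
    · rw [mk_vert]; omega
    · rw [mk_cross]; omega
    · rw [mk_vert]; omega
    · rw [mk_cross]; omega
    · rw [mk_vert]; omega
    · rw [mk_cross]; omega
    · omega
  by_cases c2 : c = y i + 1
  · subst c2
    rw [undroop_e h1 h2, hT, hT, tiling, tiling, tiling, a2, b2, hh, Function.update_self]
    unfold Vx at v1
    rcases mk_cases (v i (y i)) (v (i + 1) (y i)) (h i (y i)) with m | m | m | m | m | m | m <;>
      rw [m.1] <;> simp only
    · rw [mk_vert.2 (by omega)]; rfl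
    · rw [mk_cross.2 (by omega)]; rfl
    · rw [mk_vert]; omega
    · rw [mk_cross]; omega
    · omega
  rw [undroop_col c1 c2, hT, tiling, tiling, a3 c c1 c2, b3 c c1 c2, hh, Function.update_of_ne c2]

/-- The effect of an undroop on its first row. -/
theorem JCert.top_tiles (H' : Lab k' v' h') (J : JCert r v y v') (hi : r ≤ x)
    (hw : RowB x (v' x) (v (x + 1)) w) (h0 : mkTile (v' x (y (x + 1))) (v (x + 1) (y (x + 1)))
      (w (y (x + 1))) = .blank) (c : ℕ) :
    undroop (tiling (mixV x v' v) (mixH x h' w h)) x (y (x + 1)) x' x c = tiling v' h' x c := by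
  obtain ⟨b1, b2, b3⟩ := J.line (i := x + 1) (by omega)
  obtain ⟨j3, j4⟩ := J.inv (x + 1) (by omega)
  set z := y (x + 1)
  rw [mk_blank] at h0
  have w1 := hw.vx z
  have w2 := hw.vx (z + 1)
  have hh : h' x = Function.update w (z + 1) (v (x + 1) (z + 1)) := by
    refine (H'.row x).w_eq ?_ fun c => ?_
    · rw [Function.update_of_ne (by omega), hw.zero]
    · by_cases h1 : c = z
      · subst h1
        rw [Function.update_of_ne (by omega), Function.update_self, b1]
        unfold VxB; omega
      by_cases h2 : c = z + 1
      · subst h2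
        rw [Function.update_self, Function.update_of_ne (by omega), b2]
        unfold VxB at *; omega
      rw [b3 c h1 h2, Function.update_of_ne h2, Function.update_of_ne (by omega)]
      exact hw.vx c
  by_cases c1 : c = z
  · subst c1
    rw [undroop_nw, tiling, b1, eq_comm, mk_rElbow]; omega
  by_cases c2 : c = z + 1
  · subst c2
    rw [undroop_ne, mix_eq, tiling, b2, hh, Function.update_self]
    unfold VxB at w1 w2
    by_cases h1 : v' x (z + 1) = 0
    · rw [mk_rElbow.2 (by omega), mk_horiz.2 (by omega)]
    · rw [mk_vert.2 (by omega), mk_jElbow.2 (by omega)]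
  rw [undroop_col c1 c2, mix_eq, tiling, b3 c c1 c2, hh, Function.update_of_ne c2]

end JCert

section JCert
variable {k k' r : ℕ} {v h v' h' : ℕ → ℕ → ℕ} {y : ℕ → ℕ} {i x x' : ℕ} {w : ℕ → ℕ}

/-- The column moves in a row where the pipe of column `y i + 1` turns from west to north. Column `y
i` is empty above this turn, and beyond the turn the row is empty up to the new column. -/
theorem JCert.move_data (H : Lab k v h) (J : JCert r v y v') (hi : r < i)
    (hy : y (i + 1) ≠ y i) : v (i + 1) (y i + 1) = 0 ∧ v i (y i) = 0 ∧
      h i (y i + 1) = v i (y i + 1) ∧ h i (y i + 1 + 1) = 0 ∧ y i < y (i + 1) ∧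
      (∀ c, y i < c → c ≤ y (i + 1) → v (i + 1) c = 0) ∧
      (∀ c, y i + 1 < c → c ≤ y (i + 1) → v i c = 0) ∧
      ((v (i + 1) (y i) = 0 ∧ h i (y i) = v i (y i + 1)) ∨
        (v (i + 1) (y i) = v i (y i + 1) ∧ h i (y i) = 0)) := by
  obtain ⟨j1, j2⟩ := J.inv i hi
  have v1 := (H.row i).vx (y i)
  have v2 := (H.row i).vx (y i + 1)
  rcases J.step i hi with ⟨-, h1⟩ | ⟨h1, h2, h3, h4, h5⟩
  · exact absurd h1 hy
  · have e : h i (y i + 1) = v i (y i + 1) ∧ h i (y i + 1 + 1) = 0 := by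
      clear v1
      unfold Vx at v2; omega
    clear v2
    have e2 : v i (y i) = 0 ∧ ((v (i + 1) (y i) = 0 ∧ h i (y i) = v i (y i + 1)) ∨
        (v (i + 1) (y i) = v i (y i + 1) ∧ h i (y i) = 0)) := by
      clear h3 h4
      unfold Vx at v1; omega
    exact ⟨h1, e2.1, e.1, e.2, h2, h3, h4, e2.2⟩

theorem JCert.move_rowB (H : Lab k v h) (J : JCert r v y v') (hi : r < i)
    (hy : y (i + 1) ≠ y i) :
    RowB i (v' i) (v (i + 1)) (Function.update (h i) (y i + 1) 0) := by
  obtain ⟨m1, m2, m3, m4, m5, m6, m7, m8⟩ := J.move_data H hi hy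
  obtain ⟨a1, a2, a3⟩ := J.line hi
  obtain ⟨N, -, hN⟩ := H.far
  refine ⟨?_, fun c => ?_, N + y i + i + 2, fun c hc => ?_⟩
  · rw [Function.update_of_ne (by omega), (H.row i).w_zero]
  · by_cases h1 : c = y i
    · subst h1
      rw [Function.update_of_ne (by omega), Function.update_self, a1]
      unfold VxB; omega
    by_cases h2 : c = y i + 1
    · subst h2
      rw [Function.update_self, Function.update_of_ne (by omega), a2, m1, m2, m4]
      exact Or.inl ⟨rfl, rfl, rfl⟩
    rw [a3 c h1 h2, Function.update_of_ne h2, Function.update_of_ne (by omega)]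
    exact ((H.row i).vx c).toB
  · have := J.row_pos
    rw [Function.update_of_ne (by omega), hN i c (by omega) (by omega) (by omega)]

theorem JCert.move_blank (H : Lab k v h) (J : JCert r v y v') (hi : r < i)
    (hy : y (i + 1) ≠ y i) {c : ℕ} (h1 : y i + 1 ≤ c) (h2 : c ≤ y (i + 1)) :
    mkTile (v' i c) (v (i + 1) c) (Function.update (h i) (y i + 1) 0 c) = .blank := by
  obtain ⟨m1, m2, m3, m4, m5, m6, m7, m8⟩ := J.move_data H hi hy
  obtain ⟨a1, a2, a3⟩ := J.line hi
  have hw : ∀ c, y i + 1 < c → c ≤ y (i + 1) → h i c = 0 := by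
    intro c hc
    induction c, hc using Nat.le_induction with
    | base => exact fun _ => m4
    | succ c hc ih =>
      intro hc'
      have ih := ih (by omega)
      have hv := (H.row i).vx c
      rw [m6 c (by omega) (by omega), m7 c (by omega) (by omega), ih] at hv
      unfold Vx at hv; omega
  rw [mk_blank]
  by_cases h3 : c = y i + 1
  · subst h3
    rw [a2, Function.update_self]
    exact ⟨m2, m1, rfl⟩
  · rw [a3 c (by omega) h3, Function.update_of_ne h3]
    exact ⟨m7 c (by omega) h2, m6 c (by omega) h2, hw c (by omega) h2⟩

/-- Each row between `x` and `x'` is treated by `JCert.stay_tiles`; in row `x'` the `jElbow` leaves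
a blank tile, where the mark continues. -/
theorem JCert.undroop_move (H : Lab k v h) (H' : Lab k' v' h') (J : JCert r v y v') (hi : r ≤ x)
    (hw : RowB x (v' x) (v (x + 1)) w) (h0 : mkTile (v' x (y (x + 1))) (v (x + 1) (y (x + 1)))
      (w (y (x + 1))) = .blank) (hx : x < x') (hst : ∀ i, x < i → i ≤ x' → y i = y (x + 1))
    (hmv : y (x' + 1) ≠ y x') :
    undroop (tiling (mixV x v' v) (mixH x h' w h)) x (y (x + 1)) x' =
      tiling (mixV x' v' v) (mixH x' h' (Function.update (h x') (y x' + 1) 0) h) := by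
  funext a c
  rcases Nat.lt_or_ge a x with h1 | h1
  · rw [undroop_row hx (Or.inl h1), mix_lt h1, mix_lt (by omega)]
  rcases Nat.lt_or_ge x' a with h2 | h2
  · rw [undroop_row hx (Or.inr h2), mix_gt (by omega), mix_gt h2]
  by_cases h3 : a = x
  · subst h3
    rw [mix_lt (x := x') hx]
    exact J.top_tiles H' hi hw h0 c
  by_cases h4 : a = x'
  · subst h4
    obtain ⟨m1, m2, m3, m4, m5, m6, m7, m8⟩ := J.move_data H (by omega) hmv
    obtain ⟨a1, a2, a3⟩ := J.line (i := a) (by omega)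
    have j1 := (J.inv a (by omega)).1
    rw [mix_eq (x := a)]
    rw [hst a hx le_rfl] at m1 m2 m3 m4 m5 m6 m7 m8 a1 a2 a3 j1 ⊢
    generalize y (x + 1) = z at *
    by_cases c1 : c = z
    · subst c1
      rw [undroop_sw hx, mix_gt hx, tiling, a1, Function.update_of_ne (by omega)]
      rcases m8 with ⟨e1, e2⟩ | ⟨e1, e2⟩
      · rw [mk_horiz.2 (by omega), mk_jElbow.2 (by omega)]
      · rw [mk_rElbow.2 (by omega), mk_vert.2 (by omega)]
    by_cases c2 : c = z + 1
    · subst c2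
      rw [undroop_se hx, mix_gt hx, tiling, a2, Function.update_self, mk_jElbow.2 (by omega),
        mk_blank.2 ⟨m2, m1, rfl⟩]
    rw [undroop_col c1 c2, mix_gt hx, tiling, a3 c c1 c2, Function.update_of_ne c2]
  · rw [mix_lt (x := x') (by omega), ← hst a (by omega) (by omega)]
    exact J.stay_tiles H H' (by omega)
      (by rw [hst (a + 1) (by omega) (by omega), hst a (by omega) (by omega)])
      (fun c => mix_gt (by omega)) (by omega) (by omega) c

/-- On the lines below row `x'` both columns are occupied, so exchanging them renames pipes without
altering a tile. This is why the procedure may stop at the crossing although `JCert` prescribes an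
exchange on every lower line. -/
theorem JCert.undroop_last (H : Lab k v h) (H' : Lab k' v' h') (J : JCert r v y v') (hi : r ≤ x)
    (hw : RowB x (v' x) (v (x + 1)) w) (h0 : mkTile (v' x (y (x + 1))) (v (x + 1) (y (x + 1)))
      (w (y (x + 1))) = .blank) (hx : x < x') (hst : ∀ i, x < i → y i = y (x + 1))
    (hz : v x' (y (x + 1)) = 0) (hnz : ∀ i, x' < i → v i (y (x + 1)) ≠ 0) :
    undroop (tiling (mixV x v' v) (mixH x h' w h)) x (y (x + 1)) x' = tiling v' h' := by
  funext a c
  rcases Nat.lt_or_ge a x with h1 | h1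
  · rw [undroop_row hx (Or.inl h1), mix_lt h1]
  rcases Nat.lt_or_ge x' a with h2 | h2
  · rw [undroop_row hx (Or.inr h2), mix_gt (by omega)]
    have key : ∀ i, x' < i → ∀ c, v i c = 0 ↔ v' i c = 0 := by
      intro i hi' c
      obtain ⟨a1, a2, a3⟩ := J.line (i := i) (by omega)
      have j1 := (J.inv i (by omega)).1
      have j2 := hnz i hi'
      rw [hst i (by omega)] at a1 a2 a3 j1
      by_cases c1 : c = y (x + 1)
      · subst c1; omega
      by_cases c2 : c = y (x + 1) + 1
      · subst c2; omega
      rw [a3 c c1 c2]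
    have R := H.row a
    have R' := H'.row a
    exact mk_congr_of_straight (key a h2 c) (key (a + 1) (by omega) c)
      (vxB_zero_iff R.w_zero R'.w_zero (fun c => (R.vx c).toB) (fun c => (R'.vx c).toB)
        (key a h2) (key (a + 1) (by omega)) c)
      (fun h1 h2 => (R.straight h1 h2).symm) (fun h1 h2 => (R'.straight h1 h2).symm)
  by_cases h3 : a = x
  · subst h3
    exact J.top_tiles H' hi hw h0 c
  by_cases h4 : a = x'
  · subst h4
    have hy : y (a + 1) = y a := by rw [hst a hx, hst (a + 1) (by omega)]
    obtain ⟨hl, d1, d2, d3, d4, d5, d6⟩ := J.stay_data H (by omega) hy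
    have hh := J.stay_row H H' (by omega) hy
    obtain ⟨a1, a2, a3⟩ := J.line (i := a) (by omega)
    obtain ⟨b1, b2, b3⟩ := J.line (i := a + 1) (by omega)
    have hn := hnz (a + 1) (by omega)
    have v1 := (H.row a).vx (y (x + 1))
    rw [hst a hx] at *
    rw [hst (a + 1) (by omega)] at *
    generalize y (x + 1) = z at *
    have e : h a z = 0 ∧ h a (z + 1) = v (a + 1) z := by unfold Vx at v1; omega
    clear v1
    by_cases c1 : c = z
    · subst c1
      rw [undroop_sw hx, mix_gt hx, tiling, tiling, a1, b1, hh, Function.update_of_ne (by omega),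
        mk_rElbow.2 (by omega), mk_vert.2 (by omega)]
    by_cases c2 : c = z + 1
    · subst c2
      rw [undroop_se hx, mix_gt hx, tiling, tiling, a2, b2, mk_cross.2 (by omega),
        mk_rElbow.2 (by omega)]
    rw [undroop_col c1 c2, mix_gt hx, tiling, tiling, a3 c c1 c2, b3 c c1 c2, hh,
      Function.update_of_ne c2]
  · rw [← hst a (by omega)]
    exact J.stay_tiles H H' (by omega)
      (by rw [hst (a + 1) (by omega), hst a (by omega)])
      (fun c => mix_gt (by omega)) (by omega) (by omega) c

theorem JCert.jdtRun_uncross (H : Lab k v h) (H' : Lab k' v' h') (J : JCert r v y v') {M A a : ℕ}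
    (hM : ∀ i, M < i → y i = A) {T' : Tiling} {x m : ℕ} {w : ℕ → ℕ}
    (h2 : r ≤ x) (hw : RowB x (v' x) (v (x + 1)) w) (h3 : m ≤ y (x + 1))
    (h4 : ∀ z, m ≤ z → z ≤ y (x + 1) → mkTile (v' x z) (v (x + 1) z) (w z) = .blank)
    (hst : ∀ i, x < i → y i = y (x + 1)) :
    JdtRun (tiling (mixV x v' v) (mixH x h' w h)) x m a T' ↔ a = A ∧ T' = tiling v' h' := by
  classical
  have hrow := J.row_pos
  obtain ⟨lam, L⟩ := H.exists_lbl
  have L' := L.exists_lbl_mix H' (by omega) hw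
  obtain ⟨N, hN, -⟩ := L.far
  have hA : A = y (x + 1) := by rw [← hM (M + x + 1) (by omega), hst _ (by omega)]
  have hpos : r ≤ y (x + 1) := J.pos (by omega)
  have hlab : ∀ i, x < i → v i (y (x + 1) + 1) = v (x + 1) (y (x + 1) + 1) := by
    intro i hi
    induction i, hi using Nat.le_induction with
    | base => rfl
    | succ i hi ih' =>
      have := J.stay_label H (i := i) (by omega) (by rw [hst i hi, hst _ (by omega)])
      rw [hst i hi] at this
      rw [this, ih']
  have hinv : ∀ i, x < i → v i (y (x + 1)) = 0 ∨
      v (x + 1) (y (x + 1) + 1) < v i (y (x + 1)) := by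
    intro i hi
    have := (J.inv i (by omega)).2
    rwa [hst i hi, hlab i hi] at this
  have hP := (J.inv (x + 1) (by omega)).1
  have hb := h4 (y (x + 1)) h3 le_rfl
  have hb' := mk_blank.1 hb
  have hlam : lam (y (x + 1) + 1) = v (x + 1) (y (x + 1) + 1) := by
    have := hN (N + x + y (x + 1) + 2) (y (x + 1) + 1) (by omega)
    rw [if_pos (by omega), hlab _ (by omega)] at this
    exact this.symm
  -- Row `x'` is the one below which column `y (x + 1)` is occupied for good. Pipe `y (x + 1)` turns
  -- east there and crosses its right neighbour.
  have hex : ∃ x', x < x' ∧ ∀ i, x' < i → v i (y (x + 1)) ≠ 0 := by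
    refine ⟨N + x + y (x + 1) + 1, by omega, fun i hi => ?_⟩
    rw [hN i _ (by omega), if_pos (by omega)]
    exact L.lam_ne (by omega)
  have hs := Nat.find_spec hex
  have hmin : ∀ i, i < Nat.find hex → ¬ (x < i ∧ ∀ j, i < j → v j (y (x + 1)) ≠ 0) :=
    fun i hi => Nat.find_min hex hi
  generalize Nat.find hex = x' at hs hmin
  obtain ⟨hx, hnz⟩ := hs
  have hz : v x' (y (x + 1)) = 0 := by
    by_contra hcon
    rcases Nat.lt_or_ge (x + 1) x' with h5 | h5
    · refine hmin (x' - 1) (by omega) ⟨by omega, fun j hj => ?_⟩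
      rcases Nat.lt_or_ge x' j with h6 | h6
      · exact hnz j h6
      · rwa [show j = x' by omega]
    · rw [show x' = x + 1 by omega] at hcon
      omega
  clear hmin
  have hlz : ∀ i, x' < i → v i (y (x + 1)) = v (x' + 1) (y (x + 1)) := by
    intro i hi
    induction i, hi using Nat.le_induction with
    | base => rfl
    | succ i hi ih' => rw [(H.row i).straight (hnz i hi) (hnz (i + 1) (by omega)), ih']
  have hlam' : lam (y (x + 1)) = v (x' + 1) (y (x + 1)) := by
    have := hN (N + x' + y (x + 1) + 2) (y (x + 1)) (by omega)
    rw [if_pos (by omega), hlz _ (by omega)] at this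
    exact this.symm
  have hQ := hnz (x' + 1) (by omega)
  have hPQ := (hinv (x' + 1) (by omega)).resolve_left hQ
  have e1 := hlab x' hx
  have e2 := hlab (x' + 1) (by omega)
  have v1 := (H.row x').vx (y (x + 1))
  have e3 : h x' (y (x + 1) + 1) = v (x' + 1) (y (x + 1)) := by unfold Vx at v1; omega
  clear v1
  have hbe : IsBlockEnd (tiling (mixV x v' v) (mixH x h' w h)) x m (y (x + 1)) := by
    refine ⟨h3, fun z h5 h6 => ?_, ?_⟩
    · rw [mix_eq]; exact h4 z h5 h6
    · rw [mix_eq, Ne, mk_blank]; omega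
  refine (JdtRun.uncross_iff (y' := y (x + 1)) (x' := x') hbe
    (L'.enters_south.2 ⟨by omega, ?_⟩) (fun p' hp' => L.lam_inj ?_) hx ?_
    (fun x'' h5 h6 => ?_)).trans ?_
  · rw [mixV_gt (by omega)]; omega
  · rw [L'.enters_south, mixV_gt (by omega)] at hp'; omega
  · rw [L'.crossAt, mixV_gt (by omega), mixV_gt (by omega), mixH_gt hx]; omega
  · rw [L'.crossAt, mixV_gt (by omega), mixV_gt (by omega), mixH_gt h5] at h6
    obtain ⟨f1, f2, f3, f4⟩ := h6
    have e4 := H.cross_order (i := x'') (j := y (x + 1) + 1) (by omega) (by omega) (by omega)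
    exact (H.cross_unique (i := x'') (j := y (x + 1) + 1) (i' := x') (j' := y (x + 1) + 1)
      (by omega) (by omega) (by omega) (by omega) (by omega) (by omega)).1
  · rw [J.undroop_last H H' h2 hw hb hx hst hz hnz, hA]

/-- The invariant is as for insertion: rows above the mark are final, rows below original. If the
column is constant from here on, the last step is reached; otherwise the first row in which it
changes holds the `jElbow` of the next step. -/
theorem JCert.jdtRun_iff (H : Lab k v h) (H' : Lab k' v' h') (J : JCert r v y v') {M A a : ℕ}
    (hM : ∀ i, M < i → y i = A) {T' : Tiling} (n : ℕ) : ∀ {x m : ℕ} {w : ℕ → ℕ}, M ≤ x + n →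
    r ≤ x → RowB x (v' x) (v (x + 1)) w → m ≤ y (x + 1) → (∀ z, m ≤ z → z ≤ y (x + 1) →
      mkTile (v' x z) (v (x + 1) z) (w z) = .blank) →
    (JdtRun (tiling (mixV x v' v) (mixH x h' w h)) x m a T' ↔ a = A ∧ T' = tiling v' h') := by
  classical
  induction n with
  | zero =>
    intro x m w h1 h2 hw h3 h4
    exact J.jdtRun_uncross H H' hM h2 hw h3 h4 fun i hi => by rw [hM i (by omega), hM _ (by omega)]
  | succ n ih =>
    intro x m w h1 h2 hw h3 h4
    by_cases hconst : ∀ i, x < i → y i = y (x + 1)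
    · exact J.jdtRun_uncross H H' hM h2 hw h3 h4 hconst
    have hex : ∃ x', x < x' ∧ y (x' + 1) ≠ y x' := by
      by_contra hcon
      push Not at hcon
      refine hconst fun i hi => ?_
      induction i, hi using Nat.le_induction with
      | base => rfl
      | succ i hi ih' => rw [hcon i hi, ih']
    have hs := Nat.find_spec hex
    have hmin : ∀ i, i < Nat.find hex → x < i → y (i + 1) = y i := by
      intro i h5 h6
      by_contra hcon
      exact Nat.find_min hex h5 ⟨h6, hcon⟩
    generalize Nat.find hex = x' at hs hmin
    obtain ⟨hx, hmv⟩ := hs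
    have hst : ∀ i, x < i → i ≤ x' → y i = y (x + 1) := by
      intro i hi
      induction i, hi using Nat.le_induction with
      | base => exact fun _ => rfl
      | succ i hi ih' => intro h5; rw [hmin i (by omega) hi, ih' (by omega)]
    clear hmin hconst
    have hrow := J.row_pos
    obtain ⟨lam, L⟩ := H.exists_lbl
    have L' := L.exists_lbl_mix H' (by omega) hw
    obtain ⟨m1, m2, m3, m4, m5, m6, m7, m8⟩ := J.move_data H (by omega) hmv
    have hlab : ∀ i, x < i → i ≤ x' → v i (y (x + 1) + 1) = v (x + 1) (y (x + 1) + 1) := by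
      intro i hi
      induction i, hi using Nat.le_induction with
      | base => exact fun _ => rfl
      | succ i hi ih' =>
        intro h5
        have := J.stay_label H (i := i) (by omega) (by rw [hst i hi (by omega), hst _ (by omega) h5])
        rw [hst i hi (by omega)] at this
        rw [this, ih' (by omega)]
    have hP := (J.inv (x + 1) (by omega)).1
    obtain ⟨p, hp⟩ := L.exists_lam (v (x + 1) (y (x + 1) + 1))
    have hx' := hst x' hx le_rfl
    have hlx := hlab x' hx le_rfl
    rw [hx'] at m1 m2 m3 m4 m5 m6 m7 m8
    have hback : ∃ d, d < y (x + 1) + 1 ∧ v (x' + 1) d = v (x + 1) (y (x + 1) + 1) := by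
      rcases (H.row x').down (c := y (x + 1) + 1) (by omega) with h5 | ⟨d, h5, h6, -⟩
      · omega
      · exact ⟨d, h5, by omega⟩
    obtain ⟨d, hd1, hd2⟩ := hback
    have hbe : IsBlockEnd (tiling (mixV x v' v) (mixH x h' w h)) x m (y (x + 1)) := by
      refine ⟨h3, fun z h5 h6 => ?_, ?_⟩
      · rw [mix_eq]; exact h4 z h5 h6
      · rw [mix_eq, Ne, mk_blank]; omega
    refine (JdtRun.step_iff (y' := y (x + 1)) (x' := x') (p := p) hbe
      (L'.enters_south.2 ⟨by omega, ?_⟩) (fun p' hp' => L.lam_inj ?_) ?_ hx ?_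
      (L'.enters_west.2 ⟨by omega, ?_⟩) (fun x'' h5 h6 h7 => ?_)).trans ?_
    · rw [mixV_gt (by omega)]; omega
    · rw [L'.enters_south, mixV_gt (by omega)] at hp'; omega
    -- Below row `x'` the pipe is in a column `d ≤ y (x + 1)` and can only go further left
    -- downwards, so it did not come up in column `y (x + 1) + 1`.
    · rintro rfl
      obtain ⟨N, hN, -⟩ := L.far
      have h5 := hN (N + x' + y (x + 1) + 2) (y (x + 1) + 1) (by omega)
      rw [if_pos (by omega)] at h5
      have := H.col_mono (i := x' + 1) (i' := N + x' + y (x + 1) + 2) (c := d)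
        (d := y (x + 1) + 1) (by omega) (by omega) (by omega)
      omega
    · rw [mix_gt hx, tiling, mk_jElbow]; omega
    · rw [mixH_gt hx]; omega
    · rw [mix_gt h5, tiling, mk_jElbow] at h6
      rw [L'.enters_west, mixH_gt h5] at h7
      rcases lt_trichotomy x'' x' with h8 | h8 | h8
      · have := hlab (x'' + 1) (by omega) (by omega)
        omega
      · exact h8
      · have hv := (H.row x'').vx (y (x + 1) + 1)
        have h9 : v x'' (y (x + 1) + 1) = v (x + 1) (y (x + 1) + 1) := by
          unfold Vx at hv; omega
        have := H.col_mono (i := x' + 1) (i' := x'') (c := d)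
          (d := y (x + 1) + 1) (by omega) (by omega) (by omega)
        omega
    · rw [J.undroop_move H H' h2 hw (h4 _ h3 le_rfl) hx hst hmv, ← hx']
      exact ih (by omega) (by omega) (J.move_rowB H (by omega) hmv) (by omega)
        fun z h5 h6 => J.move_blank H (by omega) hmv h5 h6

/-- The first column of jeu de taquin is eventually constant. -/
theorem JCert.eventually_const (H : Lab k v h) (J : JCert r v y v') :
    ∃ M, ∀ i, M < i → y i = y (M + 1) := by
  obtain ⟨N, hN, -⟩ := H.far
  refine ⟨N + r, fun i hi => ?_⟩
  induction i, hi using Nat.le_induction with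
  | base => rfl
  | succ i hi ih =>
    rw [← ih]
    have h1 := (hN i (y i + 1) (by omega)).1 (J.inv i (by omega)).1
    have h2 := (hN (i + 1) (y i + 1) (by omega)).2 (by omega)
    rcases J.step i (by omega) with ⟨-, h3⟩ | ⟨h3, -⟩
    · exact h3
    · exact absurd h3 h2

/-- By `hlow` the rows before `r` have no blank tile, so `r` is the starting row. The pipe leaving
along row `r` has its `rElbow` in column `y (r + 1) + 1`, so the blank tile to the left of it is the
rightmost one. -/
theorem JCert.nabla_iff (H : Lab k v h) (H' : Lab k' v' h') (J : JCert r v y v') {A a r' : ℕ}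
    (hlow : ∀ i, i ≤ r → ∀ j, v i j ≠ 0 ↔ 1 ≤ j ∧ j < i) (hA : ∃ M, ∀ i, M < i → y i = A)
    {T' : Tiling} : Nabla (tiling v h) a r' T' ↔ a = A ∧ r' = r ∧ T' = tiling v' h' := by
  obtain ⟨M, hM⟩ := hA
  have hr := J.row_pos
  have hcol := J.col
  have hst := J.start
  have hst0 := J.start_zero
  obtain ⟨N, hN, hN2⟩ := H.far
  have hpos : ∀ i j, 1 ≤ i → i < r → 1 ≤ j → tiling v h i j ≠ .blank := by
    intro i j h1 h2 h3
    rw [tiling, Ne, mk_blank]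
    rintro ⟨h4, h5, h6⟩
    have h7 := hlow (i + 1) (by omega) j
    have h8 : ∀ c, j ≤ c → h i c = 0 := by
      intro c hc
      induction c, hc using Nat.le_induction with
      | base => exact h6
      | succ c hc ih =>
        have hv := (H.row i).vx c
        have h9 := hlow i (by omega) c
        have h10 := hlow (i + 1) (by omega) c
        unfold Vx at hv; omega
    have := h8 (N + i + j + 1) (by omega)
    rw [hN2 i _ h1 (by omega) (by omega)] at this
    omega
  have hright : ∀ c, y (r + 1) + 1 < c → h r c = r := by
    have hzero := hlow r le_rfl (y (r + 1) + 1)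
    rcases (H.row r).up (c := y (r + 1) + 1) (by omega) with h1 | ⟨h1, z, h2, h3, -⟩ | ⟨-, h1⟩
    · omega
    · have := H.lt (i := r) (c := z) (by omega)
      omega
    · intro c hc; rw [h1 c hc, hst]
  have hblank : tiling v h r (y (r + 1)) = .blank := by
    rw [tiling, mk_blank]
    have h1 := hlow r le_rfl (y (r + 1))
    have h2 := hlow r le_rfl (y (r + 1) + 1)
    have v1 := (H.row r).vx (y (r + 1))
    have v2 := (H.row r).vx (y (r + 1) + 1)
    unfold Vx at v1 v2; omega
  have hT : tiling v h = tiling (mixV r v' v) (mixH r h' (h r) h) := by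
    funext i c
    rcases lt_trichotomy i r with hi | rfl | hi
    · have e : h' i = h i := by
        refine (H'.row i).w_eq (H.row i).w_zero fun c => ?_
        rw [J.above i (by omega), J.above (i + 1) (by omega)]
        exact ((H.row i).vx c).toB
      rw [mix_lt hi, tiling, tiling, J.above i (by omega), J.above (i + 1) (by omega), e]
    · rw [mix_eq, tiling, J.above i le_rfl]
    · rw [mix_gt hi]
  have key := J.jdtRun_iff (T' := T') (a := a) (w := h r) (x := r) (m := y (r + 1)) H H' hM M
    (by omega) le_rfl ⟨(H.row r).w_zero, fun c => by
      rw [J.above r le_rfl]; exact ((H.row r).vx c).toB, N + r + 1,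
      fun c hc => hN2 r c hr (by omega) (by omega)⟩ le_rfl fun z h1 h2 => by
        rw [show z = y (r + 1) by omega, J.above r le_rfl]; exact hblank
  rw [← hT] at key
  constructor
  · rintro ⟨h1, h2, c, h3, h4, h5, h6⟩
    have hrr : r' = r := by
      rcases lt_trichotomy r' r with h7 | h7 | h7
      · exact absurd h4 (hpos r' c h1 h7 h3)
      · exact h7
      · exact absurd hblank (h2 r _ hr h7 (by omega))
    subst hrr
    have hc : c = y (r' + 1) := by
      rcases lt_trichotomy c (y (r' + 1)) with h7 | h7 | h7
      · exact absurd hblank (h5 _ h7)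
      · exact h7
      · exfalso
        rw [tiling, mk_blank] at h4
        by_cases h8 : c = y (r' + 1) + 1
        · subst h8; omega
        · have := hright c (by omega)
          omega
    subst hc
    obtain ⟨h7, h8⟩ := key.1 h6
    exact ⟨h7, rfl, h8⟩
  · rintro ⟨h1, rfl, h2⟩
    refine ⟨hr, hpos, y (r' + 1), by omega, hblank, fun c hc => ?_, key.2 ⟨h1, h2⟩⟩
    rw [tiling, Ne, mk_blank]
    by_cases h8 : c = y (r' + 1) + 1
    · subst h8; omega
    · have := hright c (by omega)
      omega

end JCert

/-! ### Commutation of jeu de taquin with insertion, row by row -/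

/-- The states of an insertion before and after a jeu de taquin that exchanges the columns `y` and
`y + 1` of a line with labels `n`, and the column of the jeu de taquin after the insertion. -/
inductive Sync (k : ℕ) (n : ℕ → ℕ) (y : ℕ) : St → St → ℕ → Prop
  | act {j : ℕ} (h1 : y + 1 ≠ j) (h2 : y ≠ j) (h3 : y ≠ j + 1) : Sync k n y (.act j) (.act j) y
  | dor {u v u' v' : ℕ} (hu : u' = Equiv.swap y (y + 1) u) (hv : v' = Equiv.swap y (y + 1) v)
      (h1 : y ≠ u) (h2 : y ≠ v) (h3 : y + 1 = u → n y = 0 ∨ n v < n y) :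
      Sync k n y (.dor u v) (.dor u' v') y
  | par {u : ℕ} {σ σ' : St} (hu : y < u) (h : ∀ c, y < c → c ≤ u → n c ≠ 0 ∧ n c ≤ k)
      (hσ : σ = .act u ∨ σ = .dor u (u + 1)) (hσ' : σ' = .act y ∨ σ' = .dor y (y + 1)) :
      Sync k n y σ σ' u

/-- A row of a bumpless pipe dream, with jeu de taquin. -/
structure JSq (k : ℕ) (n s w n' s' : ℕ → ℕ) (y y₁ : ℕ) : Prop where
  row : Row k n s w
  inj : LineInj s
  inj' : LineInj s'
  inv : JInv n y
  step : JRow n s y y₁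
  hn : n' = n ∘ Equiv.swap y (y + 1)
  hs : s' = s ∘ Equiv.swap y₁ (y₁ + 1)

section
variable {k : ℕ} {n s w n' s' : ℕ → ℕ} {y y₁ : ℕ} {τ τ' : St}

theorem JSq.n_data (Q : JSq k n s w n' s' y y₁) : n' y = n (y + 1) ∧ n' (y + 1) = n y ∧
    ∀ c, c ≠ y → c ≠ y + 1 → n' c = n c := by
  rw [Q.hn]
  exact ⟨swap_left _ _ _, swap_right _ _ _, fun c h1 h2 => swap_ne _ h1 h2⟩

theorem JSq.s_data (Q : JSq k n s w n' s' y y₁) : s' y₁ = s (y₁ + 1) ∧ s' (y₁ + 1) = s y₁ ∧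
    ∀ c, c ≠ y₁ → c ≠ y₁ + 1 → s' c = s c := by
  rw [Q.hs]
  exact ⟨swap_left _ _ _, swap_right _ _ _, fun c h1 h2 => swap_ne _ h1 h2⟩

/-- The two kinds of steps of jeu de taquin. -/
theorem JSq.cases (Q : JSq k n s w n' s' y y₁) :
    (y₁ = y ∧ s (y + 1) = n (y + 1)) ∨
    (y < y₁ ∧ s (y + 1) = 0 ∧ n y = 0 ∧ w (y + 1) = n (y + 1) ∧ (s y = 0 ∨ s y = n (y + 1)) ∧
      (∀ c, y < c → c ≤ y₁ → s c = 0) ∧ (∀ c, y + 1 < c → c ≤ y₁ → n c = 0) ∧ s (y₁ + 1) ≠ 0 ∧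
      ∀ c, y + 2 ≤ c → c ≤ y₁ + 1 → w c = 0) := by
  have R := Q.row
  obtain ⟨j1, j2⟩ := Q.inv
  rcases Q.step with ⟨h1, h2⟩ | ⟨h1, h2, h3, h4, h5⟩
  · exact Or.inl ⟨h2, R.straight j1 h1⟩
  · have v1 := R.vx y
    have v2 := R.vx (y + 1)
    have e : w (y + 1) = n (y + 1) ∧ w (y + 1 + 1) = 0 := by
      clear v1 h3 h4
      unfold Vx at v2; omega
    clear v2
    have e2 : n y = 0 ∧ (s y = 0 ∨ s y = n (y + 1)) := by
      clear h3 h4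
      unfold Vx at v1; omega
    refine Or.inr ⟨h2, h1, e2.1, e.1, e2.2, h3, h4, h5, fun c hc => ?_⟩
    induction c, hc using Nat.le_induction with
    | base => exact fun _ => e.2
    | succ c hc ih =>
      intro hc'
      have ih := ih (by omega)
      have hv := R.vx c
      rw [h3 c (by omega) (by omega), h4 c (by omega) (by omega), ih] at hv
      unfold Vx at hv; omega

theorem JRow.stay {n s : ℕ → ℕ} (h : s (y + 1) ≠ 0) : JRow n s y y := Or.inl ⟨h, rfl⟩

theorem JRow.congr {n s n₀ s₀ : ℕ → ℕ} (h : JRow n₀ s₀ y y₁)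
    (hs : ∀ c, y < c → c ≤ y₁ + 1 → (s c = 0 ↔ s₀ c = 0))
    (hn : ∀ c, y + 1 < c → c ≤ y₁ → n₀ c = 0 → n c = 0) : JRow n s y y₁ := by
  rcases h with ⟨h1, h2⟩ | ⟨h1, h2, h3, h4, h5⟩
  · exact Or.inl ⟨by rw [Ne, hs _ (by omega) (by omega)]; exact h1, h2⟩
  · exact Or.inr ⟨(hs _ (by omega) (by omega)).2 h1, h2,
      fun c hc hc' => (hs c hc (by omega)).2 (h3 c hc hc'),
      fun c hc hc' => hn c hc hc' (h4 c hc hc'),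
      by rw [Ne, hs _ (by omega) (by omega)]; exact h5⟩

/-- The two processes are in disjoint columns and can meet only when the column of jeu de taquin
moves right while the moving pipe turns left towards it. -/
theorem Sync.step_act (Q : JSq k n s w n' s' y y₁) {j : ℕ} (h1 : y + 1 ≠ j) (h2 : y ≠ j)
    (h3 : y ≠ j + 1) (G : Good k n (.act j)) (G' : Good k n' (.act j)) (Gτ : Good k s τ)
    (Gτ' : Good k s' τ') (I : IRow k n s (.act j) τ) (I' : IRow k n' s' (.act j) τ') :
    ∃ z, Sync k s y₁ τ τ' z ∧ JRow (n ∘ Equiv.swap j (j + 1)) (s ∘ τ.perm) y z := by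
  have R := Q.row
  obtain ⟨a1, a2, a3⟩ := Q.n_data
  obtain ⟨b1, b2, b3⟩ := Q.s_data
  obtain ⟨j1, j2⟩ := Q.inv
  obtain ⟨j', hj, n1, n2, n3, n4, n5, n6, n7, n8⟩ := R.act_next G
  obtain ⟨g1, g2, g3⟩ := G
  have hn'j : n' j = n j := a3 j (by omega) (by omega)
  have pn : ∀ c, c ≠ j → c ≠ j + 1 → (n ∘ Equiv.swap j (j + 1)) c = n c :=
    fun c e1 e2 => swap_ne _ e1 e2
  rcases Q.cases with ⟨rfl, hst⟩ | ⟨hy, m1, m2, m3, m4, m5, m6, m7, m8⟩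
  · have hj'1 : j' ≠ y₁ + 1 := by
      rintro rfl
      by_cases e : y₁ + 1 = j
      · exact h1 e
      · have := n2 (by omega); omega
    have hj'2 : j' ≠ y₁ := by
      rintro rfl
      have := (n3 (j' + 1) (by omega) (by omega)).2
      omega
    have hj'3 : y₁ ≠ j' + 1 := by
      intro e
      by_cases e1 : j' = j
      · omega
      · have := (n3 (y₁ + 1) (by omega) (by omega)).2
        omega
    have hs'j : s' j' = n j := by rw [b3 j' (by omega) (by omega), n1]
    have hs't : s' (j + 1) = s (j + 1) := b3 _ (by omega) (by omega)
    cases I with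
    | @act_left _ j₀ hj0 h0 =>
      obtain rfl := Q.inj j₀ j' (by omega) (by omega)
      obtain rfl := I'.unique Q.inj' G' (.act_left (j' := j₀) (by omega) (by omega))
      refine ⟨y₁, .act (by omega) (by omega) (by omega), .stay ?_⟩
      rw [St.perm, swap_ne _ (by omega) (by omega)]; omega
    | act_pass hj0 h0 hk =>
      obtain rfl := I'.unique Q.inj' G' (.act_pass (j' := j') (by omega) (by omega) (by omega))
      have e1 := Gτ.2.2
      have e2 := Gτ'.2.2
      rw [show j + 1 + 1 = j + 2 from rfl] at e1 e2
      have e3 : y₁ ≠ j + 1 := by omega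
      have e4 : y₁ ≠ j + 2 := by rintro rfl; omega
      refine ⟨y₁, .act (by omega) (by omega) (by omega), .stay ?_⟩
      rw [St.perm, swap_ne _ (by omega) (by omega)]; omega
    | @act_rest _ j₀ hj0 hk =>
      obtain rfl := Q.inj j₀ j' (by omega) (by omega)
      obtain rfl := I'.unique Q.inj' G' (.act_rest (j' := j₀) (by omega) (by omega))
      refine ⟨y₁, .dor ?_ ?_ (by omega) (by omega) (by omega), .stay ?_⟩
      · rw [Equiv.swap_apply_of_ne_of_ne] <;> omega
      · rw [Equiv.swap_apply_of_ne_of_ne] <;> omega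
      · rw [St.perm, swap_ne _ (by omega) (by omega)]; omega
  · have hjy : j < y ∨ y₁ < j := by
      by_contra hcon
      exact g1 (m6 j (by omega) (by omega))
    have J := Q.step
    rcases hjy with hjy | hjy
    · have hs'j : s' j' = n j := by rw [b3 j' (by omega) (by omega), n1]
      have hs't : s' (j + 1) = s (j + 1) := b3 _ (by omega) (by omega)
      have hpn : ∀ c, y + 1 < c → c ≤ y₁ → n c = 0 → (n ∘ Equiv.swap j (j + 1)) c = 0 :=
        fun c e1 e2 e3 => by rw [pn c (by omega) (by omega), e3]
      cases I with
      | @act_left _ j₀ hj0 h0 =>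
        obtain rfl := Q.inj j₀ j' (by omega) (by omega)
        obtain rfl := I'.unique Q.inj' G' (.act_left (j' := j₀) (by omega) (by omega))
        refine ⟨y₁, .act (by omega) (by omega) (by omega), J.congr (fun c e1 e2 => ?_) hpn⟩
        rw [St.perm, swap_ne _ (by omega) (by omega)]
      | act_pass hj0 h0 hk =>
        obtain rfl := I'.unique Q.inj' G' (.act_pass (j' := j') (by omega) (by omega) (by omega))
        refine ⟨y₁, .act (by omega) (by omega) (by omega), J.congr (fun c e1 e2 => ?_) hpn⟩
        rw [St.perm, swap_ne _ (by omega) (by omega)]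
      | @act_rest _ j₀ hj0 hk =>
        obtain rfl := Q.inj j₀ j' (by omega) (by omega)
        obtain rfl := I'.unique Q.inj' G' (.act_rest (j' := j₀) (by omega) (by omega))
        refine ⟨y₁, .dor ?_ ?_ (by omega) (by omega) (by omega), J.congr (fun c e1 e2 => ?_) hpn⟩
        · rw [Equiv.swap_apply_of_ne_of_ne] <;> omega
        · rw [Equiv.swap_apply_of_ne_of_ne] <;> omega
        · rw [St.perm, swap_ne _ (by omega) (by omega)]
    · have hj' : y₁ + 1 ≤ j' := by
        by_contra hcon
        have := (n3 (y₁ + 1) (by omega) (by omega)).1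
        have := m8 (y₁ + 1) (by omega) (by omega)
        omega
      have hs't : s' (j + 1) = s (j + 1) := b3 _ (by omega) (by omega)
      have hpn : ∀ c, y + 1 < c → c ≤ y₁ → n c = 0 → (n ∘ Equiv.swap j (j + 1)) c = 0 :=
        fun c e1 e2 e3 => by rw [pn c (by omega) (by omega), e3]
      by_cases he : j' = y₁ + 1
      · have hs'j : s' y₁ = n j := by rw [b1, ← he, n1]
        cases I with
        | @act_left _ j₀ hj0 h0 =>
          obtain rfl := Q.inj j₀ j' (by omega) (by omega)
          obtain rfl := I'.unique Q.inj' G' (.act_left (j' := y₁) (by omega) (by omega))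
          refine ⟨j₀, .par (by omega) (fun c e1 e2 => ?_) (Or.inl rfl) (Or.inl rfl),
            Or.inr ⟨?_, by omega, fun c e1 e2 => ?_, fun c e1 e2 => ?_, ?_⟩⟩
          · rw [show c = j₀ by omega]; omega
          · rw [St.perm, swap_ne _ (by omega) (by omega)]; exact m1
          · by_cases e3 : c = j₀
            · rw [e3, St.perm, swap_left]; exact Gτ.2.2
            · rw [St.perm, swap_ne _ e3 (by omega)]; exact m5 c e1 (by omega)
          · by_cases e3 : c = j₀
            · by_cases e4 : j₀ = j
              · rw [e3, e4, swap_left, g3]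
              · rw [pn c (by omega) (by omega), e3]; exact n2 (by omega)
            · rw [pn c (by omega) (by omega)]; exact m6 c e1 (by omega)
          · rw [St.perm, swap_right]; omega
        | act_pass hj0 h0 hk =>
          obtain rfl := I'.unique Q.inj' G' (.act_pass (j' := y₁) (by omega) (by omega) (by omega))
          refine ⟨y₁, .act (by omega) (by omega) (by omega), J.congr (fun c e1 e2 => ?_) hpn⟩
          rw [St.perm, swap_ne _ (by omega) (by omega)]
        | @act_rest _ j₀ hj0 hk =>
          obtain rfl := Q.inj j₀ j' (by omega) (by omega)
          obtain rfl := I'.unique Q.inj' G' (.act_rest (j' := y₁) (by omega) (by omega))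
          refine ⟨y₁, .dor ?_ ?_ (by omega) (by omega) (fun _ => Or.inl (m5 y₁ hy le_rfl)),
            J.congr (fun c e1 e2 => ?_) hpn⟩
          · rw [he, Equiv.swap_apply_right]
          · rw [Equiv.swap_apply_of_ne_of_ne] <;> omega
          · by_cases e3 : c = j₀
            · rw [e3, St.perm, swap_left]; omega
            · rw [St.perm, swap_ne _ e3 (by omega)]
      · have hs'j : s' j' = n j := by rw [b3 j' (by omega) (by omega), n1]
        cases I with
        | @act_left _ j₀ hj0 h0 =>
          obtain rfl := Q.inj j₀ j' (by omega) (by omega)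
          obtain rfl := I'.unique Q.inj' G' (.act_left (j' := j₀) (by omega) (by omega))
          refine ⟨y₁, .act (by omega) (by omega) (by omega), J.congr (fun c e1 e2 => ?_) hpn⟩
          rw [St.perm, swap_ne _ (by omega) (by omega)]
        | act_pass hj0 h0 hk =>
          obtain rfl := I'.unique Q.inj' G' (.act_pass (j' := j') (by omega) (by omega) (by omega))
          refine ⟨y₁, .act (by omega) (by omega) (by omega), J.congr (fun c e1 e2 => ?_) hpn⟩
          rw [St.perm, swap_ne _ (by omega) (by omega)]
        | @act_rest _ j₀ hj0 hk =>
          obtain rfl := Q.inj j₀ j' (by omega) (by omega)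
          obtain rfl := I'.unique Q.inj' G' (.act_rest (j' := j₀) (by omega) (by omega))
          refine ⟨y₁, .dor ?_ ?_ (by omega) (by omega) (by omega), J.congr (fun c e1 e2 => ?_) hpn⟩
          · rw [Equiv.swap_apply_of_ne_of_ne] <;> omega
          · rw [Equiv.swap_apply_of_ne_of_ne] <;> omega
          · rw [St.perm, swap_ne _ (by omega) (by omega)]

end

section
variable {k : ℕ} {n s w n' s' : ℕ → ℕ} {y y₁ : ℕ} {τ τ' : St}

/-- A horizontal pipe between the dormant pair turns north there or crosses pipe `v`; either way its
label is the larger. -/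
theorem Row.dor_key (R : Row k n s w) {u v v' c : ℕ} (G : Good k n (.dor u v)) (hv : v' ≤ v)
    (hs : s v' = n v) (hw : w c ≠ 0) (h1 : u < c) (h2 : c ≤ v') : n v < w c := by
  obtain ⟨g1, g2, g3, g4, g5⟩ := G
  rcases R.fwd hw h2 with ⟨h4, h5⟩ | ⟨z, h4, h5, h6, h7⟩
  · have hv := R.vx v'
    unfold Vx at hv; omega
  · have := g5 z (by omega) (by omega)
    omega

theorem swap_def' (f : ℕ → ℕ) (a b c : ℕ) : (f ∘ Equiv.swap a b) (Equiv.swap a b c) = f c := by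
  simp

theorem dor_zero_iff {u v : ℕ} (hu : n u ≠ 0) (hv : n v ≠ 0) (c : ℕ) :
    (n ∘ Equiv.swap u v) c = 0 ↔ n c = 0 := by
  by_cases h1 : c = u
  · subst h1; rw [swap_left]; omega
  by_cases h2 : c = v
  · subst h2; rw [swap_right]; omega
  rw [swap_ne _ h1 h2]

/-- Jeu de taquin carries the dormant pair along with its own exchange, so usually both insertions
stay dormant or awake together. When the pipe to be woken lies in column `y₁ + 1`, the parallel
position begins. -/
theorem Sync.step_dor (Q : JSq k n s w n' s' y y₁) {u v u₀ v₀ : ℕ}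
    (hu₀ : u₀ = Equiv.swap y (y + 1) u) (hv₀ : v₀ = Equiv.swap y (y + 1) v) (h1 : y ≠ u)
    (h2 : y ≠ v) (h3 : y + 1 = u → n y = 0 ∨ n v < n y) (G : Good k n (.dor u v))
    (G' : Good k n' (.dor u₀ v₀)) (Gτ : Good k s τ) (Gτ' : Good k s' τ')
    (I : IRow k n s (.dor u v) τ) (I' : IRow k n' s' (.dor u₀ v₀) τ') :
    ∃ z, Sync k s y₁ τ τ' z ∧ JRow (n ∘ Equiv.swap u v) (s ∘ τ.perm) y z := by
  have R := Q.row
  obtain ⟨b1, b2, b3⟩ := Q.s_data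
  obtain ⟨j1, j2⟩ := Q.inv
  have hnu : n' u₀ = n u := by rw [Q.hn, hu₀, swap_def']
  have hnv : n' v₀ = n v := by rw [Q.hn, hv₀, swap_def']
  have hsw : ∀ c, s' (Equiv.swap y₁ (y₁ + 1) c) = s c := fun c => by rw [Q.hs, swap_def']
  obtain ⟨u', v', hu1, hv1, hu2, hv2, hne, hu3, hu4, hu5, hv3, hv4, hv5, hc1, hc2⟩ := R.dor_next G
  have key := fun c => R.dor_key (c := c) G hv1 hv2
  obtain ⟨g1, g2, g3, g4, g5⟩ := G
  have act' : Equiv.swap y₁ (y₁ + 1) v' < Equiv.swap y₁ (y₁ + 1) u' →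
      τ' = .act (Equiv.swap y₁ (y₁ + 1) u') := fun h =>
    I'.unique Q.inj' G' (.dor_act (by rw [hsw, hnu, hu2]) (by rw [hsw, hnv, hv2]) h)
  have dor' : Equiv.swap y₁ (y₁ + 1) u' < Equiv.swap y₁ (y₁ + 1) v' →
      τ' = .dor (Equiv.swap y₁ (y₁ + 1) u') (Equiv.swap y₁ (y₁ + 1) v') := fun h =>
    I'.unique Q.inj' G' (.dor_dor (by rw [hsw, hnu, hu2]) (by rw [hsw, hnv, hv2]) h)
  have zn := dor_zero_iff (n := n) (u := u) (v := v) (by omega) (by omega)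
  have zs := dor_zero_iff (n := s) (u := u') (v := v') (by omega) (by omega)
  rcases Q.cases with ⟨rfl, hst⟩ | ⟨hy, m1, m2, m3, m4, m5, m6, m7, m8⟩
  · have hy' : y₁ ≠ u' := by
      rintro rfl
      rcases hu3 with ⟨e, -⟩ | ⟨e, -, -, e2, -⟩
      · exact h1 e
      · by_cases e1 : y₁ + 1 = u
        · rw [e1] at hst; omega
        · have := (hu5 (y₁ + 1) (by omega) (by omega)).2
          omega
    cases I with
    | @dor_act _ _ p q hp hq hlt =>
      obtain rfl := Q.inj p u' (by omega) (by omega)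
      obtain rfl := Q.inj q v' (by omega) (by omega)
      obtain rfl := hc1 hlt
      have par : ∀ σ', y₁ + 1 = p → (σ' = .act y₁ ∨ σ' = .dor y₁ (y₁ + 1)) →
          ∃ z, Sync k s y₁ (.act p) σ' z ∧
            JRow (n ∘ Equiv.swap p v) (s ∘ (St.act p).perm) y₁ z := by
        rintro σ' rfl hσ
        have e := Gτ.2.2
        refine ⟨y₁ + 1, .par (by omega) (fun c e1 e2 => ?_) (Or.inl rfl) hσ,
          Or.inr ⟨?_, by omega, fun c e1 e2 => ?_, fun c e1 e2 => by omega, ?_⟩⟩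
        · rw [show c = y₁ + 1 by omega]; omega
        · rw [St.perm, swap_left, e]
        · rw [show c = y₁ + 1 by omega, St.perm, swap_left, e]
        · rw [St.perm, swap_right]; omega
      by_cases e1 : y₁ + 1 = p
      · have e3 : Equiv.swap y₁ (y₁ + 1) p = y₁ := by rw [e1, Equiv.swap_apply_right]
        by_cases e2 : q = y₁
        · have e4 : Equiv.swap y₁ (y₁ + 1) q = y₁ + 1 := by rw [e2, Equiv.swap_apply_left]
          obtain rfl := dor' (by omega)
          exact par _ e1 (Or.inr (by rw [e3, e4]))
        · have e4 : Equiv.swap y₁ (y₁ + 1) q = q := Equiv.swap_apply_of_ne_of_ne e2 (by omega)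
          obtain rfl := act' (by omega)
          exact par _ e1 (Or.inl (by rw [e3]))
      · have e3 : Equiv.swap y₁ (y₁ + 1) p = p :=
          Equiv.swap_apply_of_ne_of_ne (by omega) (by omega)
        have e4 : Equiv.swap y₁ (y₁ + 1) q < p := by
          rw [Equiv.swap_apply_def]; split_ifs <;> omega
        obtain rfl := act' (by omega)
        rw [e3] at Gτ' ⊢
        have e5 := Gτ.2.2
        have e6 := Gτ'.2.2
        have e7 : y₁ ≠ p + 1 := by rintro rfl; omega
        refine ⟨y₁, .act (by omega) (by omega) (by omega), .stay ?_⟩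
        rw [St.perm, swap_ne _ (by omega) (by omega)]; omega
    | @dor_dor _ _ p q hp hq hlt =>
      obtain rfl := Q.inj p u' (by omega) (by omega)
      obtain rfl := Q.inj q v' (by omega) (by omega)
      have huv := hc2 hlt
      have hy'' : y₁ ≠ q := by
        rintro rfl
        obtain ⟨e1, e2, e3, e4, e5⟩ := hv3.resolve_left (by omega)
        have e6 : y₁ + 1 ≠ v := by rintro rfl; omega
        have e7 := hv5 (y₁ + 1) (by omega) (by omega)
        have e8 := g5 (y₁ + 1) (by omega) (by omega)
        omega
      obtain rfl := dor' (by
        rw [Equiv.swap_apply_def, Equiv.swap_apply_def]; split_ifs <;> omega)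
      refine ⟨y₁, .dor rfl rfl hy' hy'' (fun e => ?_), .stay ?_⟩
      · subst e
        have e1 := Q.inj
        have e2 : u = y₁ + 1 := by
          rcases hu3 with ⟨e2, -⟩ | ⟨e2, e3, -⟩
          · exact e2.symm
          · omega
        subst e2
        by_cases e3 : s y₁ = 0
        · exact Or.inl e3
        right
        by_cases e4 : n y₁ = 0
        · have e5 : w (y₁ + 1) = s y₁ ∧ w (y₁ + 1 + 1) = s y₁ := by
            have v1 := R.vx y₁
            have v2 := R.vx (y₁ + 1)
            have e5 : w (y₁ + 1) = s y₁ := by clear v2; unfold Vx at v1; omega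
            clear v1
            unfold Vx at v2; omega
          have := key (y₁ + 1 + 1) (by omega) (by omega) (by omega)
          omega
        · have := R.straight e4 e3
          have := (h3 rfl).resolve_left e4
          omega
      · rw [Ne, St.perm, zs]; omega
  · have J := Q.step
    have hu' : u' ≠ y₁ := by
      rintro rfl
      have := m5 u' hy le_rfl
      omega
    have hv' : v' ≠ y₁ := by
      rintro rfl
      have := m5 v' hy le_rfl
      omega
    have hun : ¬ (y + 1 < u ∧ u ≤ y₁) := fun e => g1 (m6 u e.1 e.2)
    have hvn : ¬ (y + 1 < v ∧ v ≤ y₁) := fun e => by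
      have := m6 v e.1 e.2
      omega
    cases I with
    | @dor_act _ _ p q hp hq hlt =>
      obtain rfl := Q.inj p u' (by omega) (by omega)
      obtain rfl := Q.inj q v' (by omega) (by omega)
      obtain rfl := hc1 hlt
      have e1 : p ≠ y + 1 := by rintro rfl; omega
      have e2 : ¬ (q < y₁ + 1 ∧ y₁ + 1 ≤ v) := by
        intro e
        have e2 := hv4 (y₁ + 1) e.1 e.2
        have e3 := m8 (y₁ + 1) (by omega) le_rfl
        omega
      have e3 : Equiv.swap y₁ (y₁ + 1) p = p :=
        Equiv.swap_apply_of_ne_of_ne hu' (by omega)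
      obtain rfl := act' (by
        rw [Equiv.swap_apply_def, Equiv.swap_apply_def]; split_ifs <;> omega)
      rw [e3]
      refine ⟨y₁, .act (by omega) (by omega) (by omega), J.congr (fun c f1 f2 => ?_)
        fun c f1 f2 f3 => (zn c).2 f3⟩
      rw [St.perm, swap_ne _ (by omega) (by omega)]
    | @dor_dor _ _ p q hp hq hlt =>
      obtain rfl := Q.inj p u' (by omega) (by omega)
      obtain rfl := Q.inj q v' (by omega) (by omega)
      obtain rfl := dor' (by
        rw [Equiv.swap_apply_def, Equiv.swap_apply_def]; split_ifs <;> omega)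
      exact ⟨y₁, .dor rfl rfl hu'.symm hv'.symm (fun _ => Or.inl (m5 y₁ hy le_rfl)),
        J.congr (fun c _ _ => zs c) fun c _ _ f3 => (zn c).2 f3⟩

end

section
variable {k : ℕ} {n s w n' s' : ℕ → ℕ} {y y₁ : ℕ} {τ τ' : St}

/-- If the pipe in column `u` runs straight, an insertion that exchanges columns `u` and `u + 1`
again exchanges two adjacent columns on the next line, and these exchanges satisfy the rule of jeu
de taquin. Both `Sync.step_par` and `JCert.of_ins` rest on this. -/
theorem Row.par_next (R : Row k n s w) (hI : LineInj s) {u : ℕ} {σ : St}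
    (hσ : σ = .act u ∨ σ = .dor u (u + 1)) (G : Good k n σ) (Gτ : Good k s τ)
    (I : IRow k n s σ τ) (hs : s u = n u) (hu : n u ≠ 0) :
    ∃ u₁, u ≤ u₁ ∧ (τ = .act u₁ ∨ τ = .dor u₁ (u₁ + 1)) ∧
      (∀ c, u < c → c ≤ u₁ → s c ≠ 0 ∧ s c ≤ k) ∧
      JRow (n ∘ Equiv.swap u (u + 1)) (s ∘ τ.perm) u u₁ := by
  have hst : JRow (n ∘ Equiv.swap u (u + 1)) (s ∘ Equiv.swap u (u + 1)) u u :=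
    .stay (by rw [swap_right]; omega)
  rcases hσ with rfl | rfl
  · cases I with
    | @act_left _ j hj h0 =>
      obtain rfl := hI j u (by omega) (by omega)
      exact ⟨j, le_rfl, Or.inl rfl, fun c e1 e2 => by omega, hst⟩
    | act_pass hj h0 hk =>
      have e := Gτ.2.2
      refine ⟨u + 1, by omega, Or.inl rfl, fun c e1 e2 => ?_,
        Or.inr ⟨?_, by omega, fun c e1 e2 => ?_, fun c e1 e2 => by omega, ?_⟩⟩
      · rw [show c = u + 1 by omega]; exact ⟨h0, hk⟩
      · rw [St.perm, swap_left, e]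
      · rw [show c = u + 1 by omega, St.perm, swap_left, e]
      · rw [St.perm, swap_right]; exact h0
    | @act_rest _ j hj hk =>
      obtain rfl := hI j u (by omega) (by omega)
      exact ⟨j, le_rfl, Or.inr rfl, fun c e1 e2 => by omega, hst⟩
  · obtain ⟨u', v', hu1, hv1, hu2, hv2, hne, hu3, hu4, hu5, hv3, hv4, hv5, hc1, hc2⟩ :=
      R.dor_next G
    have := G.2.2.1
    obtain rfl := hI u' u (by omega) (by omega)
    cases I with
    | @dor_act _ _ p q hp hq hlt =>
      obtain rfl := hI p u' (by omega) (by omega)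
      exact ⟨p, le_rfl, Or.inl rfl, fun c e1 e2 => by omega, hst⟩
    | @dor_dor _ _ p q hp hq hlt =>
      obtain rfl := hI p u' (by omega) (by omega)
      obtain rfl := hI q v' (by omega) (by omega)
      obtain rfl : q = p + 1 := by have := hc2 hlt; omega
      exact ⟨p, le_rfl, Or.inr rfl, fun c e1 e2 => by omega, hst⟩

theorem Sync.step_par (Q : JSq k n s w n' s' y y₁) {u : ℕ} {σ σ' : St} (hu : y < u)
    (hsm : ∀ c, y < c → c ≤ u → n c ≠ 0 ∧ n c ≤ k)
    (hσ : σ = .act u ∨ σ = .dor u (u + 1)) (hσ' : σ' = .act y ∨ σ' = .dor y (y + 1))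
    (G : Good k n σ) (G' : Good k n' σ') (Gτ : Good k s τ)
    (I : IRow k n s σ τ) (I' : IRow k n' s' σ' τ') :
    ∃ z, Sync k s y₁ τ τ' z ∧ JRow (n ∘ Equiv.swap u (u + 1)) (s ∘ τ.perm) u z := by
  have R := Q.row
  obtain ⟨a1, a2, a3⟩ := Q.n_data
  obtain ⟨b1, b2, b3⟩ := Q.s_data
  obtain ⟨j1, j2⟩ := Q.inv
  -- A pipe with label at most `k` that turns needs an empty top column immediately to its left, if
  -- it does not start there; these columns are full.
  have hstr : ∀ c, y + 2 ≤ c → c ≤ u → s c = n c := by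
    intro c h1 h2
    have h3 := hsm c (by omega) h2
    have h4 := hsm (c - 1) (by omega) (by omega)
    rcases R.down_small h3.1 h3.2 with h5 | ⟨d, h5, -, h6, -, -, -, -, h7⟩
    · exact h5.1
    · by_cases h8 : d = c - 1
      · rw [h8] at h6; omega
      · have := (h7 (c - 1) (by omega) (by omega)).1
        omega
  have hun := hsm u hu le_rfl
  rcases Q.cases with ⟨rfl, hst⟩ | ⟨hy, m1, m2, m3, m4, m5, m6, m7, m8⟩
  · have hsu : ∀ c, y₁ < c → c ≤ u → s c = n c := by
      intro c h1 h2
      by_cases h3 : c = y₁ + 1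
      · rw [h3, hst]
      · exact hstr c (by omega) h2
    obtain ⟨u₁, h1, h2, h3, h4⟩ := R.par_next Q.inj hσ G Gτ I (hsu u hu le_rfl) hun.1
    refine ⟨u₁, .par (by omega) (fun c e1 e2 => ?_) h2 ?_, h4⟩
    · rcases Nat.lt_or_ge u c with h5 | h5
      · exact h3 c h5 e2
      · rw [hsu c e1 h5]; exact hsm c e1 h5
    · have I1 := Q.inj'
      rcases hσ' with rfl | rfl
      · have e := G'.2.2
        cases I' with
        | @act_left _ j hj h0 =>
          rw [I1 j y₁ (by omega) (by omega)]; exact Or.inl rfl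
        | act_pass hj h0 hk =>
          exfalso
          have v1 := R.vx y₁
          have v2 := R.vx (y₁ + 1)
          have e1 : w (y₁ + 1) = s y₁ := by clear v2; unfold Vx at v1; omega
          clear v1
          unfold Vx at v2; omega
        | @act_rest _ j hj hk =>
          rw [I1 j y₁ (by omega) (by omega)]; exact Or.inr rfl
      · have e := G'.2.2.1
        cases I' with
        | @dor_act _ _ p q hp hq hlt =>
          rw [I1 p y₁ (by omega) (by omega)]; exact Or.inl rfl
        | @dor_dor _ _ p q hp hq hlt =>
          obtain rfl := I1 p y₁ (by omega) (by omega)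
          rcases R.down (c := p) (by omega) with e1 | ⟨d, e1, e2, -⟩
          · rw [I1 q (p + 1) (by omega) (by omega)]; exact Or.inr rfl
          · have := b3 d (by omega) (by omega)
            have := I1 q d (by omega) (by omega)
            omega
  · obtain rfl : σ' = .act y := by
      rcases hσ' with rfl | rfl
      · rfl
      · have := G'.2.2.1
        omega
    rcases Nat.lt_or_ge (y + 1) u with huy | huy
    · have hy₁ : y₁ = y + 1 := by
        by_contra hcon
        exact (hsm (y + 2) (by omega) (by omega)).1 (m6 (y + 2) (by omega) (by omega))
      subst hy₁
      have e1 := hstr (y + 2) le_rfl (by omega)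
      have e2 := hsm (y + 2) (by omega) (by omega)
      rw [show y + 1 + 1 = y + 2 from rfl] at *
      obtain ⟨u₁, h1, h2, h3, h4⟩ := R.par_next Q.inj hσ G Gτ I (hstr u (by omega) le_rfl) hun.1
      refine ⟨u₁, .par (by omega) (fun c f1 f2 => ?_) h2 ?_, h4⟩
      · rcases Nat.lt_or_ge u c with h5 | h5
        · exact h3 c h5 f2
        · rw [hstr c (by omega) h5]; exact hsm c (by omega) h5
      · cases I' with
        | act_left hj h0 => omega
        | act_pass hj h0 hk => exact Or.inl rfl
        | act_rest hj hk => omega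
    · obtain rfl : u = y + 1 := by omega
      have hwu : w (y + 1 + 1) = 0 := by
        have v2 := R.vx (y + 1)
        unfold Vx at v2; omega
      -- the position of the moving pipe at the bottom of the row
      obtain ⟨d, hd, hsd⟩ : ∃ d, d ≤ y ∧ s d = n (y + 1) := by
        rcases R.down (c := y + 1) j1 with h1 | ⟨d, h1, h2, -⟩
        · omega
        · exact ⟨d, by omega, h2⟩
      have hs'd : s' d = n' y := by rw [b3 d (by omega) (by omega)]; omega
      -- The parallel position ends: jeu de taquin has moved to column `y + 1`, and both insertions
      -- are dormant, with the larger label in column `y + 2` before jeu de taquin and in column `y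
      -- + 1` after it.
      have finish : k < s (y + 2) → τ = .dor d (y + 2) → ∃ z, Sync k s y₁ τ τ' z ∧
          JRow (n ∘ Equiv.swap (y + 1) (y + 1 + 1)) (s ∘ τ.perm) (y + 1) z := by
        rintro h1 rfl
        have hy₁ : y₁ = y + 1 := by
          by_contra hcon
          have := m5 (y + 2) (by omega) (by omega)
          omega
        subst hy₁
        rw [show y + 1 + 1 = y + 2 from rfl] at *
        cases I' with
        | act_left hj h0 => omega
        | act_pass hj h0 hk => omega
        | @act_rest _ j hj hk =>
          obtain rfl := Q.inj' j d (by omega) (by omega)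
          refine ⟨y + 1, .dor ?_ ?_ (by omega) (by omega) (by omega), .stay ?_⟩
          · rw [Equiv.swap_apply_of_ne_of_ne (by omega) (by omega)]
          · rw [show y + 2 = y + 1 + 1 from rfl, Equiv.swap_apply_right]
          · rw [St.perm, show y + 1 + 1 = y + 2 from rfl, swap_right]; omega
      rcases hσ with rfl | rfl
      · cases I with
        | @act_left _ j hj h0 =>
          obtain rfl := Q.inj j d (by omega) (by omega)
          rw [show y + 1 + 1 = y + 2 from rfl] at *
          have hy₁ : y + 2 ≤ y₁ := by
            by_contra hcon
            obtain rfl : y₁ = y + 1 := by omega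
            exact m7 h0
          have e := b3 (y + 1) (by omega) (by omega)
          cases I' with
          | @act_left _ j' hj' h0' =>
            obtain rfl := Q.inj' j' j (by omega) (by omega)
            refine ⟨y₁, .act (by omega) (by omega) (by omega),
              Or.inr ⟨?_, by omega, fun c e1 e2 => ?_, fun c e1 e2 => ?_, ?_⟩⟩
            · rw [St.perm, swap_ne _ (by omega) (by omega)]; exact h0
            · rw [St.perm, swap_ne _ (by omega) (by omega)]; exact m5 c (by omega) e2
            · rw [swap_ne _ (by omega) (by omega)]; exact m6 c (by omega) e2
            · rw [St.perm, swap_ne _ (by omega) (by omega)]; exact m7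
          | act_pass hj' h0' hk => omega
          | act_rest hj' hk => omega
        | act_pass hj h0 hk =>
          have e := Gτ.2.2
          have hy₁ : y₁ = y + 1 := by
            by_contra hcon
            exact h0 (m5 (y + 2) (by omega) (by omega))
          subst hy₁
          cases I' with
          | act_left hj' h0' => omega
          | act_pass hj' h0' hk' =>
            refine ⟨y + 1 + 1, .par (by omega) (fun c e1 e2 => ?_) (Or.inl rfl) (Or.inl rfl),
              Or.inr ⟨?_, by omega, fun c e1 e2 => ?_, fun c e1 e2 => by omega, ?_⟩⟩
            · rw [show c = y + 1 + 1 by omega]; exact ⟨h0, hk⟩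
            · rw [St.perm, swap_left, e]
            · rw [show c = y + 1 + 1 by omega, St.perm, swap_left, e]
            · rw [St.perm, swap_right]; exact h0
          | act_rest hj' hk' => omega
        | @act_rest _ j hj hk =>
          obtain rfl := Q.inj j d (by omega) (by omega)
          exact finish hk rfl
      · obtain ⟨g1, g2, g3, -⟩ := G
        have e : s (y + 2) = n (y + 2) := by
          have v1 := R.vx (y + 1 + 1)
          rw [show y + 1 + 1 = y + 2 from rfl] at *
          unfold Vx at v1; omega
        rw [show y + 1 + 1 = y + 2 from rfl] at *
        cases I with
        | @dor_act _ _ p q hp hq hlt =>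
          have := Q.inj p d (by omega) (by omega)
          have := Q.inj q (y + 2) (by omega) (by omega)
          omega
        | @dor_dor _ _ p q hp hq hlt =>
          obtain rfl := Q.inj p d (by omega) (by omega)
          obtain rfl := Q.inj q (y + 2) (by omega) (by omega)
          exact finish (by omega) rfl

end

theorem exists_seq {α : Type*} {P : ℕ → α → Prop} {S : ℕ → α → α → Prop} {b : ℕ} {a : α}
    (h0 : P (b + 1) a) (step : ∀ i a, b < i → P i a → ∃ a', P (i + 1) a' ∧ S i a a') :
    ∃ f : ℕ → α, f (b + 1) = a ∧ ∀ i, b < i → P i (f i) ∧ S i (f i) (f (i + 1)) := by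
  classical
  have hex : ∀ i a, ∃ a', b < i ∧ P i a → P (i + 1) a' ∧ S i a a' := by
    intro i a
    by_cases hg : b < i ∧ P i a
    · obtain ⟨a', h⟩ := step i a hg.1 hg.2
      exact ⟨a', fun _ => h⟩
    · exact ⟨a, fun h => absurd h hg⟩
  choose f hf using hex
  let g : ℕ → α := fun m => Nat.rec a (fun m x => f (b + 1 + m) x) m
  have hg : ∀ m, P (b + 1 + m) (g m) := by
    intro m
    induction m with
    | zero => exact h0
    | succ m ih => exact (hf _ _ ⟨by omega, ih⟩).1
  refine ⟨fun i => g (i - (b + 1)), by simp [g], fun i hi => ?_⟩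
  obtain ⟨m, rfl⟩ := Nat.exists_eq_add_of_le hi
  have e1 : b.succ + m - (b + 1) = m := by omega
  have e2 : b.succ + m + 1 - (b + 1) = m + 1 := by omega
  simp only [e1, e2]
  exact ⟨hg m, (hf _ _ ⟨by omega, hg m⟩).2⟩

section
variable {k : ℕ} {n s w n' s' : ℕ → ℕ} {y y₁ z : ℕ} {σ σ' τ τ' : St}

theorem Sync.next (Q : JSq k n s w n' s' y y₁) (S : Sync k n y σ σ' z) (G : Good k n σ)
    (G' : Good k n' σ') (Gτ : Good k s τ) (Gτ' : Good k s' τ') (I : IRow k n s σ τ)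
    (I' : IRow k n' s' σ' τ') :
    ∃ z₁, Sync k s y₁ τ τ' z₁ ∧ JRow (n ∘ σ.perm) (s ∘ τ.perm) z z₁ := by
  cases S with
  | act h1 h2 h3 => exact step_act Q h1 h2 h3 G G' Gτ Gτ' I I'
  | dor hu hv h1 h2 h3 => exact step_dor Q hu hv h1 h2 h3 G G' Gτ Gτ' I I'
  | @par u σ σ' hu h hσ hσ' =>
    have hp : σ.perm = Equiv.swap z (z + 1) := by rcases hσ with rfl | rfl <;> rfl
    rw [hp]
    exact step_par Q hu h hσ hσ' G G' Gτ I I'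

theorem Sync.jInv (S : Sync k n y σ σ' z) (hJ : JInv n y) (G : Good k n σ) :
    JInv (n ∘ σ.perm) z := by
  obtain ⟨j1, j2⟩ := hJ
  cases S with
  | act h1 h2 h3 =>
    rw [JInv, St.perm, swap_ne _ (by omega) (by omega), swap_ne _ h2 h3]
    exact ⟨j1, j2⟩
  | @dor u v u' v' hu hv h1 h2 h3 =>
    obtain ⟨g1, g2, g3, g4, g5⟩ := G
    rw [JInv, St.perm, swap_ne n h1 h2]
    by_cases e1 : y + 1 = u
    · rw [e1, swap_left]
      exact ⟨by omega, h3 e1⟩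
    by_cases e2 : y + 1 = v
    · rw [e2] at j2
      rw [e2, swap_right]
      exact ⟨by omega, by omega⟩
    rw [swap_ne _ e1 e2]
    exact ⟨j1, j2⟩
  | @par _ _ _ hu h hσ hσ' =>
    have hp : σ.perm = Equiv.swap z (z + 1) := by rcases hσ with rfl | rfl <;> rfl
    have e := h z hu le_rfl
    rw [hp, JInv, swap_left, swap_right]
    refine ⟨e.1, ?_⟩
    rcases hσ with rfl | rfl
    · exact Or.inl G.2.2
    · have := G.2.2.1
      omega

/-- This is the commuting square on one line. In the parallel position it is degenerate: insertion
after jeu de taquin undoes the exchange, and jeu de taquin after insertion undoes the insertion, so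
both sides are `n`. -/
theorem Sync.perm (S : Sync k n y σ σ' z) :
    (n ∘ Equiv.swap y (y + 1)) ∘ σ'.perm = (n ∘ σ.perm) ∘ Equiv.swap z (z + 1) := by
  cases S with
  | @act j h1 h2 h3 =>
    funext c
    simp only [St.perm, Function.comp_apply, Equiv.swap_apply_def]
    congr 1
    split_ifs <;> omega
  | @dor u v u' v' hu hv h1 h2 h3 =>
    subst hu hv
    funext c
    have := Equiv.swap_apply_apply (Equiv.swap y (y + 1)) u v
    simp only [St.perm, Function.comp_apply, this, Equiv.Perm.mul_apply, Equiv.swap_inv,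
      Equiv.swap_apply_self]
  | @par _ _ _ hu h hσ hσ' =>
    have hp : σ.perm = Equiv.swap z (z + 1) := by rcases hσ with rfl | rfl <;> rfl
    have hp' : σ'.perm = Equiv.swap y (y + 1) := by rcases hσ' with rfl | rfl <;> rfl
    rw [hp, hp']
    funext c
    simp

end

section
variable {k r b : ℕ} {v h v' h' v₁ v₁' : ℕ → ℕ → ℕ} {y : ℕ → ℕ} {σ σ' : ℕ → St}

/-- The exchanged column `y (b + 1) + 1` is at or to the left of the rightmost `rElbow` of row `b`.
If it is the column of that elbow, which is always so for `b = r`, the processes are parallel at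
once; otherwise they start apart. The last two clauses attach the new path to row `r` or to the
unchanged path above. -/
theorem JCert.sync_start (H : Lab k v h) (J : JCert r v y v') (H' : Lab k v' h')
    (I : Ins k b v σ v₁) (I' : Ins k b v' σ' v₁') (hrb : r ≤ b) (hbk : b ≤ k) :
    ∃ z, Sync k (v (b + 1)) (y (b + 1)) (σ (b + 1)) (σ' (b + 1)) z ∧
      (b = r → r ≤ z ∧ v₁ (b + 1) (z + 1) = r ∧ v₁ (b + 1) z = 0) ∧
      (r < b → JRow (v b) (v₁ (b + 1)) (y b) z) := by
  have hr := J.row_pos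
  obtain ⟨j, h1, h2, h3, h4⟩ := H.start (b := b) (by omega) hbk
  obtain ⟨j₀, s1, s2⟩ := I.start
  obtain rfl := H.inj (b + 1) j₀ j (by omega) (by omega)
  obtain ⟨j', t1, t2⟩ := I'.start
  obtain ⟨c1, c2, c3⟩ := J.line (i := b + 1) (by omega)
  obtain ⟨j1, j2⟩ := J.inv (b + 1) (by omega)
  have hle : y (b + 1) + 1 ≤ j₀ := by
    by_contra hcon
    exact j1 (h4 _ (by omega)).2.2
  have hj1 := (h4 (j₀ + 1) (by omega)).2.2
  have hb := I.below (b + 1) (by omega)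
  rw [s1] at hb ⊢
  rw [t1, hb]
  simp only [St.perm]
  by_cases he : y (b + 1) + 1 = j₀
  · have : j' = y (b + 1) := by
      refine H'.inj (b + 1) _ _ ?_ (by omega)
      rw [t2, c1, he, h1]
    subst this
    refine ⟨j₀, .par (by omega) (fun c e1 e2 => ?_) (Or.inl rfl) (Or.inl rfl), fun e => ?_,
      fun e => ?_⟩
    · rw [show c = j₀ by omega]; omega
    · rw [swap_left, swap_right]
      have := J.pos (i := b + 1) (by omega)
      omega
    · rcases J.step b e with ⟨f1, f2⟩ | ⟨f1, f2, f3, f4, f5⟩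
      · exfalso
        have := (J.inv b e).1
        rw [← f2, he] at this
        exact this h2
      · refine Or.inr ⟨?_, by omega, fun c e1 e2 => ?_, fun c e1 e2 => ?_, ?_⟩
        · rw [swap_ne _ (by omega) (by omega)]; exact f1
        · by_cases e3 : c = j₀
          · rw [e3, swap_left]; exact hj1
          · rw [swap_ne _ e3 (by omega)]; exact f3 c e1 (by omega)
        · by_cases e3 : c = j₀
          · rw [e3]; exact h2
          · exact f4 c e1 (by omega)
        · rw [swap_right]; omega
  · have : j' = j₀ := by
      refine H'.inj (b + 1) _ _ ?_ (by omega)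
      rw [t2, c3 j₀ (by omega) (by omega), h1]
    subst this
    refine ⟨y (b + 1), .act he (by omega) (by omega), fun e => ?_, fun e => ?_⟩
    · subst e
      exact absurd (H.inj (b + 1) _ _ (by rw [J.start, h1]) j1) he
    · refine (J.step b e).congr (fun c e1 e2 => ?_) fun _ _ _ h => h
      rw [swap_ne _ (by omega) (by omega)]

/-- Jeu de taquin commutes with right insertion. -/
theorem JCert.commute (H : Lab k v h) (J : JCert r v y v') (H' : Lab k v' h')
    (I : Ins k b v σ v₁) (I' : Ins k b v' σ' v₁') (hrb : r ≤ b) (hbk : b ≤ k) :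
    ∃ z, JCert r v₁ z v₁' := by
  obtain ⟨z₀, S0, S1, S2⟩ := J.sync_start H H' I I' hrb hbk
  obtain ⟨z, hz0, hz⟩ := exists_seq (b := b)
    (P := fun i z => Sync k (v i) (y i) (σ i) (σ' i) z)
    (S := fun i z z₁ => JRow (v i ∘ (σ i).perm) (v (i + 1) ∘ (σ (i + 1)).perm) z z₁) S0
    fun i a hi hS => hS.next ⟨H.row i, H.inj (i + 1), H'.inj (i + 1), J.inv i (by omega),
      J.step i (by omega), J.below i (by omega), J.below (i + 1) (by omega)⟩ (I.good i hi)
      (I'.good i hi) (I.good (i + 1) (by omega)) (I'.good (i + 1) (by omega)) (I.step i hi)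
      (I'.step i hi)
  have zle : ∀ i, i ≤ b → (if i ≤ b then y i else z i) = y i := fun i hi => if_pos hi
  have zgt : ∀ i, b < i → (if i ≤ b then y i else z i) = z i := fun i hi => if_neg (by omega)
  refine ⟨fun i => if i ≤ b then y i else z i, J.row_pos, ?_, ?_, ?_, fun i hi => ?_,
    fun i hi => ?_, fun i hi => ?_, fun i hi => ?_⟩
  · rcases hrb.eq_or_lt with e | e
    · rw [zgt _ (by omega), e, hz0]; have := (S1 e.symm).1; omega
    · rw [zle _ (by omega)]; exact J.col
  · rcases hrb.eq_or_lt with e | e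
    · rw [zgt _ (by omega)]
      subst e
      rw [hz0]; exact (S1 rfl).2.1
    · rw [zle _ (by omega), I.above _ (by omega)]; exact J.start
  · rcases hrb.eq_or_lt with e | e
    · rw [zgt _ (by omega)]
      subst e
      rw [hz0]; exact (S1 rfl).2.2
    · rw [zle _ (by omega), I.above _ (by omega)]; exact J.start_zero
  · rcases lt_trichotomy i b with e | rfl | e
    · rw [zle _ (by omega), zle _ (by omega), I.above _ (by omega), I.above _ (by omega)]
      exact J.step i hi
    · rw [zle _ (by omega), zgt _ (by omega), I.above _ (by omega), hz0]
      exact S2 hi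
    · rw [zgt _ (by omega), zgt _ (by omega), I.below _ e, I.below _ (by omega)]
      exact (hz i e).2
  · rcases Nat.lt_or_ge b i with e | e
    · rw [zgt _ (by omega), I.below _ e]
      exact (hz i e).1.jInv (J.inv i hi) (I.good i e)
    · rw [zle _ (by omega), I.above _ (by omega)]
      exact J.inv i hi
  · rw [I.above i (by omega), I'.above i (by omega), J.above i hi]
  · rcases Nat.lt_or_ge b i with e | e
    · rw [zgt _ (by omega), I.below _ e, I'.below _ e, J.below i hi]
      exact (hz i e).1.perm
    · rw [zle _ (by omega), I.above _ (by omega), I'.above _ (by omega), J.below i hi]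

end

/-! ### Undoing an insertion, and the effect on permutations -/

section
variable {k k' r b : ℕ} {v h v' h' v₁ v'' : ℕ → ℕ → ℕ} {y z : ℕ → ℕ} {σ σ' : ℕ → St}

/-- If the rows `1, …, r` have no blank tiles, then jeu de taquin undoes the insertion of a letter
into row `r`. -/
theorem JCert.of_ins (H : Lab k v h) (I : Ins k r v σ v₁) (hr : 1 ≤ r) (hrk : r ≤ k)
    (hlow : ∀ i, i ≤ r + 1 → ∀ j, v i j ≠ 0 ↔ 1 ≤ j ∧ j < i) : ∃ z, JCert r v₁ z v := by
  obtain ⟨j, h1, h2, h3, h4⟩ := H.start (b := r) hr hrk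
  obtain ⟨j₀, s1, s2⟩ := I.start
  obtain rfl := H.inj (r + 1) j₀ j (by omega) (by omega)
  obtain rfl : j₀ = r := by
    have e1 := hlow r (by omega) j₀
    have e2 := hlow (r + 1) le_rfl j₀
    omega
  -- Columns `1, …, u` stay full of labels at most `k`. Such pipes have no room to turn, so the
  -- insertion only ever exchanges adjacent columns.
  let P : ℕ → ℕ → Prop := fun i u =>
    (σ i = .act u ∨ σ i = .dor u (u + 1)) ∧ 1 ≤ u ∧ ∀ c, 1 ≤ c → c ≤ u → v i c ≠ 0 ∧ v i c ≤ k
  have h0 : P (j₀ + 1) j₀ := by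
    refine ⟨Or.inl s1, hr, fun c e1 e2 => ?_⟩
    have e3 := (hlow (j₀ + 1) le_rfl c).2 (by omega)
    have e4 := H.lt e3
    omega
  obtain ⟨z, hz0, hz⟩ := exists_seq (b := j₀) (P := P)
    (S := fun i z z₁ => JRow (v i ∘ Equiv.swap z (z + 1)) (v (i + 1) ∘ (σ (i + 1)).perm) z z₁) h0 (by
      rintro i u hi ⟨hσ, hu, hsm⟩
      have R := H.row i
      have hstr : ∀ c, 1 ≤ c → c ≤ u → v (i + 1) c = v i c := by
        intro c e1 e2
        have e3 := hsm c e1 e2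
        rcases R.down_small e3.1 e3.2 with h5 | ⟨d, h5, h6, h7, -, -, -, -, h8⟩
        · exact h5.1
        · exfalso
          by_cases e4 : d = 0
          · subst e4
            rw [R.s_zero] at h6; omega
          · exact (hsm d (by omega) (by omega)).1 h7
      obtain ⟨u₁, f1, f2, f3, f4⟩ := R.par_next (H.inj (i + 1)) hσ (I.good i hi)
        (I.good (i + 1) (by omega)) (I.step i hi) (hstr u hu le_rfl) (hsm u hu le_rfl).1
      refine ⟨u₁, ⟨f2, by omega, fun c e1 e2 => ?_⟩, f4⟩
      rcases Nat.lt_or_ge u c with e3 | e3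
      · exact f3 c e3 e2
      · rw [hstr c e1 e3]; exact hsm c e1 e3)
  have hp : ∀ i, j₀ < i → (σ i).perm = Equiv.swap (z i) (z i + 1) := by
    intro i hi
    rcases (hz i hi).1.1 with e | e <;> rw [e] <;> rfl
  have hl := fun i hi => I.below i hi
  refine ⟨z, hr, by rw [hz0], ?_, ?_, fun i hi => ?_, fun i hi => ?_,
    fun i hi => (I.above i hi).symm, fun i hi => ?_⟩
  · rw [hl _ (by omega), hp _ (by omega), swap_right, hz0, h1]
  · rw [hl _ (by omega), hp _ (by omega), swap_left, hz0]; exact (h4 _ (by omega)).2.2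
  · rw [hl _ hi, hp _ hi, hl _ (by omega)]
    exact (hz i hi).2
  · obtain ⟨⟨e1, e2, e3⟩, -⟩ := hz i hi
    have g := I.good i hi
    rw [hl _ hi, hp _ hi, JInv, swap_left, swap_right]
    refine ⟨(e3 _ e2 le_rfl).1, ?_⟩
    have := (e3 _ e2 le_rfl).2
    rcases e1 with e1 | e1 <;> rw [e1] at g
    · exact Or.inl g.2.2
    · have := g.2.2.1
      omega
  · rw [hl _ hi, hp _ hi]
    funext c
    simp

/-- The columns of two consecutive jeux de taquin from the same row. -/
theorem JCert.col_lt (J : JCert r v y v') (J' : JCert r v' z v'') (H' : Lab k v' h') {i : ℕ}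
    (hi : r < i) : z i < y i := by
  induction i, hi using Nat.le_induction with
  | base =>
    have h1 := (J.line (i := r + 1) (by omega)).1
    have h2 := J'.start
    rw [J.start] at h1
    have := H'.inj (r + 1) (z (r + 1) + 1) (y (r + 1)) (by omega) (by have := J.row_pos; omega)
    have e : r.succ = r + 1 := rfl
    rw [e]; omega
  | succ m hm ih =>
    rcases J'.step m hm with ⟨-, h2⟩ | ⟨h1, h2, h3, h4, h5⟩
    · have := J.mono (i' := m + 1) hm (by omega)
      omega
    -- After the first jeu de taquin, column `y (m + 1)` is occupied on this line, and the second
    -- one moves only across empty columns.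
    · by_contra hcon
      have h6 := (J.line (i := m + 1) (by omega)).1
      have h7 := (J.inv (m + 1) (by omega)).1
      have h8 := J.mono (i' := m + 1) hm (by omega)
      have := h3 (y (m + 1)) (by omega) (by omega)
      omega

/-- On a line far down, the exchange of columns `A` and `A + 1` exchanges the exit rows of these two
pipes, and `JInv` on that line tells which exit row is larger. -/
theorem JCert.perm {π π' : Equiv.Perm ℕ} {A : ℕ} (J : JCert r v y v') (L : Lbl v h π.symm)
    (L' : Lbl v' h' π'.symm) (hA : ∃ M, ∀ i, M < i → y i = A) :
    π = Equiv.swap A (A + 1) * π' ∧ π'.symm A < π'.symm (A + 1) ∧ r ≤ A := by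
  obtain ⟨M, hM⟩ := hA
  obtain ⟨N, hN, -⟩ := L.far
  obtain ⟨N', hN', -⟩ := L'.far
  have hl := fun c => J.below (M + N + N' + r + A + c + 2) (by omega)
  have hrA : r ≤ A := by
    rw [← hM (M + r + 1) (by omega)]; exact J.pos (by omega)
  have hr := J.row_pos
  have key : ∀ c, π'.symm c = π.symm (Equiv.swap A (A + 1) c) := by
    intro c
    have h1 := congrFun (hl c) c
    have h2 : Equiv.swap A (A + 1) c < M + N + N' + r + A + c + 2 := by
      rw [Equiv.swap_apply_def]; split_ifs <;> omega
    rw [hN' _ _ (by omega), if_pos (by omega), hM _ (by omega), Function.comp_apply,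
      hN _ _ (by omega), if_pos h2] at h1
    exact h1
  refine ⟨?_, ?_, hrA⟩
  · have e : π'.symm = π.symm * Equiv.swap A (A + 1) := Equiv.ext key
    have e' : π = (π.symm)⁻¹ := rfl
    have e'' : π' = (π'.symm)⁻¹ := rfl
    rw [e'', e, mul_inv_rev, Equiv.swap_inv, ← mul_assoc, Equiv.swap_mul_self, one_mul]
    exact e'
  · rw [key, key, Equiv.swap_apply_left, Equiv.swap_apply_right]
    have h1 := (J.inv (M + N + r + A + 2) (by omega)).2
    rw [hM _ (by omega), hN _ _ (by omega), if_pos (by omega), hN _ _ (by omega),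
      if_pos (by omega)] at h1
    exact h1.resolve_left (L.lam_ne (by omega))

end

/-- The inversions of a permutation. -/
def inversions (π : Equiv.Perm ℕ) : Set (ℕ × ℕ) := {x | x.1 < x.2 ∧ π x.2 < π x.1}

theorem inversions_swap_mul {π : Equiv.Perm ℕ} {a : ℕ} (h : π.symm a < π.symm (a + 1)) :
    inversions (Equiv.swap a (a + 1) * π) =
      insert (π.symm a, π.symm (a + 1)) (inversions π) ∧
      (π.symm a, π.symm (a + 1)) ∉ inversions π := by
  constructor
  · ext ⟨x, y⟩
    simp only [inversions, Set.mem_ofPred_eq, Set.mem_insert_iff, Prod.mk.injEq,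
      Equiv.Perm.mul_apply, Equiv.eq_symm_apply]
    rcases Nat.lt_or_ge x y with hxy | hxy
    · have hne : π x ≠ π y := fun e => by have := π.injective e; omega
      by_cases h1 : π x = a + 1 ∧ π y = a
      · have e1 : x = π.symm (a + 1) := by rw [Equiv.eq_symm_apply, h1.1]
        have e2 : y = π.symm a := by rw [Equiv.eq_symm_apply, h1.2]
        omega
      · simp only [Equiv.swap_apply_def]
        split_ifs <;> omega
    · have : ¬ (π x = a ∧ π y = a + 1) := by
        rintro ⟨e1, e2⟩
        have e1 : x = π.symm a := by rw [Equiv.eq_symm_apply, e1]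
        have e2 : y = π.symm (a + 1) := by rw [Equiv.eq_symm_apply, e2]
        omega
      constructor
      · rintro ⟨e, -⟩; omega
      · rintro (e | ⟨e, -⟩)
        · exact absurd e this
        · omega
  · simp [inversions]

theorem permLength_swap_mul {π : Equiv.Perm ℕ} {a : ℕ} (h : π.symm a < π.symm (a + 1))
    (hf : (inversions π).Finite) : (inversions (Equiv.swap a (a + 1) * π)).Finite ∧
      permLength (Equiv.swap a (a + 1) * π) = permLength π + 1 := by
  obtain ⟨h1, h2⟩ := inversions_swap_mul h
  refine ⟨by rw [h1]; exact hf.insert _, ?_⟩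
  change (inversions _).ncard = (inversions _).ncard + 1
  rw [h1, Set.ncard_insert_of_notMem h2 hf]

theorem Lab.h_unique {k k' : ℕ} {v h h' : ℕ → ℕ → ℕ} (H : Lab k v h) (H' : Lab k' v h') : h = h' :=
  funext fun i => (H.row i).w_eq (H'.row i).w_zero fun c => ((H'.row i).vx c).toB

/-- The labels of the vertical edges of the identity. -/
def vId (i j : ℕ) : ℕ := if 1 ≤ j ∧ j < i then j else 0

/-- The labels of the horizontal edges of the identity. -/
def hId (i j : ℕ) : ℕ := if 1 ≤ i ∧ i < j then i else 0

theorem vId_ne_zero {i j : ℕ} : vId i j ≠ 0 ↔ 1 ≤ j ∧ j < i := by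
  unfold vId; split_ifs <;> omega

theorem lab_id (k : ℕ) : Lab k vId hId := by
  refine ⟨fun i => ⟨?_, ?_, ?_, fun c => ?_⟩, fun j => ?_, fun j => ?_, fun j => ?_,
    0, fun i j _ => vId_ne_zero, fun i j h1 h2 _ => if_pos ⟨h1, h2⟩⟩
  · exact if_neg (by omega)
  · exact if_neg (by omega)
  · exact if_neg (by omega)
  · unfold Vx vId hId; split_ifs <;> omega
  · exact if_neg (by omega)
  · exact if_neg (by omega)
  · exact if_neg (by omega)

theorem lbl_id : Lbl vId hId (Equiv.symm (1 : Equiv.Perm ℕ)) := by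
  refine ⟨fun i j => (((lab_id 0).row i).vx j).toB, fun i => ((lab_id 0).row i).w_zero,
    (lab_id 0).h_zero, rfl, Equiv.injective _, 0, fun i j _ => ?_,
    fun i j h1 h2 _ => if_pos ⟨h1, h2⟩⟩
  have : (Equiv.symm (1 : Equiv.Perm ℕ)) j = j := rfl
  rw [this, vId]
  split_ifs <;> omega

theorem tiling_id : tiling vId hId = idTiling := by
  funext i j
  unfold tiling mkTile vId hId idTiling
  split_ifs <;> first | rfl | omega

/-- The identity has no blank tile from which jeu de taquin could start. -/
theorem gaoHuang_id {L : List (ℕ × ℕ)} : GaoHuang idTiling L ↔ L = [] := by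
  cases L with
  | nil => exact ⟨fun _ => rfl, fun _ => rfl⟩
  | cons x L =>
    refine ⟨?_, fun h => by cases h⟩
    rintro ⟨D', ⟨h1, -, y, h2, h3, -⟩, -⟩
    unfold idTiling at h3
    rw [if_neg (by omega)] at h3
    split_ifs at h3

/-! ### Chains of jeux de taquin and the growth diagram -/

/-- A sequence of jeux de taquin from row `r`, with the columns in which they end. -/
inductive JChain (k r : ℕ) : (ℕ → ℕ → ℕ) → List ℕ → (ℕ → ℕ → ℕ) → Prop
  | nil {v h : ℕ → ℕ → ℕ} (H : Lab k v h) : JChain k r v [] v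
  | cons {v h v' v'' : ℕ → ℕ → ℕ} {y : ℕ → ℕ} {A : ℕ} {L : List ℕ} (H : Lab k v h)
      (J : JCert r v y v') (hA : ∃ M, ∀ i, M < i → y i = A) (C : JChain k r v' L v'') :
      JChain k r v (A :: L) v''

section
variable {k r : ℕ} {v h v' h' v₁ v₁' v'' h'' : ℕ → ℕ → ℕ} {L : List ℕ}

theorem JChain.mono {k' : ℕ} (hk : k' ≤ k) (C : JChain k r v L v') : JChain k' r v L v' := by
  induction C with
  | nil H => exact .nil (H.mono hk)
  | cons H J hA _ ih => exact .cons (H.mono hk) J hA ih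

theorem JChain.head (C : JChain k r v L v') : ∃ h, Lab k v h := by
  cases C with
  | nil H => exact ⟨_, H⟩
  | cons H => exact ⟨_, H⟩

theorem JChain.snoc {y : ℕ → ℕ} {A : ℕ} (C : JChain k r v L v') (J : JCert r v' y v'')
    (hA : ∃ M, ∀ i, M < i → y i = A) (H : Lab k v'' h'') : JChain k r v (L ++ [A]) v'' := by
  induction C with
  | nil H' => exact .cons H' J hA (.nil H)
  | cons H' J' hA' _ ih => exact .cons H' J' hA' (ih J)

theorem Lab.of_ins {b : ℕ} {σ : ℕ → St} (H : Lab k v h) (I : Ins k b v σ v₁) (hb : 1 ≤ b)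
    (hbk : b ≤ k) : ∃ h₁, Lab k v₁ h₁ := by
  obtain ⟨τ, v₂, h₂, I₂, H₂⟩ := H.exists_ins hb hbk
  obtain rfl := (Ins.unique H (by omega) I I₂).2
  exact ⟨h₂, H₂⟩

theorem JChain.commute {b : ℕ} {σ σ' : ℕ → St} (C : JChain k r v L v') (I : Ins k b v σ v₁)
    (I' : Ins k b v' σ' v₁') (hr : 1 ≤ r) (hrb : r ≤ b) (hbk : b ≤ k) :
    ∃ L', JChain k r v₁ L' v₁' := by
  induction C generalizing v₁ σ with
  | nil H =>
    obtain rfl := (Ins.unique H (by omega) I I').2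
    obtain ⟨h₁, H₁⟩ := H.of_ins I (by omega) hbk
    exact ⟨[], .nil H₁⟩
  | cons H J hA C ih =>
    obtain ⟨h', H'⟩ := C.head
    obtain ⟨τ, v₂, h₂, I₂, H₂⟩ := H'.exists_ins (b := b) (by omega) hbk
    obtain ⟨h₁, H₁⟩ := H.of_ins I (by omega) hbk
    obtain ⟨z, Z⟩ := J.commute H H' I I₂ hrb hbk
    obtain ⟨L', C'⟩ := ih I₂ I'
    obtain ⟨M, hM⟩ := Z.eventually_const H₁
    exact ⟨_, .cons H₁ Z ⟨M, hM⟩ C'⟩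

/-- Transport the chain through the insertion, then undo the insertion at its far end by one more
jeu de taquin from the same row. -/
theorem JChain.append_ins {σ : ℕ → St} (C : JChain k r v L v') (I : Ins k r v σ v₁)
    (hr : 1 ≤ r) (hrk : r ≤ k) (H' : Lab k v' h')
    (hlow : ∀ i, i ≤ r + 1 → ∀ j, v' i j ≠ 0 ↔ 1 ≤ j ∧ j < i) : ∃ L', JChain k r v₁ L' v' := by
  obtain ⟨τ, v₂, h₂, I₂, H₂⟩ := H'.exists_ins hr hrk
  obtain ⟨L', C'⟩ := C.commute I I₂ hr le_rfl hrk
  obtain ⟨z, Z⟩ := JCert.of_ins H' I₂ hr hrk hlow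
  obtain ⟨M, hM⟩ := Z.eventually_const H₂
  exact ⟨_, C'.snoc Z ⟨M, hM⟩ H'⟩

theorem JChain.lt {y : ℕ → ℕ} {A : ℕ} (C : JChain k r v L v') (J : JCert r v'' y v)
    (hA : ∃ M, ∀ i, M < i → y i = A) : ∀ a ∈ L, a < A := by
  induction C generalizing v'' y A with
  | nil H => simp
  | cons H J' hA' C ih =>
    obtain ⟨M, hM⟩ := hA
    obtain ⟨M', hM'⟩ := hA'
    have h := J.col_lt J' H (i := M + M' + r + 1) (by omega)
    rw [hM _ (by omega), hM' _ (by omega)] at h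
    intro a ha
    rcases List.mem_cons.1 ha with rfl | ha
    · exact h
    · exact (ih J' ⟨M', hM'⟩ a ha).trans h

theorem JChain.pairwise (C : JChain k r v L v') : L.Pairwise fun c d => d < c := by
  induction C with
  | nil H => exact .nil
  | cons H J hA C ih => exact .cons (C.lt J hA) ih

theorem JChain.le (C : JChain k r v L v') : ∀ a ∈ L, r ≤ a := by
  induction C with
  | nil H => simp
  | cons H J hA C ih =>
    intro a ha
    rcases List.mem_cons.1 ha with rfl | ha
    · obtain ⟨M, hM⟩ := hA
      rw [← hM (M + r + 1) (by omega)]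
      exact J.pos (by omega)
    · exact ih a ha

theorem Lbl.lam_unique {lam lam' : ℕ → ℕ} (H : Lbl v h lam) (H' : Lbl v h' lam') :
    lam = lam' := by
  obtain ⟨N, hN, -⟩ := H.far
  obtain ⟨N', hN', -⟩ := H'.far
  funext c
  have h1 := hN (N + N' + c + 1) c (by omega)
  rw [hN' _ _ (by omega), if_pos (by omega), if_pos (by omega)] at h1
  exact h1.symm

theorem wordProd_cons (a : ℕ) (L : List ℕ) :
    wordProd (a :: L) = Equiv.swap a (a + 1) * wordProd L := by
  simp [wordProd]

theorem wordProd_append (L L' : List ℕ) : wordProd (L ++ L') = wordProd L * wordProd L' := by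
  simp [wordProd]

theorem JChain.perm {π π' : Equiv.Perm ℕ} (C : JChain k r v L v') (B : Lbl v h π.symm)
    (B' : Lbl v' h' π'.symm) (hf : (inversions π').Finite) :
    π = wordProd L * π' ∧ (inversions π).Finite ∧ permLength π = L.length + permLength π' := by
  induction C generalizing h π with
  | nil H =>
    have e := B.lam_unique B'
    obtain rfl : π = π' := by
      rw [← Equiv.symm_symm π, ← Equiv.symm_symm π', DFunLike.coe_injective e]
    exact ⟨by simp [wordProd], hf, by simp⟩
  | cons H J hA C ih =>
    obtain ⟨h₁, H₁⟩ := C.head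
    obtain ⟨ρ, -, hρ⟩ := H₁.isBPD
    obtain ⟨e1, e2, e3⟩ := ih hρ B'
    obtain ⟨f1, f2, -⟩ := J.perm B hρ hA
    obtain ⟨g1, g2⟩ := permLength_swap_mul f2 e2
    rw [← f1] at g1 g2
    refine ⟨?_, g1, ?_⟩
    · rw [f1, e1, wordProd_cons, mul_assoc]
    · rw [g2, e3, List.length_cons]; omega

theorem JCert.ne_id (J : JCert r v y v') (hlow : ∀ j, v r j ≠ 0 ↔ 1 ≤ j ∧ j < r) :
    tiling v h ≠ idTiling := by
  intro e
  have h1 := congrFun (congrFun e r) (y (r + 1) + 1)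
  have hc := J.col
  have hr := J.row_pos
  have h2 := hlow (y (r + 1) + 1)
  have h3 : tiling v h r (y (r + 1) + 1) = .rElbow :=
    mk_rElbow.2 ⟨by omega, by rw [J.start]; omega⟩
  rw [h3, idTiling, if_neg (by omega), if_neg (by omega), if_pos (by omega)] at h1
  cases h1

/-- Lines up to `r` stay full along the chain, so each jeu de taquin in it is the one that `Nabla`
must perform. -/
theorem JChain.gaoHuang (C : JChain k r v L v') (H : Lab k v h) (H' : Lab k v' h')
    (hlow : ∀ i, i ≤ r → ∀ j, v i j ≠ 0 ↔ 1 ≤ j ∧ j < i) {K : List (ℕ × ℕ)} :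
    GaoHuang (tiling v h) K ↔ ∃ K', K = (L.map fun c => (c, r)) ++ K' ∧
      GaoHuang (tiling v' h') K' := by
  induction C generalizing h K with
  | nil H₀ =>
    obtain rfl := H.h_unique H'
    simp
  | cons H₀ J hA C ih =>
    obtain ⟨h₁, H₁⟩ := C.head
    cases K with
    | nil =>
      refine ⟨fun e => absurd e (J.ne_id (hlow r le_rfl)), ?_⟩
      rintro ⟨K', h1, -⟩
      simp at h1
    | cons x K =>
      obtain ⟨a, s⟩ := x
      have hl : ∀ i, i ≤ r → ∀ j, _ := fun i hi j => by
        have := hlow i hi j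
        rwa [← J.above i hi] at this
      have key := fun K => ih H₁ H' hl (K := K)
      simp only [GaoHuang, J.nabla_iff H H₁ hlow hA]
      constructor
      · rintro ⟨D', ⟨rfl, rfl, rfl⟩, h2⟩
        obtain ⟨K', rfl, h3⟩ := (key _).1 h2
        exact ⟨K', rfl, h3⟩
      · rintro ⟨K', h1, h2⟩
        simp only [List.map_cons, List.cons_append, List.cons.injEq, Prod.mk.injEq] at h1
        obtain ⟨⟨rfl, rfl⟩, rfl⟩ := h1
        exact ⟨_, ⟨rfl, rfl, rfl⟩, (key _).2 ⟨K', rfl, h2⟩⟩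

end

theorem insertWord_append {T T' : Tiling} {Q Q' : List (ℕ × ℕ)} :
    InsertWord T (Q ++ Q') T' ↔ ∃ U, InsertWord T Q U ∧ InsertWord U Q' T' := by
  induction Q generalizing T with
  | nil => simp [InsertWord]
  | cons x Q ih =>
    simp only [List.cons_append, InsertWord, ih]
    constructor
    · rintro ⟨U, h1, U', h2, h3⟩
      exact ⟨U', ⟨U, h1, h2⟩, h3⟩
    · rintro ⟨U', ⟨U, h1, h2⟩, h3⟩
      exact ⟨U, h1, U', h2, h3⟩

/-- The labels of the insertion bumpless pipe dreams of the subwords of a plactic biword `Q`, and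
the jeux de taquin between them. -/
theorem exists_growth (Q : List (ℕ × ℕ)) (hQ : IsPlactic Q) :
    ∀ k, (∀ x ∈ Q, k ≤ x.2) → ∃ V H : ℕ → ℕ → ℕ → ℕ, (∀ r, Lab k (V r) (H r)) ∧
      (∀ r T, InsertWord idTiling (Q.filter fun x => r < x.1) T ↔ T = tiling (V r) (H r)) ∧
      (∀ r i, i ≤ r + 1 → ∀ j, V r i j ≠ 0 ↔ 1 ≤ j ∧ j < i) ∧
      (∀ r, ∃ L, JChain k (r + 1) (V r) L (V (r + 1))) ∧
      ∀ r, (∀ x ∈ Q, x.1 ≤ r) → V r = vId := by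
  induction Q using List.reverseRecOn with
  | nil =>
    intro k _
    refine ⟨fun _ => vId, fun _ => hId, fun _ => lab_id k, fun r T => ?_,
      fun r i _ j => vId_ne_zero, fun r => ⟨[], .nil (lab_id k)⟩, fun _ _ => rfl⟩
    rw [tiling_id]
    rfl
  | append_singleton Q x ih =>
    intro k hk
    obtain ⟨b, k₀⟩ := x
    obtain ⟨hQ1, hQ2⟩ := hQ
    rw [List.pairwise_append] at hQ2
    obtain ⟨hb, hbk⟩ := hQ1 (b, k₀) (by simp)
    simp only at hb hbk
    -- All earlier bounds are at least `k₀`, so the induction hypothesis is available with the bound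
    -- of the new letter, the one under which its insertion is analysed.
    obtain ⟨V, H, c1, c2, c3, c4, c5⟩ := ih ⟨fun y hy => hQ1 y (by simp [hy]), hQ2.1⟩ k₀
      fun y hy => hQ2.2.2 y hy (b, k₀) (by simp)
    choose σ V₁ H₁ I HL using fun r => (c1 r).exists_ins hb hbk
    have hkk : k ≤ k₀ := hk (b, k₀) (by simp)
    have lt : ∀ {r}, r < b → (if r < b then V₁ r else V r) = V₁ r := fun h => if_pos h
    have ge : ∀ {r}, ¬ r < b → (if r < b then V₁ r else V r) = V r := fun h => if_neg h
    refine ⟨fun r => if r < b then V₁ r else V r, fun r => if r < b then H₁ r else H r,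
      fun r => ?_, fun r T => ?_, fun r i hi j => ?_, fun r => ?_, fun r hr => ?_⟩
    · by_cases h : r < b
      · simp only [if_pos h]; exact (HL r).mono hkk
      · simp only [if_neg h]; exact (c1 r).mono hkk
    · rw [List.filter_append, insertWord_append]
      simp only [c2, exists_eq_left]
      by_cases h : r < b
      · simp [h, InsertWord, (I r).rightInsert_iff (c1 r) (HL r) hb hbk]
      · simp [h, InsertWord]
    · by_cases h : r < b
      · simp only [if_pos h]
        rw [(I r).above i (by omega)]
        exact c3 r i hi j
      · simp only [if_neg h]; exact c3 r i hi j
    · obtain ⟨L, C⟩ := c4 r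
      simp only
      -- The new letter enters both subwords, only the one for `r`, or neither.
      rcases lt_trichotomy (r + 1) b with h | h | h
      · rw [lt (by omega), lt h]
        obtain ⟨L', C'⟩ := C.commute (I r) (I (r + 1)) (by omega) (by omega) hbk
        exact ⟨L', C'.mono hkk⟩
      · rw [lt (by omega), ge (by omega)]
        subst h
        obtain ⟨L', C'⟩ := C.append_ins (I r) hb hbk (c1 (r + 1)) (c3 (r + 1))
        exact ⟨L', C'.mono hkk⟩
      · rw [ge (by omega), ge (by omega)]
        exact ⟨L, C.mono hkk⟩
    · have := hr (b, k₀) (by simp)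
      simp only
      rw [ge (by simpa using this)]
      exact c5 r fun y hy => hr y (by simp [hy])

/-! ### Decreasing words and the compatible sequence -/

theorem le_maxLetter {Q : List (ℕ × ℕ)} {x : ℕ × ℕ} (h : x ∈ Q) : x.1 ≤ maxLetter Q := by
  induction Q with
  | nil => simp at h
  | cons y Q ih =>
    have e : maxLetter (y :: Q) = max y.1 (maxLetter Q) := rfl
    rw [e]
    rcases List.mem_cons.1 h with rfl | h
    · exact le_max_left _ _
    · exact (ih h).trans (le_max_right _ _)

theorem wordProd_apply_of_lt {L : List ℕ} {x : ℕ} (h : ∀ a ∈ L, a + 1 < x) :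
    wordProd L x = x := by
  induction L with
  | nil => simp [wordProd]
  | cons a L ih =>
    rw [wordProd_cons, Equiv.Perm.mul_apply, ih fun b hb => h b (by simp [hb])]
    have := h a (by simp)
    exact Equiv.swap_apply_of_ne_of_ne (by omega) (by omega)

theorem wordProd_cons_apply {L : List ℕ} {a : ℕ} (h : ∀ b ∈ L, b < a) :
    wordProd (a :: L) (a + 1) = a := by
  rw [wordProd_cons, Equiv.Perm.mul_apply,
    wordProd_apply_of_lt fun b hb => Nat.succ_lt_succ (h b hb), Equiv.swap_apply_right]

/-- The product of a decreasing word with first letter `a` sends `a + 1` to `a` and fixes everything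
beyond, so it reveals `a`; cancel and repeat. -/
theorem wordProd_injective_of_pairwise {L L' : List ℕ} (hL : L.Pairwise fun c d => d < c)
    (hL' : L'.Pairwise fun c d => d < c) (h : wordProd L = wordProd L') : L = L' := by
  induction L generalizing L' with
  | nil =>
    cases L' with
    | nil => rfl
    | cons a L' =>
      have := wordProd_cons_apply (List.pairwise_cons.1 hL').1
      rw [← h] at this
      simp [wordProd] at this
  | cons a L ih =>
    cases L' with
    | nil =>
      have := wordProd_cons_apply (List.pairwise_cons.1 hL).1
      rw [h] at this
      simp [wordProd] at this
    | cons b L' =>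
      obtain ⟨h1, h2⟩ := List.pairwise_cons.1 hL
      obtain ⟨h3, h4⟩ := List.pairwise_cons.1 hL'
      have e1 := wordProd_cons_apply h1
      have e2 := wordProd_cons_apply h3
      obtain rfl : a = b := by
        rcases lt_trichotomy a b with hab | hab | hab
        · rw [← h, wordProd_apply_of_lt fun c hc => ?_] at e2
          · omega
          · rcases List.mem_cons.1 hc with rfl | hc
            · omega
            · have := h1 c hc; omega
        · exact hab
        · rw [h, wordProd_apply_of_lt fun c hc => ?_] at e1
          · omega
          · rcases List.mem_cons.1 hc with rfl | hc
            · omega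
            · have := h3 c hc; omega
      rw [wordProd_cons, wordProd_cons] at h
      rw [ih h2 h4 (mul_left_cancel h)]

theorem inversions_one : inversions 1 = ∅ := by
  ext x
  simpa [inversions] using le_of_lt

/-- The letters of `L 0, …, L (a - 1)`, those of `L i` paired with the row `i + 1`. -/
def rowWord (L : ℕ → List ℕ) (a : ℕ) : List (ℕ × ℕ) :=
  (List.range a).flatMap fun i => (L i).map fun c => (c, i + 1)

theorem labeledWord_eq (L : ℕ → List ℕ) (a : ℕ) :
    labeledWord (fun i : Fin a => L i) = rowWord L a := by
  rw [rowWord, ← List.map_coe_finRange_eq_range, List.flatMap_map]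
  rfl

theorem rowWord_succ (L : ℕ → List ℕ) (a : ℕ) :
    rowWord L (a + 1) = rowWord L a ++ (L a).map fun c => (c, a + 1) := by
  simp [rowWord, List.range_succ, List.flatMap_append]

section
variable {k : ℕ} {V H : ℕ → ℕ → ℕ → ℕ} {L : ℕ → List ℕ} {ρ : ℕ → Equiv.Perm ℕ}

theorem gaoHuang_rowWord (hV : ∀ r, Lab k (V r) (H r))
    (hlow : ∀ r i, i ≤ r + 1 → ∀ j, V r i j ≠ 0 ↔ 1 ≤ j ∧ j < i)
    (C : ∀ r, JChain k (r + 1) (V r) (L r) (V (r + 1))) (a : ℕ) {K : List (ℕ × ℕ)} :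
    GaoHuang (tiling (V 0) (H 0)) K ↔
      ∃ K', K = rowWord L a ++ K' ∧ GaoHuang (tiling (V a) (H a)) K' := by
  induction a with
  | zero => simp [rowWord]
  | succ a ih =>
    simp only [ih, (C a).gaoHuang (hV a) (hV (a + 1)) (hlow a), rowWord_succ]
    constructor
    · rintro ⟨K', rfl, K'', rfl, h⟩
      exact ⟨K'', by simp, h⟩
    · rintro ⟨K'', rfl, h⟩
      exact ⟨_, by simp, K'', rfl, h⟩

theorem perm_rowWord (hρ : ∀ r, Lbl (V r) (H r) (ρ r).symm)
    (C : ∀ r, JChain k (r + 1) (V r) (L r) (V (r + 1))) (a : ℕ)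
    (hf : (inversions (ρ a)).Finite) :
    ρ 0 = wordProd ((rowWord L a).map Prod.fst) * ρ a ∧
      permLength (ρ 0) = (rowWord L a).length + permLength (ρ a) := by
  induction a with
  | zero => simp [rowWord, wordProd]
  | succ a ih =>
    obtain ⟨h1, h2, h3⟩ := (C a).perm (hρ a) (hρ (a + 1)) hf
    obtain ⟨h4, h5⟩ := ih h2
    have e : (L a).map (Prod.fst ∘ fun c => (c, a + 1)) = L a := by simp [Function.comp_def]
    rw [rowWord_succ, List.map_append, List.map_map, e, wordProd_append, List.length_append,
      List.length_map, mul_assoc, ← h1]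
    exact ⟨h4, by omega⟩

/-- Every jeu de taquin accounts for one inversion, which makes the word reduced. Rows increase from
block to block and letters decrease inside a block, which makes it compatible. -/
theorem isCompatibleSeq_rowWord (hρ : ∀ r, Lbl (V r) (H r) (ρ r).symm)
    (C : ∀ r, JChain k (r + 1) (V r) (L r) (V (r + 1))) {a : ℕ} (ha : ρ a = 1) :
    IsCompatibleSeq (ρ 0) (rowWord L a) := by
  obtain ⟨h1, h2⟩ := perm_rowWord hρ C a (by rw [ha, inversions_one]; exact Set.finite_empty)
  refine ⟨by rw [h1, ha, mul_one], ?_, fun x hx => ?_, ?_⟩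
  · have : permLength (1 : Equiv.Perm ℕ) = 0 := by
      change (inversions _).ncard = 0
      rw [inversions_one, Set.ncard_empty]
    rw [h2, ha, this, add_zero]
  · simp only [rowWord, List.mem_flatMap, List.mem_map] at hx
    obtain ⟨i, -, c, hc, rfl⟩ := hx
    exact ⟨by simp, (C i).le c hc⟩
  · have : (rowWord L a).Pairwise fun x y => x.2 < y.2 ∨ x.2 = y.2 ∧ y.1 < x.1 := by
      rw [rowWord, List.pairwise_flatMap]
      refine ⟨fun i _ => ?_, List.pairwise_lt_range.imp fun {i j} hij => ?_⟩
      · rw [List.pairwise_map]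
        exact (C i).pairwise.imp fun h => Or.inr ⟨rfl, h⟩
      · simp only [List.mem_map]
        rintro _ ⟨c, -, rfl⟩ _ ⟨d, -, rfl⟩
        exact Or.inl (by simpa using hij)
    exact (this.imp fun {x y} h => by omega).isChain

end

end BPD

theorem mainTheorem3 (Q : List (ℕ × ℕ)) (hQ : BPD.IsPlactic Q) :
    (∃! D, BPD.IsInsertionBPD Q D) ∧ (∃ π, BPD.IsGrowthDiagram Q π) ∧
    ∀ (D : BPD.Tiling) (π : ℕ → ℕ → Equiv.Perm ℕ),
      BPD.IsInsertionBPD Q D → BPD.IsGrowthDiagram Q π →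
      BPD.IsBPD D (π 0 Q.length) ∧
      π (BPD.maxLetter Q) Q.length = 1 ∧
      (∃! s : Fin (BPD.maxLetter Q) → List ℕ,
        BPD.IsChainLetters (fun i => π i Q.length) s) ∧
      ∀ s : Fin (BPD.maxLetter Q) → List ℕ,
        BPD.IsChainLetters (fun i => π i Q.length) s →
        BPD.IsCompatibleSeq (π 0 Q.length) (BPD.labeledWord s) ∧
        ∀ L, BPD.GaoHuang D L ↔ L = BPD.labeledWord s := by
  open BPD in
  obtain ⟨V, H, c1, c2, c3, c4, c5⟩ := exists_growth Q hQ 0 fun _ _ => Nat.zero_le _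
  have hQ0 : Q.filter (fun x => 0 < x.1) = Q :=
    List.filter_eq_self.2 fun x hx => decide_eq_true (hQ.1 x hx).1
  have hIns : ∀ T, IsInsertionBPD Q T ↔ T = tiling (V 0) (H 0) := fun T => by
    have := c2 0 T
    rwa [hQ0] at this
  refine ⟨⟨_, (hIns _).2 rfl, fun T hT => (hIns T).1 hT⟩, ?_, ?_⟩
  · have hex : ∀ i j, ∃ π D, IsInsertionBPD (subword Q i j) D ∧ IsBPD D π := by
      intro i j
      have hP : IsPlactic (Q.take j) :=
        ⟨fun x hx => hQ.1 x (List.mem_of_mem_take hx), hQ.2.sublist (List.take_sublist j Q)⟩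
      obtain ⟨V, H, c1, c2, -⟩ := exists_growth _ hP 0 fun _ _ => Nat.zero_le _
      obtain ⟨π, hπ, -⟩ := (c1 i).isBPD
      exact ⟨π, _, (c2 i _).2 rfl, hπ⟩
    choose π hπ using hex
    exact ⟨π, fun i _ j _ => hπ i j⟩
  · intro D π hD hπ
    obtain rfl := (hIns D).1 hD
    choose L C using c4
    choose ρ hρ hL using fun r => (c1 r).isBPD
    have hπρ : ∀ i ≤ maxLetter Q, π i Q.length = ρ i := by
      intro i hi
      obtain ⟨D, h1, h2⟩ := hπ i hi Q.length le_rfl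
      rw [subword, List.take_length] at h1
      obtain rfl := (c2 i D).1 h1
      exact (hL i).perm_unique h2
    have hlast : ρ (maxLetter Q) = 1 := by
      have h1 := hL (maxLetter Q)
      rw [c5 _ fun x hx => le_maxLetter hx] at h1
      have := DFunLike.coe_injective (h1.lam_unique lbl_id)
      rw [← Equiv.symm_symm (ρ (maxLetter Q)), this, Equiv.symm_symm]
    -- Finiteness climbs up the chain from the identity; it is needed because `permLength` is an
    -- `ncard`.
    have hfin : ∀ n i, i + n = maxLetter Q → (inversions (ρ i)).Finite := by
      intro n
      induction n with
      | zero =>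
        intro i hi
        obtain rfl : i = maxLetter Q := hi
        rw [hlast, inversions_one]
        exact Set.finite_empty
      | succ n ih =>
        intro i hi
        exact ((C i).perm (hL i) (hL (i + 1)) (ih (i + 1) (by omega))).2.1
    have hstep : ∀ i < maxLetter Q, ρ i = wordProd (L i) * ρ (i + 1) := fun i hi =>
      ((C i).perm (hL i) (hL (i + 1)) (hfin (maxLetter Q - (i + 1)) (i + 1) (by omega))).1
    have hchain : IsChainLetters (fun i => π i Q.length)
        fun i : Fin (maxLetter Q) => L i := by
      intro i
      refine ⟨(C i).pairwise, fun c hc => ?_, ?_⟩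
      · have := (C i).le c hc
        omega
      · simp only
        rw [hπρ _ (by omega), hπρ _ (by omega)]
        exact hstep i i.2
    have huniq : ∀ s : Fin (maxLetter Q) → List ℕ,
        IsChainLetters (fun i => π i Q.length) s → s = fun i : Fin (maxLetter Q) => L i := by
      intro s hs
      funext i
      exact wordProd_injective_of_pairwise (hs i).1 (hchain i).1
        (mul_right_cancel ((hs i).2.2.symm.trans (hchain i).2.2))
    have hBPD := hρ 0
    rw [← hπρ 0 (Nat.zero_le _)] at hBPD
    refine ⟨hBPD, (hπρ _ le_rfl).trans hlast, ⟨fun i : Fin (maxLetter Q) => L i, hchain, huniq⟩, fun s hs => ?_⟩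
    obtain rfl := huniq s hs
    rw [labeledWord_eq, hπρ 0 (Nat.zero_le _)]
    refine ⟨isCompatibleSeq_rowWord hL C hlast, fun K => ?_⟩
    rw [gaoHuang_rowWord c1 c3 C (maxLetter Q)]
    have hid : tiling (V (maxLetter Q)) (H (maxLetter Q)) = idTiling := by
      have h1 := c1 (maxLetter Q)
      have h2 := c5 _ fun x hx => le_maxLetter hx
      rw [h2] at h1 ⊢
      rw [h1.h_unique (lab_id 0), tiling_id]
    simp [hid, gaoHuang_id]
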